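/- **Setting.** Fix sets of processes $p,q,r,s$, variables $x,y$, values $v$ (with a distinguished value $\mathsf{true}$), labels $\ell$, and expressions $e$. Each expression has a set of variables occurring in it ($y\in e$), and evaluates in every local memory $m$ to a value $e\downarrow_m$ that depends only on the values in $m$ of the variables occurring in $e$. A state $\sigma$ gives each process a local memory $\sigma(p)$. *Choreographies* are $C ::= H;C \mid \Phi;C \mid \mathsf{if}\ p.e\ \mathsf{then}\ C_1\ \mathsf{else}\ C_2\mid \mathsf{rec}\ X=C_2\ \mathsf{in}\ C_1\mid X\mid \mathbf 0$, where $H$ is a finite set of communications $p.e\to q.y$ and $\Phi$ a finite set of selections $p\to q[\ell]$, always with $p\ne q$. Every invocation $X$ refers to an enclosing definition ($X$ is bound in both $C_1$ and $C_2$), and all groups are well-formed: (a) two distinct communications $p.e\to q.y$, $r.e'\to q.y'$ in the same $H$ have $y\neq y'$ and $p\ne r$; (b) if $p.e\to q.y$ and $q.e'\to r.y'$ are in the same $H$, then $y\notin e'$; (c) if $p\to q[\ell]$ and $r\to s[\ell']$ are distinct and in the same $\Phi$, then $q\notin\{r,s\}$. *Concurrent semantics.* $\preceq_c$ is the least preorder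 on choreographies, closed under prefixing, both branches of a conditional and the scope $C_1$ of a definition, such that, writing $\equiv$ for $\preceq_c$ in both directions: $\mathsf{rec}\ X=C_2\ \mathsf{in}\ C_1[X]\preceq_c\mathsf{rec}\ X=C_2\ \mathsf{in}\ C_1[C_2]$ (one occurrence of $X$, not inside the body of another definition, is replaced without variable capture); $\mathsf{rec}\ X=C\ \mathsf{in}\ \mathbf 0\preceq_c\mathbf 0$; $\emptyset;C\preceq_c C$ for both kinds of empty group; $(H_1\uplus H_2);C\equiv H_1;H_2;C$ and $(\Phi_1\uplus\Phi_2);C\equiv\Phi_1;\Phi_2;C$ if the disjoint unions are well-formed; $H;\Phi;C\equiv\Phi;H;C$ if no target of $\Phi$ occurs in $H$; $\mathsf{if}\ p.e\ \mathsf{then}\ (H;C_1)\ \mathsf{else}\ (H;C_2)\equiv H;\mathsf{if}\ p.e\ \mathsf{then}\ C_1\ \mathsf{else}\ C_2$ if $x\notin e$ whenever some $q.e'\to p.x\in H$; the same for $\Phi$ instead of $H$ if $p$ is no target of $\Phi$; $\mathsf{rec}\ X=C_2\ \mathsf{in}\ (H;C_1)\equiv H;\mathsf{rec}\ X=C_2\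 \mathsf{in}\ C_1$ and the same for $\Phi$; $\mathsf{rec}\ X=C_2\ \mathsf{in}\ (\mathsf{if}\ p.e\ \mathsf{then}\ C\ \mathsf{else}\ C')\equiv\mathsf{if}\ p.e\ \mathsf{then}\ (\mathsf{rec}\ X=C_2\ \mathsf{in}\ C)\ \mathsf{else}\ (\mathsf{rec}\ X=C_2\ \mathsf{in}\ C')$; and nested conditionals on $p.e_1$ and $q.e_2$ may be exchanged, i.e. $\mathsf{if}\ p.e_1\ \mathsf{then}\ (\mathsf{if}\ q.e_2\ \mathsf{then}\ C_{11}\ \mathsf{else}\ C_{12})\ \mathsf{else}\ (\mathsf{if}\ q.e_2\ \mathsf{then}\ C_{21}\ \mathsf{else}\ C_{22})\equiv\mathsf{if}\ q.e_2\ \mathsf{then}\ (\mathsf{if}\ p.e_1\ \mathsf{then}\ C_{11}\ \mathsf{else}\ C_{21})\ \mathsf{else}\ (\mathsf{if}\ p.e_1\ \mathsf{then}\ C_{12}\ \mathsf{else}\ C_{22})$. The relation $\to_c$ is the least one with: $\{p.e\to q.y\};C,\sigma\to_c C,\sigma[q.y\mapsto e\downarrow_{\sigma(p)}]$; $\{p\to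 q[\ell]\};C,\sigma\to_c C,\sigma$; $\mathsf{if}\ p.e\ \mathsf{then}\ C_1\ \mathsf{else}\ C_2,\sigma\to_c C_i,\sigma$ with $i=1$ if $e\downarrow_{\sigma(p)}=\mathsf{true}$ and $i=2$ otherwise; closed under reduction in the scope $C_1$ of $\mathsf{rec}\ X=C_2\ \mathsf{in}\ C_1$, and under $\preceq_c$ before and after a step. *Networks* are $N::=\mathbf 0\mid p\triangleright B\mid N\,|\,N$ with behaviours $B::=\Theta;B\mid S;B\mid p\&\{\ell:B_\ell\}_{\ell\in I}\mid\mathsf{if}\ e\ \mathsf{then}\ B_1\ \mathsf{else}\ B_2\mid\mathsf{rec}\ X=B_2\ \mathsf{in}\ B_1\mid X\mid\mathbf 0$, where $\Theta$ is a finite set of actions $q!e$ (send) and $q?x$ (receive), $S$ a finite set of selections $q\oplus\ell$, and $I$ is finite. The precongruence $\preceq$ on networks is generated by associativity and commutativity of $|$, $\mathbf 0\,|\,N\preceq N$, $p\triangleright\mathbf 0\preceq\mathbf 0$ and, inside behaviours (in the contexts analogous to those above, including branches), unfolding, $\mathsf{rec}\ X=B\ \mathsf{in}\ \mathbf 0\preceq\mathbf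 0$, and removal of empty groups. Steps, closed under parallel composition, $\preceq$ before and after, and the scope of a process's recursive definition, are: $p\triangleright\Theta;B\,|\,q\triangleright\Theta';B',\sigma\to p\triangleright(\Theta\setminus\{q!e\});B\,|\,q\triangleright(\Theta'\setminus\{p?x\});B',\sigma[q.x\mapsto e\downarrow_{\sigma(p)}]$ if $q!e\in\Theta$ and $p?x\in\Theta'$; $p\triangleright S;B\,|\,q\triangleright p\&\{\ell:B_\ell\}_{\ell\in J},\sigma\to p\triangleright (S\setminus\{q\oplus\ell\});B\,|\,q\triangleright B_\ell,\sigma$ if $q\oplus\ell\in S$ and $\ell\in J$; and $p\triangleright\mathsf{if}\ e\ \mathsf{then}\ B_1\ \mathsf{else}\ B_2,\sigma\to p\triangleright B_i,\sigma$, with $i$ chosen as above. *Projection.* Let $\mathrm{pn}(C)$ be the set of processes appearing in $C$, and annotate each procedure name with the set of processes appearing in its body (including those of outer procedures invoked there). The partial operation $B\sqcup B'$ is defined homomorphically when $B$ and $B'$ agree up to branching, with $p\&\{\ell:B_\ell\}_{I}\sqcup p\&\{\ell:B'_\ell\}_{J}$ having label set $I\cup J$, the merge $B_\ell\sqcup B'_\ell$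 on $I\cap J$, and the given branch elsewhere. The (partial) projection $[\![C]\!]_r$ is: $[\![\mathbf 0]\!]_r=\mathbf 0$; $[\![H;C]\!]_r=\{q!e\mid r.e\to q.y\in H\}\cup\{p?y\mid p.e\to r.y\in H\};[\![C]\!]_r$; $[\![\Phi;C]\!]_r=p\&\{\ell:[\![C]\!]_r\}$ if $p\to r[\ell]\in\Phi$, and $\{q\oplus\ell\mid r\to q[\ell]\in\Phi\};[\![C]\!]_r$ otherwise (in both cases an empty group is omitted); $[\![\mathsf{if}\ p.e\ \mathsf{then}\ C_1\ \mathsf{else}\ C_2]\!]_r=\mathsf{if}\ e\ \mathsf{then}\ [\![C_1]\!]_r\ \mathsf{else}\ [\![C_2]\!]_r$ if $p=r$, and $[\![C_1]\!]_r\sqcup[\![C_2]\!]_r$ otherwise; $[\![\mathsf{rec}\ X=C_2\ \mathsf{in}\ C_1]\!]_r=\mathsf{rec}\ X=[\![C_2]\!]_r\ \mathsf{in}\ [\![C_1]\!]_r$ and $[\![X]\!]_r=X$ if $r$ is in the annotation of $X$, and $[\![C_1]\!]_r$, respectively $\mathbf 0$, otherwise. The endpoint projection is $[\![C]\!]=\prod_{p\in\mathrm{pn}(C)}p\triangleright[\![C]\!]_p$,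 and $C$ is *projectable* if it is defined. *Pruning* $N\sqsubset M$ means that, up to structural congruence (the equivalence generated by $\preceq$), $N$ results from $M$ by dropping branches of branching terms. **Theorem.** Let $C$ be a projectable choreography. 1. If $C,\sigma\to_c C',\sigma'$, then there are $N$, $C''$ and $\sigma''$ such that $C''$ is projectable, $[\![C'']\!]\sqsubset N$, $C',\sigma'\to_c^{*}C'',\sigma''$, and $[\![C]\!],\sigma\to^{+}N,\sigma''$. 2. If $[\![C]\!],\sigma\to N,\sigma'$, then there is a projectable $C'$ such that $[\![C']\!]\sqsubset N$ and $C,\sigma\to_c C',\sigma'$. -/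

import Mathlib

/-! Choreographies with grouped interactions (multicoms and multisels), their concurrent
semantics, process networks, and endpoint projection.

Procedure names are represented by de Bruijn indices: `call k` refers to the `k`-th enclosing
recursive definition, and `recd C₂ C₁` (in mathematical notation `rec X = C₂ in C₁`) binds
index `0` both in the procedure body `C₂` and in the scope `C₁`. -/

namespace Multicom

/-- A language of local expressions: its free variables, a total evaluation function on local
memories, and the value `true`. Evaluation depends only on the variables that occur in the
expression. -/
structure ExprLang (Var Val Expr : Type*) where
  vars : Expr → Set Var
  eval : Expr → (Var → Val) → Val
  tt : Val
  eval_congr : ∀ (e : Expr) (s t : Var → Val), (∀ x ∈ vars e, s x = t x) → eval e s = eval e t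

/-- A value communication `src.e → tgt.y`. -/
structure Com (Pid Var Expr : Type*) where
  src : Pid
  expr : Expr
  tgt : Pid
  var : Var

/-- A selection `src → tgt[lbl]`. -/
structure Sel (Pid Lbl : Type*) where
  src : Pid
  tgt : Pid
  lbl : Lbl

/-- Choreographies. -/
inductive Chor (Pid Var Expr Lbl : Type*) where
  | com (H : Finset (Com Pid Var Expr)) (C : Chor Pid Var Expr Lbl)
  | sel (Φ : Finset (Sel Pid Lbl)) (C : Chor Pid Var Expr Lbl)
  | ite (p : Pid) (e : Expr) (C₁ C₂ : Chor Pid Var Expr Lbl)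
  | recd (C₂ C₁ : Chor Pid Var Expr Lbl)
  | call (k : ℕ)
  | nil

/-- Memory configurations. -/
abbrev State (Pid Var Val : Type*) := Pid → Var → Val

/-- `σ[q.y ↦ v]` -/
def State.set {Pid Var Val : Type*} [DecidableEq Pid] [DecidableEq Var]
    (σ : State Pid Var Val) (q : Pid) (y : Var) (v : Val) : State Pid Var Val :=
  Function.update σ q (Function.update (σ q) y v)

section Choreographies

variable {Pid Var Val Expr Lbl : Type*}

/-- Well-formed multicoms (without self-communications). -/
def WFCom (L : ExprLang Var Val Expr) (H : Finset (Com Pid Var Expr)) : Prop :=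
  (∀ η ∈ H, η.src ≠ η.tgt) ∧
  (∀ η ∈ H, ∀ η' ∈ H, η ≠ η' → η.tgt = η'.tgt → η.var ≠ η'.var ∧ η.src ≠ η'.src) ∧
  (∀ η ∈ H, ∀ η' ∈ H, η.tgt = η'.src → η.var ∉ L.vars η'.expr)

/-- Well-formed multisels (without self-selections). -/
def WFSel (Φ : Finset (Sel Pid Lbl)) : Prop :=
  (∀ φ ∈ Φ, φ.src ≠ φ.tgt) ∧
  (∀ φ ∈ Φ, ∀ φ' ∈ Φ, φ ≠ φ' → φ.tgt ≠ φ'.src ∧ φ.tgt ≠ φ'.tgt)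

namespace Chor

/-- All multicoms and multisels of the choreography are well-formed. -/
def WF (L : ExprLang Var Val Expr) : Chor Pid Var Expr Lbl → Prop
  | com H C => WFCom L H ∧ C.WF L
  | sel Φ C => WFSel Φ ∧ C.WF L
  | ite _ _ C₁ C₂ => C₁.WF L ∧ C₂.WF L
  | recd C₂ C₁ => C₂.WF L ∧ C₁.WF L
  | call _ => True
  | nil => True

/-- Every invocation refers to one of the enclosing definitions or to one of `n` outer ones. -/
def ClosedAt : ℕ → Chor Pid Var Expr Lbl → Prop
  | n, com _ C => C.ClosedAt n
  | n, sel _ C => C.ClosedAt n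
  | n, ite _ _ C₁ C₂ => C₁.ClosedAt n ∧ C₂.ClosedAt n
  | n, recd C₂ C₁ => C₂.ClosedAt (n + 1) ∧ C₁.ClosedAt (n + 1)
  | n, call k => k < n
  | _, nil => True

/-- All procedure invocations refer to defined procedures. -/
def Closed (C : Chor Pid Var Expr Lbl) : Prop := C.ClosedAt 0

/-- `lift d c C` adds `d` to the indices in `C` that are not bound by the innermost `c`
binders. -/
def lift (d : ℕ) : ℕ → Chor Pid Var Expr Lbl → Chor Pid Var Expr Lbl
  | c, com H C => com H (lift d c C)
  | c, sel Φ C => sel Φ (lift d c C)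
  | c, ite p e C₁ C₂ => ite p e (lift d c C₁) (lift d c C₂)
  | c, recd C₂ C₁ => recd (lift d (c + 1) C₂) (lift d (c + 1) C₁)
  | c, call k => call (if k < c then k else k + d)
  | _, nil => nil

/-- `Repl D n C C'`: one invocation of procedure `n` in `C` (not inside the body of another
definition) is replaced in `C'` by the procedure body `D`. Here `D` lives in the scope in
which the procedure has index `0`, and `n` counts the binders passed on the way to the
occurrence. -/
inductive Repl (D : Chor Pid Var Expr Lbl) :
    ℕ → Chor Pid Var Expr Lbl → Chor Pid Var Expr Lbl → Prop
  | here (n) : Repl D n (call n) (lift n 0 D)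
  | com {n C C'} (H) : Repl D n C C' → Repl D n (com H C) (com H C')
  | sel {n C C'} (Φ) : Repl D n C C' → Repl D n (sel Φ C) (sel Φ C')
  | iteL {n C₁ C₁'} (p e C₂) : Repl D n C₁ C₁' → Repl D n (ite p e C₁ C₂) (ite p e C₁' C₂)
  | iteR {n C₂ C₂'} (p e C₁) : Repl D n C₂ C₂' → Repl D n (ite p e C₁ C₂) (ite p e C₁ C₂')
  | recd {n C₁ C₁'} (C₂) : Repl D (n + 1) C₁ C₁' → Repl D n (recd C₂ C₁) (recd C₂ C₁')

/-- The exchange axioms of the concurrent semantics, to be read as equivalences `≡`. -/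
inductive Swap (L : ExprLang Var Val Expr) :
    Chor Pid Var Expr Lbl → Chor Pid Var Expr Lbl → Prop
  | comCom (H₁ H₂ : Finset (Com Pid Var Expr)) (h : Disjoint H₁ H₂) (C) :
      WFCom L (H₁.disjUnion H₂ h) →
      Swap L (com (H₁.disjUnion H₂ h) C) (com H₁ (com H₂ C))
  | selSel (Φ₁ Φ₂ : Finset (Sel Pid Lbl)) (h : Disjoint Φ₁ Φ₂) (C) :
      WFSel (Φ₁.disjUnion Φ₂ h) →
      Swap L (sel (Φ₁.disjUnion Φ₂ h) C) (sel Φ₁ (sel Φ₂ C))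
  | comSel (H : Finset (Com Pid Var Expr)) (Φ : Finset (Sel Pid Lbl)) (C) :
      (∀ φ ∈ Φ, ∀ η ∈ H, φ.tgt ≠ η.src ∧ φ.tgt ≠ η.tgt) →
      Swap L (com H (sel Φ C)) (sel Φ (com H C))
  | comIte (H : Finset (Com Pid Var Expr)) (p : Pid) (e : Expr) (C₁ C₂) :
      (∀ η ∈ H, η.tgt = p → η.var ∉ L.vars e) →
      Swap L (ite p e (com H C₁) (com H C₂)) (com H (ite p e C₁ C₂))
  | selIte (Φ : Finset (Sel Pid Lbl)) (p : Pid) (e : Expr) (C₁ C₂) :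
      (∀ φ ∈ Φ, φ.tgt ≠ p) →
      Swap L (ite p e (sel Φ C₁) (sel Φ C₂)) (sel Φ (ite p e C₁ C₂))
  | comRec (H : Finset (Com Pid Var Expr)) (C₁ C₂) :
      Swap L (recd C₂ (com H C₁)) (com H (recd C₂ C₁))
  | selRec (Φ : Finset (Sel Pid Lbl)) (C₁ C₂) :
      Swap L (recd C₂ (sel Φ C₁)) (sel Φ (recd C₂ C₁))
  | iteRec (p : Pid) (e : Expr) (C₁ C₁' C₂) :
      Swap L (recd C₂ (ite p e C₁ C₁')) (ite p e (recd C₂ C₁) (recd C₂ C₁'))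
  | iteIte (p q : Pid) (e₁ e₂ : Expr) (C₁₁ C₁₂ C₂₁ C₂₂) :
      Swap L (ite p e₁ (ite q e₂ C₁₁ C₁₂) (ite q e₂ C₂₁ C₂₂))
        (ite q e₂ (ite p e₁ C₁₁ C₂₁) (ite p e₁ C₁₂ C₂₂))

/-- The structural precongruence of the concurrent semantics. It is closed under prefixing,
conditionals, and the scope of recursive definitions. -/
inductive Pre (L : ExprLang Var Val Expr) :
    Chor Pid Var Expr Lbl → Chor Pid Var Expr Lbl → Prop
  | refl (C) : Pre L C C
  | trans {C₁ C₂ C₃} : Pre L C₁ C₂ → Pre L C₂ C₃ → Pre L C₁ C₃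
  | com (H) {C C'} : Pre L C C' → Pre L (com H C) (com H C')
  | sel (Φ) {C C'} : Pre L C C' → Pre L (sel Φ C) (sel Φ C')
  | ite (p e) {C₁ C₁' C₂ C₂'} : Pre L C₁ C₁' → Pre L C₂ C₂' →
      Pre L (ite p e C₁ C₂) (ite p e C₁' C₂')
  | recd (C₂) {C₁ C₁'} : Pre L C₁ C₁' → Pre L (recd C₂ C₁) (recd C₂ C₁')
  | unfold {C₁ C₁' C₂} : Repl C₂ 0 C₁ C₁' → Pre L (recd C₂ C₁) (recd C₂ C₁')
  | defNil (C) : Pre L (recd C nil) nil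
  | comEmpty (C) : Pre L (com ∅ C) C
  | selEmpty (C) : Pre L (sel ∅ C) C
  | swap {C C'} : Swap L C C' → Pre L C C'
  | swapSymm {C C'} : Swap L C C' → Pre L C' C

/-- The concurrent semantics `C, σ →_c C', σ'`. -/
inductive Step [DecidableEq Pid] [DecidableEq Var] (L : ExprLang Var Val Expr) :
    Chor Pid Var Expr Lbl × State Pid Var Val → Chor Pid Var Expr Lbl × State Pid Var Val → Prop
  | com (η : Com Pid Var Expr) (C σ) :
      Step L (com {η} C, σ) (C, σ.set η.tgt η.var (L.eval η.expr (σ η.src)))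
  | sel (φ : Sel Pid Lbl) (C σ) : Step L (sel {φ} C, σ) (C, σ)
  | iteTrue (p e C₁ C₂ σ) : L.eval e (σ p) = L.tt → Step L (ite p e C₁ C₂, σ) (C₁, σ)
  | iteFalse (p e C₁ C₂ σ) : L.eval e (σ p) ≠ L.tt → Step L (ite p e C₁ C₂, σ) (C₂, σ)
  | str {C₁ C₂ C₂' C₁' σ σ'} : Pre L C₁ C₂ → Step L (C₂, σ) (C₂', σ') → Pre L C₂' C₁' →
      Step L (C₁, σ) (C₁', σ')
  | ctx {C₁ C₁' σ σ'} (C₂) : Step L (C₁, σ) (C₁', σ') →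
      Step L (recd C₂ C₁, σ) (recd C₂ C₁', σ')

/-- The processes of a choreography; `Γ` lists the processes of the procedures in scope. The
processes of a procedure are those appearing in its body, including those of the outer
procedures invoked there; its own recursive invocations add nothing. -/
def pn [DecidableEq Pid] : List (Finset Pid) → Chor Pid Var Expr Lbl → Finset Pid
  | Γ, com H C => H.image Com.src ∪ H.image Com.tgt ∪ pn Γ C
  | Γ, sel Φ C => Φ.image Sel.src ∪ Φ.image Sel.tgt ∪ pn Γ C
  | Γ, ite p _ C₁ C₂ => {p} ∪ pn Γ C₁ ∪ pn Γ C₂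
  | Γ, recd C₂ C₁ => pn (∅ :: Γ) C₂ ∪ pn (pn (∅ :: Γ) C₂ :: Γ) C₁
  | Γ, call k => Γ.getD k ∅
  | _, nil => ∅

end Chor

end Choreographies

/-- Actions of a process inside a group: `q!e` and `q?x`. -/
inductive Act (Pid Var Expr : Type*) where
  | send (q : Pid) (e : Expr)
  | recv (q : Pid) (x : Var)
  deriving DecidableEq

/-- Behaviours. In `sel S B`, the pair `(q, ℓ)` stands for the selection of `ℓ` at `q`;
`branch p I f` is `p & {ℓ : f ℓ}` with `ℓ` ranging over `I`. Procedure names are de Bruijn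
indices as for choreographies. -/
inductive Beh (Pid Var Expr Lbl : Type*) where
  | com (Θ : Finset (Act Pid Var Expr)) (B : Beh Pid Var Expr Lbl)
  | sel (S : Finset (Pid × Lbl)) (B : Beh Pid Var Expr Lbl)
  | branch (p : Pid) (I : Finset Lbl) (f : I → Beh Pid Var Expr Lbl)
  | ite (e : Expr) (B₁ B₂ : Beh Pid Var Expr Lbl)
  | recd (B₂ B₁ : Beh Pid Var Expr Lbl)
  | call (k : ℕ)
  | nil

/-- Networks. -/
inductive Net (Pid Var Expr Lbl : Type*) where
  | nil
  | proc (p : Pid) (B : Beh Pid Var Expr Lbl)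
  | par (N M : Net Pid Var Expr Lbl)

section Processes

variable {Pid Var Val Expr Lbl : Type*}

namespace Beh

/-- `lift d c B` adds `d` to the indices in `B` that are not bound by the innermost `c`
binders. -/
def lift (d : ℕ) : ℕ → Beh Pid Var Expr Lbl → Beh Pid Var Expr Lbl
  | c, com Θ B => com Θ (lift d c B)
  | c, sel S B => sel S (lift d c B)
  | c, branch p I f => branch p I (fun ℓ => lift d c (f ℓ))
  | c, ite e B₁ B₂ => ite e (lift d c B₁) (lift d c B₂)
  | c, recd B₂ B₁ => recd (lift d (c + 1) B₂) (lift d (c + 1) B₁)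
  | c, call k => call (if k < c then k else k + d)
  | _, nil => nil

/-- One invocation of procedure `n` (not inside the body of another definition) is replaced by
the procedure body `D`; compare `Chor.Repl`. -/
inductive Repl (D : Beh Pid Var Expr Lbl) :
    ℕ → Beh Pid Var Expr Lbl → Beh Pid Var Expr Lbl → Prop
  | here (n) : Repl D n (call n) (lift n 0 D)
  | com {n B B'} (Θ) : Repl D n B B' → Repl D n (com Θ B) (com Θ B')
  | sel {n B B'} (S) : Repl D n B B' → Repl D n (sel S B) (sel S B')
  | branch {n} (p : Pid) (I : Finset Lbl) (f g : I → Beh Pid Var Expr Lbl) (ℓ : I) :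
      Repl D n (f ℓ) (g ℓ) → (∀ ℓ', ℓ' ≠ ℓ → g ℓ' = f ℓ') →
      Repl D n (branch p I f) (branch p I g)
  | iteL {n B₁ B₁'} (e B₂) : Repl D n B₁ B₁' → Repl D n (ite e B₁ B₂) (ite e B₁' B₂)
  | iteR {n B₂ B₂'} (e B₁) : Repl D n B₂ B₂' → Repl D n (ite e B₁ B₂) (ite e B₁ B₂')
  | recd {n B₁ B₁'} (B₂) : Repl D (n + 1) B₁ B₁' → Repl D n (recd B₂ B₁) (recd B₂ B₁')

/-- Structural precongruence on behaviours. -/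
inductive Pre : Beh Pid Var Expr Lbl → Beh Pid Var Expr Lbl → Prop
  | refl (B) : Pre B B
  | trans {B₁ B₂ B₃} : Pre B₁ B₂ → Pre B₂ B₃ → Pre B₁ B₃
  | com (Θ) {B B'} : Pre B B' → Pre (com Θ B) (com Θ B')
  | sel (S) {B B'} : Pre B B' → Pre (sel S B) (sel S B')
  | branch (p : Pid) (I : Finset Lbl) (f g : I → Beh Pid Var Expr Lbl) :
      (∀ ℓ, Pre (f ℓ) (g ℓ)) → Pre (branch p I f) (branch p I g)
  | ite (e) {B₁ B₁' B₂ B₂'} : Pre B₁ B₁' → Pre B₂ B₂' → Pre (ite e B₁ B₂) (ite e B₁' B₂')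
  | recd (B₂) {B₁ B₁'} : Pre B₁ B₁' → Pre (recd B₂ B₁) (recd B₂ B₁')
  | unfold {B₁ B₁' B₂} : Repl B₂ 0 B₁ B₁' → Pre (recd B₂ B₁) (recd B₂ B₁')
  | defNil (B) : Pre (recd B nil) nil
  | comEmpty (B) : Pre (com ∅ B) B
  | selEmpty (B) : Pre (sel ∅ B) B

/-- The graph of the partial merging operator: `Merge B B' B''` means `B ⊔ B' = B''`. The two
behaviours agree up to branching; branches with distinct labels are all included. -/
inductive Merge [DecidableEq Lbl] :
    Beh Pid Var Expr Lbl → Beh Pid Var Expr Lbl → Beh Pid Var Expr Lbl → Prop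
  | com (Θ) {B B' B''} : Merge B B' B'' → Merge (com Θ B) (com Θ B') (com Θ B'')
  | sel (S) {B B' B''} : Merge B B' B'' → Merge (sel S B) (sel S B') (sel S B'')
  | branch (p : Pid) (I J : Finset Lbl) (f : I → Beh Pid Var Expr Lbl)
      (g : J → Beh Pid Var Expr Lbl) (h : ↥(I ∪ J) → Beh Pid Var Expr Lbl) :
      (∀ ℓ (hI : ℓ ∈ I) (hJ : ℓ ∈ J),
        Merge (f ⟨ℓ, hI⟩) (g ⟨ℓ, hJ⟩) (h ⟨ℓ, Finset.mem_union_left J hI⟩)) →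
      (∀ ℓ (hI : ℓ ∈ I), ℓ ∉ J → h ⟨ℓ, Finset.mem_union_left J hI⟩ = f ⟨ℓ, hI⟩) →
      (∀ ℓ (hJ : ℓ ∈ J), ℓ ∉ I → h ⟨ℓ, Finset.mem_union_right I hJ⟩ = g ⟨ℓ, hJ⟩) →
      Merge (branch p I f) (branch p J g) (branch p (I ∪ J) h)
  | ite (e) {B₁ B₁' B₁'' B₂ B₂' B₂''} : Merge B₁ B₁' B₁'' → Merge B₂ B₂' B₂'' →
      Merge (ite e B₁ B₂) (ite e B₁' B₂') (ite e B₁'' B₂'')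
  | recd {B₁ B₁' B₁'' B₂ B₂' B₂''} : Merge B₂ B₂' B₂'' → Merge B₁ B₁' B₁'' →
      Merge (recd B₂ B₁) (recd B₂' B₁') (recd B₂'' B₁'')
  | call (k) : Merge (call k) (call k) (call k)
  | nil : Merge nil nil nil

/-- `Prune B B'`: the behaviour `B` results from `B'` by dropping branches. -/
inductive Prune : Beh Pid Var Expr Lbl → Beh Pid Var Expr Lbl → Prop
  | com (Θ) {B B'} : Prune B B' → Prune (com Θ B) (com Θ B')
  | sel (S) {B B'} : Prune B B' → Prune (sel S B) (sel S B')
  | branch (p : Pid) (I J : Finset Lbl) (hIJ : I ⊆ J) (f : I → Beh Pid Var Expr Lbl)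
      (g : J → Beh Pid Var Expr Lbl) :
      (∀ ℓ : I, Prune (f ℓ) (g ⟨ℓ, hIJ ℓ.2⟩)) → Prune (branch p I f) (branch p J g)
  | ite (e) {B₁ B₁' B₂ B₂'} : Prune B₁ B₁' → Prune B₂ B₂' →
      Prune (ite e B₁ B₂) (ite e B₁' B₂')
  | recd {B₁ B₁' B₂ B₂'} : Prune B₂ B₂' → Prune B₁ B₁' → Prune (recd B₂ B₁) (recd B₂' B₁')
  | call (k) : Prune (call k) (call k)
  | nil : Prune nil nil

/-- `Θ; B`, where an empty group is omitted. -/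
def comOpt [DecidableEq Pid] [DecidableEq Var] [DecidableEq Expr]
    (Θ : Finset (Act Pid Var Expr)) (B : Beh Pid Var Expr Lbl) : Beh Pid Var Expr Lbl :=
  if Θ = ∅ then B else com Θ B

/-- A group of selections followed by `B`, where an empty group is omitted. -/
def selOpt [DecidableEq Pid] [DecidableEq Lbl]
    (S : Finset (Pid × Lbl)) (B : Beh Pid Var Expr Lbl) : Beh Pid Var Expr Lbl :=
  if S = ∅ then B else sel S B

end Beh

namespace Net

/-- Structural precongruence on networks. Parallel composition is associative and
commutative (`parAssoc` in the other direction follows by `parComm`). -/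
inductive Pre : Net Pid Var Expr Lbl → Net Pid Var Expr Lbl → Prop
  | refl (N) : Pre N N
  | trans {N₁ N₂ N₃} : Pre N₁ N₂ → Pre N₂ N₃ → Pre N₁ N₃
  | par {N N' M M'} : Pre N N' → Pre M M' → Pre (par N M) (par N' M')
  | proc (p) {B B'} : Beh.Pre B B' → Pre (proc p B) (proc p B')
  | parComm (N M) : Pre (par N M) (par M N)
  | parAssoc (N₁ N₂ N₃) : Pre (par (par N₁ N₂) N₃) (par N₁ (par N₂ N₃))
  | parNil (N) : Pre (par nil N) N
  | procNil (p) : Pre (proc p Beh.nil) nil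

/-- The semantics `N, σ → N', σ'` of networks. -/
inductive Step [DecidableEq Pid] [DecidableEq Var] [DecidableEq Expr] [DecidableEq Lbl]
    (L : ExprLang Var Val Expr) :
    Net Pid Var Expr Lbl × State Pid Var Val → Net Pid Var Expr Lbl × State Pid Var Val → Prop
  | com (p q : Pid) (e : Expr) (x : Var) (Θ Θ' : Finset (Act Pid Var Expr)) (B B' σ) :
      Act.send q e ∈ Θ → Act.recv p x ∈ Θ' →
      Step L (par (proc p (Beh.com Θ B)) (proc q (Beh.com Θ' B')), σ)
        (par (proc p (Beh.com (Θ.erase (Act.send q e)) B))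
          (proc q (Beh.com (Θ'.erase (Act.recv p x)) B')),
          σ.set q x (L.eval e (σ p)))
  | sel (p q : Pid) (S : Finset (Pid × Lbl)) (B) (J : Finset Lbl)
      (f : J → Beh Pid Var Expr Lbl) (ℓ : J) (σ) :
      (q, (ℓ : Lbl)) ∈ S →
      Step L (par (proc p (Beh.sel S B)) (proc q (Beh.branch p J f)), σ)
        (par (proc p (Beh.sel (S.erase (q, (ℓ : Lbl))) B)) (proc q (f ℓ)), σ)
  | iteTrue (p e B₁ B₂ σ) : L.eval e (σ p) = L.tt →
      Step L (proc p (Beh.ite e B₁ B₂), σ) (proc p B₁, σ)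
  | iteFalse (p e B₁ B₂ σ) : L.eval e (σ p) ≠ L.tt →
      Step L (proc p (Beh.ite e B₁ B₂), σ) (proc p B₂, σ)
  | ctx {p B₁ B₁' N N' σ σ'} (B₂) :
      Step L (par (proc p B₁) N, σ) (par (proc p B₁') N', σ') →
      Step L (par (proc p (Beh.recd B₂ B₁)) N, σ) (par (proc p (Beh.recd B₂ B₁')) N', σ')
  | par {N N' σ σ'} (M) : Step L (N, σ) (N', σ') → Step L (par N M, σ) (par N' M, σ')
  | str {N M M' N' σ σ'} : Pre N M → Step L (M, σ) (M', σ') → Pre M' N' →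
      Step L (N, σ) (N', σ')

/-- Pruning on networks, process by process. -/
inductive Prune₀ : Net Pid Var Expr Lbl → Net Pid Var Expr Lbl → Prop
  | nil : Prune₀ nil nil
  | proc (p) {B B'} : Beh.Prune B B' → Prune₀ (proc p B) (proc p B')
  | par {N N' M M'} : Prune₀ N N' → Prune₀ M M' → Prune₀ (par N M) (par N' M')

/-- Structural congruence: the equivalence generated by the precongruence. -/
def Congr : Net Pid Var Expr Lbl → Net Pid Var Expr Lbl → Prop := Relation.EqvGen Pre

/-- The pruning relation `N ⊏ M`, on networks up to structural congruence: `N` results from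
`M` by dropping branches. -/
def Prune (N M : Net Pid Var Expr Lbl) : Prop :=
  ∃ N' M', Congr N N' ∧ Prune₀ N' M' ∧ Congr M' M

/-- The parallel composition of the processes `p ▷ B p` for `p` in a list. -/
def prod (B : Pid → Beh Pid Var Expr Lbl) (l : List Pid) : Net Pid Var Expr Lbl :=
  l.foldr (fun p N => par (proc p (B p)) N) nil

end Net

section Projection

variable [DecidableEq Pid] [DecidableEq Var] [DecidableEq Expr] [DecidableEq Lbl]

/-- The actions of `r` in a multicom. -/
def actsOf (r : Pid) (H : Finset (Com Pid Var Expr)) : Finset (Act Pid Var Expr) :=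
  (H.filter (fun η => η.src = r)).image (fun η => Act.send η.tgt η.expr) ∪
    (H.filter (fun η => η.tgt = r)).image (fun η => Act.recv η.src η.var)

/-- The selections sent by `r` in a multisel. -/
def selsOf (r : Pid) (Φ : Finset (Sel Pid Lbl)) : Finset (Pid × Lbl) :=
  (Φ.filter (fun φ => φ.src = r)).image (fun φ => (φ.tgt, φ.lbl))

/-- The graph of behaviour projection: `Proj r Γ C B` means that the projection of `C` on `r` is
defined and equal to `B`, where `Γ` lists the process annotations of the procedures in scope. A
definition is kept if `r` is among its processes, and the index of an invocation counts only the
definitions that are kept. -/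
inductive Proj (r : Pid) :
    List (Finset Pid) → Chor Pid Var Expr Lbl → Beh Pid Var Expr Lbl → Prop
  | nil (Γ) : Proj r Γ Chor.nil Beh.nil
  | com {Γ C B} (H) : Proj r Γ C B →
      Proj r Γ (Chor.com H C) (Beh.comOpt (actsOf r H) B)
  | selRecv {Γ C B} (Φ : Finset (Sel Pid Lbl)) (φ : Sel Pid Lbl) : φ ∈ Φ → φ.tgt = r →
      Proj r Γ C B →
      Proj r Γ (Chor.sel Φ C) (Beh.branch φ.src {φ.lbl} (fun _ => B))
  | selSend {Γ C B} (Φ : Finset (Sel Pid Lbl)) : (∀ φ ∈ Φ, φ.tgt ≠ r) →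
      Proj r Γ C B →
      Proj r Γ (Chor.sel Φ C) (Beh.selOpt (selsOf r Φ) B)
  | iteSelf {Γ C₁ C₂ B₁ B₂} (e) : Proj r Γ C₁ B₁ → Proj r Γ C₂ B₂ →
      Proj r Γ (Chor.ite r e C₁ C₂) (Beh.ite e B₁ B₂)
  | iteOther {Γ C₁ C₂ B₁ B₂ B} (p e) : p ≠ r → Proj r Γ C₁ B₁ → Proj r Γ C₂ B₂ →
      Beh.Merge B₁ B₂ B →
      Proj r Γ (Chor.ite p e C₁ C₂) B
  | recIn {Γ C₁ C₂ B₁ B₂} : r ∈ Chor.pn (∅ :: Γ) C₂ →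
      Proj r (Chor.pn (∅ :: Γ) C₂ :: Γ) C₂ B₂ → Proj r (Chor.pn (∅ :: Γ) C₂ :: Γ) C₁ B₁ →
      Proj r Γ (Chor.recd C₂ C₁) (Beh.recd B₂ B₁)
  | recOut {Γ C₁ C₂ B₁} : r ∉ Chor.pn (∅ :: Γ) C₂ →
      Proj r (Chor.pn (∅ :: Γ) C₂ :: Γ) C₁ B₁ →
      Proj r Γ (Chor.recd C₂ C₁) B₁
  | callIn {Γ A} (k) : Γ[k]? = some A → r ∈ A →
      Proj r Γ (Chor.call k) (Beh.call ((Γ.take k).countP (fun A' => r ∈ A')))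
  | callOut {Γ A} (k) : Γ[k]? = some A → r ∉ A →
      Proj r Γ (Chor.call k) Beh.nil

/-- The graph of endpoint projection: `EPP C N` means that the endpoint projection of `C` is
defined (`C` is projectable) and equal to `N`, the parallel composition of the projections of `C`
on its processes. -/
def EPP (C : Chor Pid Var Expr Lbl) (N : Net Pid Var Expr Lbl) : Prop :=
  ∃ B : Pid → Beh Pid Var Expr Lbl,
    (∀ p ∈ Chor.pn [] C, Proj p [] C (B p)) ∧ N = Net.prod B (Chor.pn [] C).toList

end Projection

end Processes

end Multicom

/-! Part 1. The obstacle is that `C'` need not be projectable: the precongruence may rearrange or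
unfold a single branch of a conditional, after which the projections of the two branches no longer
merge. It does not, however, change what the choreography does when executed in program order. Let
`mstep` be a deterministic machine for that execution, which also counts actions. Every axiom of the
precongruence is sound for the machine, in the sense that both sides reach a common configuration
(`Join.of_pre`), and a concurrent step is worth exactly one count (`Join.of_step`). Hence the runs
of the machine from `C` and from `C'` meet in some `D`. The run from `C` only ever acts at the front
of the program, where the projections follow each action up to pruning (`Run.net`), so the network
of `C` reaches behaviours of which the projections of `D` are prunings. The counts show that this
run contains at least one action. The run from `C'` either contains an action, and is then a
concurrent reduction to `D`, or is silent, and then the projections of `D` pull back to `C'`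
(`Run.proj_of_zero`), so that `C'` itself serves as `C''`.

Part 2. A network step is read process by process (`Net.Step.view`): there is a label whose
participants perform a local action, possibly after unfolding definitions, while all other processes
stay structurally equivalent. Now unfold all invocations outside procedure bodies simultaneously,
`n` times, in the choreography and in the behaviours. Uniformity keeps branches mergeable, and
projection commutes with this operation up to pruning (`Proj.unf`). For large `n` the local actions
stand at the heads of the unfolded behaviours (`Beh.Cap.exists_LH`). Then the unfolded choreography
contains the corresponding action, with nothing before it that involves its participants
(`Ext.exists`). The exchange axioms bring it to the front (`Ext.step`), and its removal acts on the
projections as the network step does, up to pruning (`Ext.proj`).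

Both parts rest on the invariant `Chor.Good`, which, unlike projectability, survives every step, and
on the compatibility of pruning with merging, unfolding and local actions. -/

set_option linter.unusedSectionVars false

namespace Multicom

/-- Local actions of a single process. -/
inductive BAct (Pid Var Expr Lbl : Type*) where
  | act (a : Act Pid Var Expr)
  | sel (q : Pid) (l : Lbl)
  | br (p : Pid) (l : Lbl)
  | cond (e : Expr) (b : Bool)

/-! ### Merging, pruning and unfolding of behaviours -/

namespace Beh

section Basic

variable {Pid Var Expr Lbl : Type*}

/-- The constructor forces the label set to be literally `I ∪ J`; a propositional equality is needed
to read `I ∪ I` as `I`. -/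
theorem Merge.branch_of_eq [DecidableEq Lbl] (p : Pid) (I J K : Finset Lbl) (hK : K = I ∪ J)
    (f : I → Beh Pid Var Expr Lbl) (g : J → Beh Pid Var Expr Lbl) (h : K → Beh Pid Var Expr Lbl)
    (h₁ : ∀ ℓ (hI : ℓ ∈ I) (hJ : ℓ ∈ J) (hℓ : ℓ ∈ K), Merge (f ⟨ℓ, hI⟩) (g ⟨ℓ, hJ⟩) (h ⟨ℓ, hℓ⟩))
    (h₂ : ∀ ℓ (hI : ℓ ∈ I) (hℓ : ℓ ∈ K), ℓ ∉ J → h ⟨ℓ, hℓ⟩ = f ⟨ℓ, hI⟩)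
    (h₃ : ∀ ℓ (hJ : ℓ ∈ J) (hℓ : ℓ ∈ K), ℓ ∉ I → h ⟨ℓ, hℓ⟩ = g ⟨ℓ, hJ⟩) :
    Merge (Beh.branch p I f) (Beh.branch p J g) (Beh.branch p K h) := by
  subst hK
  exact Merge.branch p I J f g h (fun ℓ hI hJ => h₁ ℓ hI hJ _) (fun ℓ hI => h₂ ℓ hI _)
    (fun ℓ hJ => h₃ ℓ hJ _)

theorem Merge.refl [DecidableEq Lbl] (B : Beh Pid Var Expr Lbl) : Merge B B B := by
  induction B with
  | com Θ B ih => exact .com Θ ih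
  | sel S B ih => exact .sel S ih
  | branch p I f ih =>
    exact .branch_of_eq p I I I (by simp) f f f (fun ℓ _ _ _ => ih _)
      (fun ℓ hI _ hn => absurd hI hn) (fun ℓ hI _ hn => absurd hI hn)
  | ite e B₁ B₂ ih₁ ih₂ => exact .ite e ih₁ ih₂
  | recd B₂ B₁ ih₂ ih₁ => exact .recd ih₂ ih₁
  | call k => exact .call k
  | nil => exact .nil

theorem Merge.functional [DecidableEq Lbl] {B B' X Y : Beh Pid Var Expr Lbl}
    (h : Merge B B' X) (h' : Merge B B' Y) : X = Y := by
  induction h generalizing Y with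
  | com Θ _ ih => cases h' with | com _ h => rw [ih h]
  | sel S _ ih => cases h' with | sel _ h => rw [ih h]
  | branch p I J f g h h₁ h₂ h₃ ih =>
    cases h' with
    | branch _ _ _ _ _ h' h₁' h₂' h₃' =>
      congr 1
      funext ⟨ℓ, hℓ⟩
      by_cases hI : ℓ ∈ I
      · by_cases hJ : ℓ ∈ J
        · exact ih ℓ hI hJ (h₁' ℓ hI hJ)
        · rw [h₂ ℓ hI hJ, h₂' ℓ hI hJ]
      · have hJ : ℓ ∈ J := (Finset.mem_union.1 hℓ).resolve_left hI
        rw [h₃ ℓ hJ hI, h₃' ℓ hJ hI]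
  | ite e _ _ ih₁ ih₂ => cases h' with | ite _ h₁ h₂ => rw [ih₁ h₁, ih₂ h₂]
  | recd _ _ ih₂ ih₁ => cases h' with | recd h₂ h₁ => rw [ih₁ h₁, ih₂ h₂]
  | call k => cases h'; rfl
  | nil => cases h'; rfl

theorem Merge.lift [DecidableEq Lbl] {B B' B'' : Beh Pid Var Expr Lbl} (h : Merge B B' B'')
    (d c : ℕ) : Merge (B.lift d c) (B'.lift d c) (B''.lift d c) := by
  induction h generalizing c with
  | com Θ _ ih => exact .com Θ (ih c)
  | sel S _ ih => exact .sel S (ih c)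
  | branch p I J f g h h₁ h₂ h₃ ih =>
    exact .branch p I J _ _ _ (fun ℓ hI hJ => ih ℓ hI hJ c)
      (fun ℓ hI hJ => congrArg (Beh.lift d c) (h₂ ℓ hI hJ))
      (fun ℓ hJ hI => congrArg (Beh.lift d c) (h₃ ℓ hJ hI))
  | ite e _ _ ih₁ ih₂ => exact .ite e (ih₁ c) (ih₂ c)
  | recd _ _ ih₂ ih₁ => exact .recd (ih₂ _) (ih₁ _)
  | call k => exact .call _
  | nil => exact .nil

theorem Prune.refl (B : Beh Pid Var Expr Lbl) : Prune B B := by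
  induction B with
  | com Θ B ih => exact .com Θ ih
  | sel S B ih => exact .sel S ih
  | branch p I f ih => exact .branch p I I (Finset.Subset.refl _) f f (fun ℓ => ih _)
  | ite e B₁ B₂ ih₁ ih₂ => exact .ite e ih₁ ih₂
  | recd B₂ B₁ ih₂ ih₁ => exact .recd ih₂ ih₁
  | call k => exact .call k
  | nil => exact .nil

theorem Prune.trans {B B' B'' : Beh Pid Var Expr Lbl} (h : Prune B B') (h' : Prune B' B'') :
    Prune B B'' := by
  induction h generalizing B'' with
  | com Θ _ ih => cases h' with | com _ h => exact .com Θ (ih h)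
  | sel S _ ih => cases h' with | sel _ h => exact .sel S (ih h)
  | branch p I J hIJ f g _ ih =>
    cases h' with
    | branch _ _ K hJK _ k h =>
      exact .branch p I K (hIJ.trans hJK) f k (fun ℓ => ih ℓ (h ⟨ℓ, hIJ ℓ.2⟩))
  | ite e _ _ ih₁ ih₂ => cases h' with | ite _ h₁ h₂ => exact .ite e (ih₁ h₁) (ih₂ h₂)
  | recd _ _ ih₂ ih₁ => cases h' with | recd h₂ h₁ => exact .recd (ih₂ h₂) (ih₁ h₁)
  | call k => exact h'
  | nil => exact h'

theorem Prune.lift {B B' : Beh Pid Var Expr Lbl} (h : Prune B B') (d c : ℕ) :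
    Prune (B.lift d c) (B'.lift d c) := by
  induction h generalizing c with
  | com Θ _ ih => exact .com Θ (ih c)
  | sel S _ ih => exact .sel S (ih c)
  | branch p I J hIJ f g _ ih => exact .branch p I J hIJ _ _ (fun ℓ => ih ℓ c)
  | ite e _ _ ih₁ ih₂ => exact .ite e (ih₁ c) (ih₂ c)
  | recd _ _ ih₂ ih₁ => exact .recd (ih₂ _) (ih₁ _)
  | call k => exact .call _
  | nil => exact .nil

theorem Prune.of_merge [DecidableEq Lbl] {B B' B'' : Beh Pid Var Expr Lbl} (h : Merge B B' B'') :
    Prune B B'' ∧ Prune B' B'' := by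
  induction h with
  | com Θ _ ih => exact ⟨.com Θ ih.1, .com Θ ih.2⟩
  | sel S _ ih => exact ⟨.sel S ih.1, .sel S ih.2⟩
  | branch p I J f g h h₁ h₂ h₃ ih =>
    refine ⟨.branch p I _ Finset.subset_union_left _ _ fun ℓ => ?_,
      .branch p J _ Finset.subset_union_right _ _ fun ℓ => ?_⟩
    · by_cases hJ : (ℓ : Lbl) ∈ J
      · exact (ih ℓ ℓ.2 hJ).1
      · rw [h₂ ℓ ℓ.2 hJ]; exact .refl _
    · by_cases hI : (ℓ : Lbl) ∈ I
      · exact (ih ℓ hI ℓ.2).2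
      · rw [h₃ ℓ ℓ.2 hI]; exact .refl _
  | ite e _ _ ih₁ ih₂ => exact ⟨.ite e ih₁.1 ih₂.1, .ite e ih₁.2 ih₂.2⟩
  | recd _ _ ih₂ ih₁ => exact ⟨.recd ih₂.1 ih₁.1, .recd ih₂.2 ih₁.2⟩
  | call k => exact ⟨.call k, .call k⟩
  | nil => exact ⟨.nil, .nil⟩

/-- Pruning shrinks the set of common labels, so mergeability can only get easier. A label that is
lost on one side only costs nothing, since either argument of a merge is a pruning of the result. -/
theorem Prune.merge [DecidableEq Lbl] {B₁ B₂ B A₁ A₂ : Beh Pid Var Expr Lbl} (h : Merge B₁ B₂ B)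
    (h₁ : Prune A₁ B₁) (h₂ : Prune A₂ B₂) : ∃ A, Merge A₁ A₂ A ∧ Prune A B := by
  induction h generalizing A₁ A₂ with
  | com Θ _ ih =>
    cases h₁ with | com _ h₁ => cases h₂ with | com _ h₂ =>
    obtain ⟨A, hA, hA'⟩ := ih h₁ h₂
    exact ⟨_, .com Θ hA, .com Θ hA'⟩
  | sel S _ ih =>
    cases h₁ with | sel _ h₁ => cases h₂ with | sel _ h₂ =>
    obtain ⟨A, hA, hA'⟩ := ih h₁ h₂
    exact ⟨_, .sel S hA, .sel S hA'⟩
  | branch p I J f g h hm hf hg ih =>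
    cases h₁ with | branch _ I' _ hI f' _ h₁ =>
    cases h₂ with | branch _ J' _ hJ g' _ h₂ =>
    have key : ∀ ℓ (hI' : ℓ ∈ I') (hJ' : ℓ ∈ J'), ∃ A, Merge (f' ⟨ℓ, hI'⟩) (g' ⟨ℓ, hJ'⟩) A ∧
        Prune A (h ⟨ℓ, Finset.mem_union_left _ (hI hI')⟩) := fun ℓ hI' hJ' =>
      ih ℓ (hI hI') (hJ hJ') (h₁ ⟨ℓ, hI'⟩) (h₂ ⟨ℓ, hJ'⟩)
    choose k hk using key
    have hfp : ∀ ℓ (hI' : ℓ ∈ I'), Prune (f' ⟨ℓ, hI'⟩) (h ⟨ℓ, Finset.mem_union_left _ (hI hI')⟩) := by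
      intro ℓ hI'
      refine (h₁ ⟨ℓ, hI'⟩).trans ?_
      by_cases hℓ : ℓ ∈ J
      · exact (Prune.of_merge (hm ℓ (hI hI') hℓ)).1
      · rw [hf ℓ (hI hI') hℓ]; exact .refl _
    have hgp : ∀ ℓ (hJ' : ℓ ∈ J'), Prune (g' ⟨ℓ, hJ'⟩) (h ⟨ℓ, Finset.mem_union_right _ (hJ hJ')⟩) := by
      intro ℓ hJ'
      refine (h₂ ⟨ℓ, hJ'⟩).trans ?_
      by_cases hℓ : ℓ ∈ I
      · exact (Prune.of_merge (hm ℓ hℓ (hJ hJ'))).2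
      · rw [hg ℓ (hJ hJ') hℓ]; exact .refl _
    let k' : ↥(I' ∪ J') → Beh Pid Var Expr Lbl := fun ℓ =>
      if hI' : (ℓ : Lbl) ∈ I' then
        if hJ' : (ℓ : Lbl) ∈ J' then k ℓ hI' hJ' else f' ⟨ℓ, hI'⟩
      else g' ⟨ℓ, (Finset.mem_union.1 ℓ.2).resolve_left hI'⟩
    refine ⟨Beh.branch p (I' ∪ J') k', .branch p I' J' f' g' k' ?_ ?_ ?_,
      .branch p _ _ (Finset.union_subset_union hI hJ) _ _ ?_⟩
    · intro ℓ hI' hJ'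
      simpa [k', hI', hJ'] using (hk ℓ hI' hJ').1
    · intro ℓ hI' hJ'
      simp [k', hI', hJ']
    · intro ℓ hJ' hI'
      simp [k', hI']
    · rintro ⟨ℓ, hℓ⟩
      by_cases hI' : ℓ ∈ I'
      · by_cases hJ' : ℓ ∈ J'
        · simpa [k', hI', hJ'] using (hk ℓ hI' hJ').2
        · simpa [k', hI', hJ'] using hfp ℓ hI'
      · simpa [k', hI'] using hgp ℓ ((Finset.mem_union.1 hℓ).resolve_left hI')
  | ite e _ _ ih₁ ih₂ =>
    cases h₁ with | ite _ h₁ h₁' => cases h₂ with | ite _ h₂ h₂' =>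
    obtain ⟨A, hA, hA'⟩ := ih₁ h₁ h₂
    obtain ⟨A', hB, hB'⟩ := ih₂ h₁' h₂'
    exact ⟨_, .ite e hA hB, .ite e hA' hB'⟩
  | recd _ _ ih₂ ih₁ =>
    cases h₁ with | recd h₁ h₁' => cases h₂ with | recd h₂ h₂' =>
    obtain ⟨A, hA, hA'⟩ := ih₂ h₁ h₂
    obtain ⟨A', hB, hB'⟩ := ih₁ h₁' h₂'
    exact ⟨_, .recd hA hB, .recd hA' hB'⟩
  | call k => cases h₁; cases h₂; exact ⟨_, .call k, .call k⟩
  | nil => cases h₁; cases h₂; exact ⟨_, .nil, .nil⟩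

/-- The procedure body is pruned along with the term, because pruning also drops branches inside
definitions; the inserted copy is therefore a pruning of its counterpart. -/
theorem Prune.repl {D D' B B' A : Beh Pid Var Expr Lbl} {n : ℕ} (h : Repl D n B B')
    (hD : Prune D D') (hA : Prune B A) : ∃ A', Repl D' n A A' ∧ Prune B' A' := by
  classical
  induction h generalizing A with
  | here n => cases hA; exact ⟨_, .here n, hD.lift n 0⟩
  | com Θ _ ih =>
    cases hA with | com _ hA =>
    obtain ⟨A', h₁, h₂⟩ := ih hA
    exact ⟨_, .com Θ h₁, .com Θ h₂⟩
  | sel S _ ih =>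
    cases hA with | sel _ hA =>
    obtain ⟨A', h₁, h₂⟩ := ih hA
    exact ⟨_, .sel S h₁, .sel S h₂⟩
  | branch p I f g ℓ _ hg ih =>
    cases hA with | branch _ _ J hIJ _ k hA =>
    obtain ⟨A', h₁, h₂⟩ := ih (hA ℓ)
    refine ⟨_, .branch p J k (Function.update k ⟨ℓ, hIJ ℓ.2⟩ A') ⟨ℓ, hIJ ℓ.2⟩ (by simpa using h₁)
      (fun ℓ' hℓ' => Function.update_of_ne hℓ' _ _), .branch p I J hIJ _ _ fun ℓ' => ?_⟩
    by_cases hℓ : ℓ' = ℓ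
    · subst hℓ; simpa using h₂
    · rw [hg ℓ' hℓ, Function.update_of_ne]
      · exact hA ℓ'
      · intro h; apply hℓ; exact Subtype.ext (congrArg Subtype.val h :)
  | iteL e B₂ _ ih =>
    cases hA with | ite _ hA hA₂ =>
    obtain ⟨A', h₁, h₂⟩ := ih hA
    exact ⟨_, .iteL e _ h₁, .ite e h₂ hA₂⟩
  | iteR e B₁ _ ih =>
    cases hA with | ite _ hA₁ hA =>
    obtain ⟨A', h₁, h₂⟩ := ih hA
    exact ⟨_, .iteR e _ h₁, .ite e hA₁ h₂⟩
  | recd B₂ _ ih =>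
    cases hA with | recd hA₂ hA =>
    obtain ⟨A', h₁, h₂⟩ := ih hA
    exact ⟨_, .recd _ h₁, .recd hA₂ h₂⟩

/-- Pruning simulates the structural precongruence. -/
theorem Prune.pre {B B' A : Beh Pid Var Expr Lbl} (h : Pre B B') (hA : Prune B A) :
    ∃ A', Pre A A' ∧ Prune B' A' := by
  classical
  induction h generalizing A with
  | refl B => exact ⟨A, .refl _, hA⟩
  | trans _ _ ih₁ ih₂ =>
    obtain ⟨A₁, h₁, h₁'⟩ := ih₁ hA
    obtain ⟨A₂, h₂, h₂'⟩ := ih₂ h₁'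
    exact ⟨A₂, .trans h₁ h₂, h₂'⟩
  | com Θ _ ih =>
    cases hA with | com _ hA =>
    obtain ⟨A', h₁, h₂⟩ := ih hA
    exact ⟨_, .com Θ h₁, .com Θ h₂⟩
  | sel S _ ih =>
    cases hA with | sel _ hA =>
    obtain ⟨A', h₁, h₂⟩ := ih hA
    exact ⟨_, .sel S h₁, .sel S h₂⟩
  | branch p I f g _ ih =>
    cases hA with | branch _ _ J hIJ _ k hA =>
    choose k' h₁ h₂ using fun ℓ => ih ℓ (hA ℓ)
    -- Branches absent from the smaller term are left as they are.
    refine ⟨_, .branch p J k (fun ℓ => if h : (ℓ : Lbl) ∈ I then k' ⟨ℓ, h⟩ else k ℓ) fun ℓ => ?_,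
      .branch p I J hIJ _ _ fun ℓ => ?_⟩
    · by_cases h : (ℓ : Lbl) ∈ I
      · simpa [h] using h₁ ⟨ℓ, h⟩
      · simpa [h] using .refl _
    · simpa using h₂ ℓ
  | ite e _ _ ih₁ ih₂ =>
    cases hA with | ite _ hA₁ hA₂ =>
    obtain ⟨A₁, h₁, h₁'⟩ := ih₁ hA₁
    obtain ⟨A₂, h₂, h₂'⟩ := ih₂ hA₂
    exact ⟨_, .ite e h₁ h₂, .ite e h₁' h₂'⟩
  | recd B₂ _ ih =>
    cases hA with | recd hA₂ hA =>
    obtain ⟨A', h₁, h₂⟩ := ih hA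
    exact ⟨_, .recd _ h₁, .recd hA₂ h₂⟩
  | unfold h =>
    cases hA with | recd hA₂ hA =>
    obtain ⟨A', h₁, h₂⟩ := Prune.repl h hA₂ hA
    exact ⟨_, .unfold h₁, .recd hA₂ h₂⟩
  | defNil B => cases hA with | recd _ hA => cases hA; exact ⟨_, .defNil _, .nil⟩
  | comEmpty B => cases hA with | com _ hA => exact ⟨_, .comEmpty _, hA⟩
  | selEmpty B => cases hA with | sel _ hA => exact ⟨_, .selEmpty _, hA⟩

/-- Every invocation in the scope of `B` is unfolded once; `l` lists the enclosing bodies. -/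
def unf : List (Beh Pid Var Expr Lbl) → Beh Pid Var Expr Lbl → Beh Pid Var Expr Lbl
  | l, com Θ B => com Θ (unf l B)
  | l, sel S B => sel S (unf l B)
  | l, branch p I f => branch p I (fun ℓ => unf l (f ℓ))
  | l, ite e B₁ B₂ => ite e (unf l B₁) (unf l B₂)
  | l, recd B₂ B₁ => recd B₂ (unf (B₂ :: l) B₁)
  | l, call k => (l[k]?).elim (call k) (lift k 0)
  | _, nil => nil

/-- Pointwise merging of lists. -/
inductive MergeL [DecidableEq Lbl] : List (Beh Pid Var Expr Lbl) → List (Beh Pid Var Expr Lbl) →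
    List (Beh Pid Var Expr Lbl) → Prop
  | nil : MergeL [] [] []
  | cons {A A' A'' l l' l''} : Merge A A' A'' → MergeL l l' l'' →
      MergeL (A :: l) (A' :: l') (A'' :: l'')

theorem MergeL.refl [DecidableEq Lbl] (l : List (Beh Pid Var Expr Lbl)) : MergeL l l l := by
  induction l with
  | nil => exact .nil
  | cons A l ih => exact .cons (.refl A) ih

theorem MergeL.unf_call [DecidableEq Lbl] {l l' l'' : List (Beh Pid Var Expr Lbl)}
    (h : MergeL l l' l'') (k : ℕ) :
    ((l[k]?) = none ∧ (l'[k]?) = none ∧ (l''[k]?) = none) ∨ ∃ A A' A'', l[k]? = some A ∧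
      l'[k]? = some A' ∧ l''[k]? = some A'' ∧ Merge A A' A'' := by
  induction h generalizing k with
  | nil => simp
  | cons h _ ih =>
    cases k with
    | zero => exact .inr ⟨_, _, _, rfl, rfl, rfl, h⟩
    | succ k => simpa using ih k

/-- Pointwise pruning of lists. -/
abbrev PruneL (l l' : List (Beh Pid Var Expr Lbl)) : Prop := List.Forall₂ Prune l l'

theorem MergeL.prune [DecidableEq Lbl] {l l' l'' : List (Beh Pid Var Expr Lbl)}
    (h : MergeL l l' l'') : PruneL l l'' ∧ PruneL l' l'' := by
  induction h with
  | nil => exact ⟨.nil, .nil⟩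
  | cons h _ ih => exact ⟨.cons (Prune.of_merge h).1 ih.1, .cons (Prune.of_merge h).2 ih.2⟩

theorem PruneL.getElem? {l l' : List (Beh Pid Var Expr Lbl)} (h : PruneL l l') (k : ℕ) :
    (l[k]? = none ∧ l'[k]? = none) ∨ ∃ A A', l[k]? = some A ∧ l'[k]? = some A' ∧ Prune A A' := by
  induction h generalizing k with
  | nil => simp
  | cons h _ ih =>
    cases k with
    | zero => exact .inr ⟨_, _, rfl, rfl, h⟩
    | succ k => simpa using ih k

/-- The lists of bodies have to be related too: an invocation is replaced by a body taken from its
own side. -/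
theorem Prune.unf {B B' : Beh Pid Var Expr Lbl} (h : Prune B B') {l l'} (hl : PruneL l l') :
    Prune (unf l B) (unf l' B') := by
  induction h generalizing l l' with
  | com Θ _ ih => exact .com Θ (ih hl)
  | sel S _ ih => exact .sel S (ih hl)
  | branch p I J hIJ f g _ ih => exact .branch p I J hIJ _ _ (fun ℓ => ih ℓ hl)
  | ite e _ _ ih₁ ih₂ => exact .ite e (ih₁ hl) (ih₂ hl)
  | recd h _ ih₂ ih₁ => exact .recd h (ih₁ (.cons h hl))
  | call k =>
    rcases hl.getElem? k with ⟨h, h'⟩ | ⟨A, A', h, h', hA⟩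
    · simpa [Beh.unf, h, h'] using .call k
    · simpa [Beh.unf, h, h'] using hA.lift k 0
  | nil => exact .nil

/-- Unfolding commutes with merging, up to pruning: a branch that is present on one side only
refers to the definitions of that side. -/
theorem Merge.unf [DecidableEq Lbl] {B B' B'' : Beh Pid Var Expr Lbl} (h : Merge B B' B'')
    {l l' l''} (hl : MergeL l l' l'') :
    ∃ X, Merge (unf l B) (unf l' B') X ∧ Prune X (unf l'' B'') := by
  induction h generalizing l l' l'' with
  | com Θ _ ih =>
    obtain ⟨X, h, h'⟩ := ih hl
    exact ⟨_, .com Θ h, .com Θ h'⟩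
  | sel S _ ih =>
    obtain ⟨X, h, h'⟩ := ih hl
    exact ⟨_, .sel S h, .sel S h'⟩
  | branch p I J f g h hm hf hg ih =>
    have key := fun ℓ (hI : ℓ ∈ I) (hJ : ℓ ∈ J) => ih ℓ hI hJ hl
    choose k hk using key
    let k' : ↥(I ∪ J) → Beh Pid Var Expr Lbl := fun ℓ =>
      if hI : (ℓ : Lbl) ∈ I then
        if hJ : (ℓ : Lbl) ∈ J then k ℓ hI hJ else Beh.unf l (f ⟨ℓ, hI⟩)
      else Beh.unf l' (g ⟨ℓ, (Finset.mem_union.1 ℓ.2).resolve_left hI⟩)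
    refine ⟨Beh.branch p (I ∪ J) k', .branch p I J _ _ k' ?_ ?_ ?_,
      .branch p _ _ (Finset.Subset.refl _) _ _ ?_⟩
    · intro ℓ hI hJ
      simpa [k', hI, hJ] using (hk ℓ hI hJ).1
    · intro ℓ hI hJ
      simp [k', hI, hJ]
    · intro ℓ hJ hI
      simp [k', hI]
    · rintro ⟨ℓ, hℓ⟩
      by_cases hI : ℓ ∈ I
      · by_cases hJ : ℓ ∈ J
        · simpa [k', hI, hJ] using (hk ℓ hI hJ).2
        · simpa [k', hI, hJ, hf ℓ hI hJ] using (Prune.refl _).unf hl.prune.1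
      · have hJ := (Finset.mem_union.1 hℓ).resolve_left hI
        simpa [k', hI, hg ℓ hJ hI] using (Prune.refl _).unf hl.prune.2
  | ite e _ _ ih₁ ih₂ =>
    obtain ⟨X, h, h'⟩ := ih₁ hl
    obtain ⟨Y, k, k'⟩ := ih₂ hl
    exact ⟨_, .ite e h k, .ite e h' k'⟩
  | recd h _ ih₂ ih₁ =>
    obtain ⟨X, k, k'⟩ := ih₁ (.cons h hl)
    exact ⟨_, .recd h k, .recd (.refl _) k'⟩
  | call k =>
    rcases hl.unf_call k with ⟨h, h', h''⟩ | ⟨A, A', A'', h, h', h'', hA⟩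
    · exact ⟨Beh.call k, by simpa [Beh.unf, h, h'] using .call k, by simpa [Beh.unf, h''] using .call k⟩
    · exact ⟨A''.lift k 0, by simpa [Beh.unf, h, h'] using hA.lift k 0,
        by simpa [Beh.unf, h''] using .refl _⟩
  | nil => exact ⟨_, .nil, .nil⟩

end Basic
end Beh
-- Structural equivalence relative to the definitions in scope
namespace Beh
section Equivalence

variable {Pid Var Expr Lbl : Type*}

/-- Structural equivalence of behaviours in the scope of the definitions listed in `l`. -/
inductive BEq : List (Beh Pid Var Expr Lbl) → Beh Pid Var Expr Lbl → Beh Pid Var Expr Lbl → Prop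
  | refl (l B) : BEq l B B
  | symm {l B B'} : BEq l B B' → BEq l B' B
  | trans {l B₁ B₂ B₃} : BEq l B₁ B₂ → BEq l B₂ B₃ → BEq l B₁ B₃
  | com {l} (Θ) {B B'} : BEq l B B' → BEq l (com Θ B) (com Θ B')
  | sel {l} (S) {B B'} : BEq l B B' → BEq l (sel S B) (sel S B')
  | branch {l} (p : Pid) (I : Finset Lbl) (f g : I → Beh Pid Var Expr Lbl) :
      (∀ ℓ, BEq l (f ℓ) (g ℓ)) → BEq l (branch p I f) (branch p I g)
  | ite {l} (e) {B₁ B₁' B₂ B₂'} : BEq l B₁ B₁' → BEq l B₂ B₂' →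
      BEq l (ite e B₁ B₂) (ite e B₁' B₂')
  | recd {l} (B₂) {B₁ B₁'} : BEq (B₂ :: l) B₁ B₁' → BEq l (recd B₂ B₁) (recd B₂ B₁')
  | unfold {l k A} : l[k]? = some A → BEq l (call k) (lift k 0 A)
  | defNil (l B) : BEq l (recd B nil) nil
  | comEmpty (l B) : BEq l (com ∅ B) B
  | selEmpty (l B) : BEq l (sel ∅ B) B

/-- New definitions enter at the outer end of the list, so the indices of the existing ones do not
move. This places an equivalence below a further definition. -/
theorem BEq.append {l : List (Beh Pid Var Expr Lbl)} {B B'} (h : BEq l B B') (l') :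
    BEq (l ++ l') B B' := by
  induction h with
  | refl => exact .refl _ _
  | symm _ ih => exact ih.symm
  | trans _ _ ih₁ ih₂ => exact ih₁.trans ih₂
  | com Θ _ ih => exact .com Θ ih
  | sel S _ ih => exact .sel S ih
  | branch p I f g _ ih => exact .branch p I f g ih
  | ite e _ _ ih₁ ih₂ => exact .ite e ih₁ ih₂
  | recd B₂ _ ih => exact .recd B₂ ih
  | unfold h => exact .unfold (List.getElem?_append_left (List.getElem?_eq_some_iff.1 h).1 ▸ h)
  | defNil => exact .defNil _ _
  | comEmpty => exact .comEmpty _ _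
  | selEmpty => exact .selEmpty _ _

theorem BEq.of_repl {D B B' : Beh Pid Var Expr Lbl} {n : ℕ} (h : Repl D n B B') {l}
    (hl : l[n]? = some D) : BEq l B B' := by
  induction h generalizing l with
  | here n => exact .unfold hl
  | com Θ _ ih => exact .com Θ (ih hl)
  | sel S _ ih => exact .sel S (ih hl)
  | branch p I f g ℓ _ hg ih =>
    refine .branch p I f g fun ℓ' => ?_
    by_cases h : ℓ' = ℓ
    · subst h; exact ih hl
    · rw [hg ℓ' h]; exact .refl _ _
  | iteL e B₂ _ ih => exact .ite e (ih hl) (.refl _ _)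
  | iteR e B₁ _ ih => exact .ite e (.refl _ _) (ih hl)
  | recd B₂ _ ih => exact .recd B₂ (ih (by simpa using hl))

theorem BEq.of_pre {B B' : Beh Pid Var Expr Lbl} (h : Pre B B') (l) : BEq l B B' := by
  induction h generalizing l with
  | refl => exact .refl _ _
  | trans _ _ ih₁ ih₂ => exact (ih₁ l).trans (ih₂ l)
  | com Θ _ ih => exact .com Θ (ih l)
  | sel S _ ih => exact .sel S (ih l)
  | branch p I f g _ ih => exact .branch p I f g (fun ℓ => ih ℓ l)
  | ite e _ _ ih₁ ih₂ => exact .ite e (ih₁ l) (ih₂ l)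
  | recd B₂ _ ih => exact .recd B₂ (ih _)
  | unfold h => exact .recd _ (.of_repl h rfl)
  | defNil => exact .defNil _ _
  | comEmpty => exact .comEmpty _ _
  | selEmpty => exact .selEmpty _ _

theorem BEq.unf (l) (B : Beh Pid Var Expr Lbl) : BEq l B (unf l B) := by
  induction B generalizing l with
  | com Θ _ ih => exact .com Θ (ih l)
  | sel S _ ih => exact .sel S (ih l)
  | branch p I f ih => exact .branch p I f _ (fun ℓ => ih ℓ l)
  | ite e _ _ ih₁ ih₂ => exact .ite e (ih₁ l) (ih₂ l)
  | recd B₂ _ _ ih => exact .recd B₂ (ih _)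
  | call k =>
    cases h : l[k]? with
    | none => simpa [Beh.unf, h] using .refl _ _
    | some A => simpa [Beh.unf, h] using BEq.unfold h
  | nil => exact .refl _ _

/-- Evaluation contexts, with the list of definitions in whose scope the hole is. -/
inductive IsCtx : List (Beh Pid Var Expr Lbl) → (Beh Pid Var Expr Lbl → Beh Pid Var Expr Lbl) → Prop
  | id : IsCtx [] (fun B => B)
  | com {l K} (Θ) : IsCtx l K → IsCtx l (fun B => K (com Θ B))
  | sel {l K} (S) : IsCtx l K → IsCtx l (fun B => K (sel S B))
  | branch {l K} (p : Pid) (I : Finset Lbl) [DecidableEq I] (f : I → Beh Pid Var Expr Lbl) (ℓ : I) :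
      IsCtx l K → IsCtx l (fun B => K (branch p I (Function.update f ℓ B)))
  | iteL {l K} (e B₂) : IsCtx l K → IsCtx l (fun B => K (ite e B B₂))
  | iteR {l K} (e B₁) : IsCtx l K → IsCtx l (fun B => K (ite e B₁ B))
  | recd {l K} (A) : IsCtx l K → IsCtx (A :: l) (fun B => K (recd A B))

theorem IsCtx.pre {l : List (Beh Pid Var Expr Lbl)} {K} (hK : IsCtx l K) {B B'} (h : Pre B B') :
    Pre (K B) (K B') := by
  induction hK generalizing B B' with
  | id => exact h
  | com Θ _ ih => exact ih (.com Θ h)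
  | sel S _ ih => exact ih (.sel S h)
  | branch p I f ℓ _ ih =>
    refine ih (.branch p I _ _ fun ℓ' => ?_)
    by_cases h' : ℓ' = ℓ
    · subst h'; simpa using h
    · simpa [h'] using .refl _
  | iteL e B₂ _ ih => exact ih (.ite e h (.refl _))
  | iteR e B₁ _ ih => exact ih (.ite e (.refl _) h)
  | recd A _ ih => exact ih (.recd A h)

/-- Going outwards from the hole, each definition that is passed lowers the index by one; at index
zero the binder has been found and `Pre.unfold` applies. -/
theorem IsCtx.repl {l : List (Beh Pid Var Expr Lbl)} {K} (hK : IsCtx l K) {B B' D n}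
    (hn : l[n]? = some D) (h : Repl D n B B') : Pre (K B) (K B') := by
  induction hK generalizing B B' n with
  | id => simp at hn
  | com Θ _ ih => exact ih hn (.com Θ h)
  | sel S _ ih => exact ih hn (.sel S h)
  | branch p I f ℓ _ ih =>
    exact ih hn (.branch p I _ _ ℓ (by simpa using h) fun ℓ' h' => by simp [h'])
  | iteL e B₂ _ ih => exact ih hn (.iteL e _ h)
  | iteR e B₁ _ ih => exact ih hn (.iteR e _ h)
  | recd A hK ih =>
    cases n with
    | zero => cases hn; exact hK.pre (.unfold h)
    | succ n => exact ih (by simpa using hn) (.recd A h)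

/-- Replacing the branches one after the other. -/
theorem branch_induction [DecidableEq Lbl] {R : Beh Pid Var Expr Lbl → Beh Pid Var Expr Lbl → Prop}
    (hr : ∀ B, R B B) (ht : ∀ B₁ B₂ B₃, R B₁ B₂ → R B₂ B₃ → R B₁ B₃)
    {K : Beh Pid Var Expr Lbl → Beh Pid Var Expr Lbl} {p : Pid} {I : Finset Lbl}
    {F G : I → Beh Pid Var Expr Lbl}
    (h : ∀ (f : I → Beh Pid Var Expr Lbl) ℓ,
      R (K (branch p I (Function.update f ℓ (F ℓ)))) (K (branch p I (Function.update f ℓ (G ℓ))))) :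
    R (K (branch p I F)) (K (branch p I G)) := by
  have key : ∀ s : Finset I, R (K (branch p I F))
      (K (branch p I (fun ℓ => if ℓ ∈ s then G ℓ else F ℓ))) := by
    intro s
    induction s using Finset.induction_on with
    | empty => simpa using hr _
    | insert ℓ s hℓ ih =>
      refine ht _ _ _ ih ?_
      have := h (fun ℓ => if ℓ ∈ s then G ℓ else F ℓ) ℓ
      convert this using 3
      · funext ℓ'
        by_cases h : ℓ' = ℓ
        · subst h; simp [hℓ]
        · simp [h]
      · funext ℓ'
        by_cases h : ℓ' = ℓ
        · subst h; simp
        · simp [h]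
  simpa using key Finset.univ

/-- An invocation can be unfolded only together with its binder, which lies in the context; hence
the induction is over all contexts at once, unfolding one invocation after the other. -/
theorem IsCtx.pre_unf [DecidableEq Lbl] (B : Beh Pid Var Expr Lbl) {l K} (hK : IsCtx l K) :
    Pre (K B) (K (Beh.unf l B)) := by
  induction B generalizing l K with
  | com Θ _ ih => exact ih (.com Θ hK)
  | sel S _ ih => exact ih (.sel S hK)
  | branch p I f ih =>
    exact branch_induction .refl (fun _ _ _ => .trans) (fun g ℓ => ih ℓ (.branch p I g ℓ hK))
  | ite e B₁ B₂ ih₁ ih₂ => exact .trans (ih₁ (.iteL e B₂ hK)) (ih₂ (.iteR e _ hK))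
  | recd B₂ _ _ ih => exact ih (.recd B₂ hK)
  | call k =>
    cases h : l[k]? with
    | none => simpa [Beh.unf, h] using .refl _
    | some A => simpa [Beh.unf, h] using hK.repl h (.here k)
  | nil => exact .refl _

theorem Pre.unf [DecidableEq Lbl] (B : Beh Pid Var Expr Lbl) : Pre B (Beh.unf [] B) :=
  IsCtx.id.pre_unf B

/-- The context supplies the definitions that `BEq` only assumes, so each rule becomes an instance
of the precongruence on the whole term. -/
theorem BEq.eqvGen_ctx [DecidableEq Lbl] {l : List (Beh Pid Var Expr Lbl)} {B B'} (h : BEq l B B') {K}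
    (hK : IsCtx l K) : Relation.EqvGen Pre (K B) (K B') := by
  induction h generalizing K with
  | refl => exact .refl _
  | symm _ ih => exact .symm _ _ (ih hK)
  | trans _ _ ih₁ ih₂ => exact .trans _ _ _ (ih₁ hK) (ih₂ hK)
  | com Θ _ ih => exact ih (.com Θ hK)
  | sel S _ ih => exact ih (.sel S hK)
  | branch p I f g _ ih =>
    exact branch_induction .refl .trans (fun g ℓ => ih ℓ (.branch p I g ℓ hK))
  | ite e _ _ ih₁ ih₂ => exact .trans _ _ _ (ih₁ (.iteL e _ hK)) (ih₂ (.iteR e _ hK))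
  | recd B₂ _ ih => exact ih (.recd B₂ hK)
  | unfold h => exact .rel _ _ (hK.repl h (.here _))
  | defNil => exact .rel _ _ (hK.pre (.defNil _))
  | comEmpty => exact .rel _ _ (hK.pre (.comEmpty _))
  | selEmpty => exact .rel _ _ (hK.pre (.selEmpty _))

theorem BEq.eqvGen [DecidableEq Lbl] {B B' : Beh Pid Var Expr Lbl} (h : BEq [] B B') :
    Relation.EqvGen Pre B B' := h.eqvGen_ctx .id

end Equivalence

/-! ### Local actions of a behaviour and how unfolding exposes them -/

section Actions

variable {Pid Var Expr Lbl : Type*} [DecidableEq Pid] [DecidableEq Var] [DecidableEq Expr]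
  [DecidableEq Lbl]

/-- `LH a B B'`: the behaviour `B` performs the action `a` at its head, without unfolding. -/
inductive LH : BAct Pid Var Expr Lbl → Beh Pid Var Expr Lbl → Beh Pid Var Expr Lbl → Prop
  | com {a Θ} (B) : a ∈ Θ → LH (.act a) (com Θ B) (comOpt (Θ.erase a) B)
  | sel {q l S} (B) : (q, l) ∈ S → LH (.sel q l) (sel S B) (selOpt (S.erase (q, l)) B)
  | br {p} {J : Finset Lbl} (f : J → Beh Pid Var Expr Lbl) (l : J) : LH (.br p l) (branch p J f) (f l)
  | iteTrue (e B₁ B₂) : LH (.cond e true) (ite e B₁ B₂) B₁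
  | iteFalse (e B₁ B₂) : LH (.cond e false) (ite e B₁ B₂) B₂
  | recd {a B₁ B₁'} (B₂) : LH a B₁ B₁' → LH a (recd B₂ B₁) (recd B₂ B₁')
  | comEmpty {a B B'} : LH a B B' → LH a (com ∅ B) B'
  | selEmpty {a B B'} : LH a B B' → LH a (sel ∅ B) B'

/-- The shape of the head of `B` fits the action `a`; the labels of a branching term are ignored. -/
inductive Can : BAct Pid Var Expr Lbl → Beh Pid Var Expr Lbl → Prop
  | com {a Θ} (B) : a ∈ Θ → Can (.act a) (com Θ B)
  | sel {q l S} (B) : (q, l) ∈ S → Can (.sel q l) (sel S B)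
  | br {p} {J : Finset Lbl} (f : J → Beh Pid Var Expr Lbl) (l : Lbl) : Can (.br p l) (branch p J f)
  | ite (e b B₁ B₂) : Can (.cond e b) (ite e B₁ B₂)
  | recd {a B₁} (B₂) : Can a B₁ → Can a (recd B₂ B₁)
  | comEmpty {a B} : Can a B → Can a (com ∅ B)
  | selEmpty {a B} : Can a B → Can a (sel ∅ B)

/-- `Cap l a B B'`: the behaviour `B` performs the action `a` after unfolding definitions from `l`
at its head. -/
inductive Cap : List (Beh Pid Var Expr Lbl) → BAct Pid Var Expr Lbl → Beh Pid Var Expr Lbl →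
    Beh Pid Var Expr Lbl → Prop
  | com {l a Θ} (B) : a ∈ Θ → Cap l (.act a) (com Θ B) (comOpt (Θ.erase a) B)
  | sel {l q b S} (B) : (q, b) ∈ S → Cap l (.sel q b) (sel S B) (selOpt (S.erase (q, b)) B)
  | br {l p} {J : Finset Lbl} (f : J → Beh Pid Var Expr Lbl) (b : J) : Cap l (.br p b) (branch p J f) (f b)
  | iteTrue (l e B₁ B₂) : Cap l (.cond e true) (ite e B₁ B₂) B₁
  | iteFalse (l e B₁ B₂) : Cap l (.cond e false) (ite e B₁ B₂) B₂
  | recd {l a B₁ B₁'} (B₂) : Cap (B₂ :: l) a B₁ B₁' → Cap l a (recd B₂ B₁) (recd B₂ B₁')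
  | comEmpty {l a B B'} : Cap l a B B' → Cap l a (com ∅ B) B'
  | selEmpty {l a B B'} : Cap l a B B' → Cap l a (sel ∅ B) B'
  | unfold {l a k A B'} : l[k]? = some A → Cap l a (lift k 0 A) B' → Cap l a (call k) B'

theorem pre_comOpt (Θ) (B : Beh Pid Var Expr Lbl) : Pre (com Θ B) (comOpt Θ B) := by
  unfold comOpt
  split
  · subst_vars; exact .comEmpty _
  · exact .refl _

theorem pre_selOpt (S) (B : Beh Pid Var Expr Lbl) : Pre (sel S B) (selOpt S B) := by
  unfold selOpt
  split
  · subst_vars; exact .selEmpty _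
  · exact .refl _

theorem BEq.comOpt {l} (Θ) {B B' : Beh Pid Var Expr Lbl} (h : BEq l B B') :
    BEq l (comOpt Θ B) (comOpt Θ B') :=
  (BEq.of_pre (pre_comOpt Θ B) l).symm.trans ((BEq.com Θ h).trans (.of_pre (pre_comOpt Θ B') l))

theorem BEq.selOpt {l} (S) {B B' : Beh Pid Var Expr Lbl} (h : BEq l B B') :
    BEq l (selOpt S B) (selOpt S B') :=
  (BEq.of_pre (pre_selOpt S B) l).symm.trans ((BEq.sel S h).trans (.of_pre (pre_selOpt S B') l))

theorem Prune.comOpt (Θ) {B B' : Beh Pid Var Expr Lbl} (h : Prune B B') :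
    Prune (comOpt Θ B) (comOpt Θ B') := by
  unfold Beh.comOpt; split
  · exact h
  · exact .com Θ h

theorem Prune.selOpt (S) {B B' : Beh Pid Var Expr Lbl} (h : Prune B B') :
    Prune (selOpt S B) (selOpt S B') := by
  unfold Beh.selOpt; split
  · exact h
  · exact .sel S h

theorem Merge.comOpt (Θ) {B B' B'' : Beh Pid Var Expr Lbl} (h : Merge B B' B'') :
    Merge (comOpt Θ B) (comOpt Θ B') (comOpt Θ B'') := by
  unfold Beh.comOpt; split
  · exact h
  · exact .com Θ h

theorem Merge.selOpt (S) {B B' B'' : Beh Pid Var Expr Lbl} (h : Merge B B' B'') :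
    Merge (selOpt S B) (selOpt S B') (selOpt S B'') := by
  unfold Beh.selOpt; split
  · exact h
  · exact .sel S h

theorem LH.can {a} {B B' : Beh Pid Var Expr Lbl} (h : LH a B B') : Can a B := by
  induction h with
  | com B h => exact .com B h
  | sel B h => exact .sel B h
  | br f l => exact .br f _
  | iteTrue e B₁ B₂ => exact .ite e _ _ _
  | iteFalse e B₁ B₂ => exact .ite e _ _ _
  | recd B₂ _ ih => exact .recd B₂ ih
  | comEmpty _ ih => exact .comEmpty ih
  | selEmpty _ ih => exact .selEmpty ih

/-- Going down to a pruning may lose the selected label. This is why `Can` ignores the labels of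
branching terms, while `LH` is only transported upwards. -/
theorem Can.of_prune {a} {B A : Beh Pid Var Expr Lbl} (h : Can a A) (hp : Prune B A) : Can a B := by
  induction h generalizing B with
  | com _ h => cases hp; exact .com _ h
  | sel _ h => cases hp; exact .sel _ h
  | br f l => cases hp; exact .br _ _
  | ite e b B₁ B₂ => cases hp; exact .ite e _ _ _
  | recd B₂ _ ih => cases hp with | recd _ hp => exact .recd _ (ih hp)
  | comEmpty _ ih => cases hp with | com _ hp => exact .comEmpty (ih hp)
  | selEmpty _ ih => cases hp with | sel _ hp => exact .selEmpty (ih hp)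

theorem LH.functional {a} {B X Y : Beh Pid Var Expr Lbl} (h : LH a B X) (h' : LH a B Y) : X = Y := by
  induction h generalizing Y with
  | com _ h => cases h' with
    | com => rfl
    | comEmpty => simp at h
  | sel _ h => cases h' with
    | sel => rfl
    | selEmpty => simp at h
  | br f l =>
    obtain ⟨l, hl⟩ := l
    generalize ha : BAct.br _ _ = a at h'
    cases h' with
    | br _ l' =>
      obtain ⟨l', hl'⟩ := l'
      simp only [BAct.br.injEq, true_and] at ha
      subst ha
      rfl
  | iteTrue e B₁ B₂ => cases h'; rfl
  | iteFalse e B₁ B₂ => cases h'; rfl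
  | recd B₂ _ ih => cases h' with | recd _ h' => rw [ih h']
  | comEmpty _ ih => cases h' with
    | com _ h => simp at h
    | comEmpty h' => exact ih h'
  | selEmpty _ ih => cases h' with
    | sel _ h => simp at h
    | selEmpty h' => exact ih h'

theorem LH.prune {a} {B B' A : Beh Pid Var Expr Lbl} (h : LH a B B') (hp : Prune B A) :
    ∃ A', LH a A A' ∧ Prune B' A' := by
  induction h generalizing A with
  | com _ h => cases hp with | com _ hp => exact ⟨_, .com _ h, hp.comOpt _⟩
  | sel _ h => cases hp with | sel _ hp => exact ⟨_, .sel _ h, hp.selOpt _⟩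
  | br f l => cases hp with | branch _ _ J hIJ _ g hp => exact ⟨_, .br g ⟨l, hIJ l.2⟩, hp l⟩
  | iteTrue e B₁ B₂ => cases hp with | ite _ h₁ h₂ => exact ⟨_, .iteTrue e _ _, h₁⟩
  | iteFalse e B₁ B₂ => cases hp with | ite _ h₁ h₂ => exact ⟨_, .iteFalse e _ _, h₂⟩
  | recd B₂ _ ih =>
    cases hp with | recd hp₂ hp =>
    obtain ⟨A', h, h'⟩ := ih hp
    exact ⟨_, .recd _ h, .recd hp₂ h'⟩
  | comEmpty _ ih =>
    cases hp with | com _ hp =>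
    obtain ⟨A', h, h'⟩ := ih hp
    exact ⟨_, .comEmpty h, h'⟩
  | selEmpty _ ih =>
    cases hp with | sel _ hp =>
    obtain ⟨A', h, h'⟩ := ih hp
    exact ⟨_, .selEmpty h, h'⟩

/-- Needed when an action is taken out of both branches of a conditional: a process unaware of the
condition performs it in the merged behaviour, and the two remainders still merge. -/
theorem LH.merge {a} {B₁ B₂ B B₁' B₂' : Beh Pid Var Expr Lbl} (hm : Merge B₁ B₂ B) (h₁ : LH a B₁ B₁')
    (h₂ : LH a B₂ B₂') : ∃ B', Merge B₁' B₂' B' ∧ LH a B B' := by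
  induction h₁ generalizing B₂ B B₂' with
  | com _ h =>
    cases hm with | com _ hm =>
    cases h₂ with
    | com _ h => exact ⟨_, hm.comOpt _, .com _ h⟩
    | comEmpty => simp at h
  | sel _ h =>
    cases hm with | sel _ hm =>
    cases h₂ with
    | sel _ h => exact ⟨_, hm.selOpt _, .sel _ h⟩
    | selEmpty => simp at h
  | br f l =>
    cases hm with | branch _ _ J _ g h hm _ _ =>
    obtain ⟨l, hl⟩ := l
    generalize ha : BAct.br _ _ = a at h₂
    cases h₂ with
    | br _ l' =>
      obtain ⟨l', hl'⟩ := l'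
      simp only [BAct.br.injEq, true_and] at ha
      subst ha
      exact ⟨_, hm l hl hl', .br h ⟨l, _⟩⟩
  | iteTrue e =>
    cases hm with | ite _ hm₁ hm₂ =>
    cases h₂
    exact ⟨_, hm₁, .iteTrue e _ _⟩
  | iteFalse e =>
    cases hm with | ite _ hm₁ hm₂ =>
    cases h₂
    exact ⟨_, hm₂, .iteFalse e _ _⟩
  | recd B₂ _ ih =>
    cases hm with | recd hm₂ hm =>
    cases h₂ with | recd _ h₂ =>
    obtain ⟨B', h, h'⟩ := ih hm h₂
    exact ⟨_, .recd hm₂ h, .recd _ h'⟩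
  | comEmpty _ ih =>
    cases hm with | com _ hm =>
    cases h₂ with
    | com _ h => simp at h
    | comEmpty h₂ =>
      obtain ⟨B', h, h'⟩ := ih hm h₂
      exact ⟨_, h, .comEmpty h'⟩
  | selEmpty _ ih =>
    cases hm with | sel _ hm =>
    cases h₂ with
    | sel _ h => simp at h
    | selEmpty h₂ =>
      obtain ⟨B', h, h'⟩ := ih hm h₂
      exact ⟨_, h, .selEmpty h'⟩

theorem Cap.append {l a} {B B' : Beh Pid Var Expr Lbl} (h : Cap l a B B') (l') :
    Cap (l ++ l') a B B' := by
  induction h with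
  | com _ h => exact .com _ h
  | sel _ h => exact .sel _ h
  | br f l => exact .br f l
  | iteTrue => exact .iteTrue _ _ _ _
  | iteFalse => exact .iteFalse _ _ _ _
  | recd B₂ _ ih => exact .recd B₂ ih
  | comEmpty _ ih => exact .comEmpty ih
  | selEmpty _ ih => exact .selEmpty ih
  | unfold h _ ih =>
    exact .unfold (List.getElem?_append_left (List.getElem?_eq_some_iff.1 h).1 ▸ h) ih

/-- If the inserted body is what performs the action, `Cap.unfold` inserts it on demand. Otherwise
the invocation survives in the remainder, which is why the remainders agree only up to `BEq`. -/
theorem Cap.of_repl {D B C : Beh Pid Var Expr Lbl} {n} (h : Repl D n B C) {l a C'}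
    (hl : l[n]? = some D) (hc : Cap l a C C') : ∃ B', Cap l a B B' ∧ BEq l B' C' := by
  induction h generalizing l C' with
  | here n => exact ⟨_, .unfold hl hc, .refl _ _⟩
  | com Θ h ih =>
    cases hc with
    | com _ ha => exact ⟨_, .com _ ha, .comOpt _ (.of_repl h hl)⟩
    | comEmpty hc =>
      obtain ⟨B', h₁, h₂⟩ := ih hl hc
      exact ⟨_, .comEmpty h₁, h₂⟩
  | sel S h ih =>
    cases hc with
    | sel _ ha => exact ⟨_, .sel _ ha, .selOpt _ (.of_repl h hl)⟩
    | selEmpty hc =>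
      obtain ⟨B', h₁, h₂⟩ := ih hl hc
      exact ⟨_, .selEmpty h₁, h₂⟩
  | branch p I f g ℓ h hg ih =>
    cases hc with
    | br _ b =>
      refine ⟨_, .br f b, ?_⟩
      by_cases hb : b = ℓ
      · subst hb; exact .of_repl h hl
      · rw [hg b hb]; exact .refl _ _
  | iteL e B₂ h ih =>
    cases hc with
    | iteTrue => exact ⟨_, .iteTrue _ _ _ _, .of_repl h hl⟩
    | iteFalse => exact ⟨_, .iteFalse _ _ _ _, .refl _ _⟩
  | iteR e B₁ h ih =>
    cases hc with
    | iteTrue => exact ⟨_, .iteTrue _ _ _ _, .refl _ _⟩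
    | iteFalse => exact ⟨_, .iteFalse _ _ _ _, .of_repl h hl⟩
  | recd B₂ h ih =>
    cases hc with | recd _ hc =>
    obtain ⟨B', h₁, h₂⟩ := ih (by simpa using hl) hc
    exact ⟨_, .recd _ h₁, .recd _ h₂⟩

/-- The structural precongruence reflects capabilities. -/
theorem Cap.of_pre {B C : Beh Pid Var Expr Lbl} (h : Pre B C) {l a C'} (hc : Cap l a C C') :
    ∃ B', Cap l a B B' ∧ BEq l B' C' := by
  induction h generalizing l C' with
  | refl => exact ⟨_, hc, .refl _ _⟩
  | trans _ _ ih₁ ih₂ =>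
    obtain ⟨B₂, h₂, h₂'⟩ := ih₂ hc
    obtain ⟨B₁, h₁, h₁'⟩ := ih₁ h₂
    exact ⟨B₁, h₁, h₁'.trans h₂'⟩
  | com Θ h ih =>
    cases hc with
    | com _ ha => exact ⟨_, .com _ ha, .comOpt _ (.of_pre h l)⟩
    | comEmpty hc =>
      obtain ⟨B', h₁, h₂⟩ := ih hc
      exact ⟨_, .comEmpty h₁, h₂⟩
  | sel S h ih =>
    cases hc with
    | sel _ ha => exact ⟨_, .sel _ ha, .selOpt _ (.of_pre h l)⟩
    | selEmpty hc =>
      obtain ⟨B', h₁, h₂⟩ := ih hc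
      exact ⟨_, .selEmpty h₁, h₂⟩
  | branch p I f g h ih =>
    cases hc with | br _ b => exact ⟨_, .br f b, .of_pre (h b) l⟩
  | ite e h₁ h₂ _ _ =>
    cases hc with
    | iteTrue => exact ⟨_, .iteTrue _ _ _ _, .of_pre h₁ l⟩
    | iteFalse => exact ⟨_, .iteFalse _ _ _ _, .of_pre h₂ l⟩
  | recd B₂ h ih =>
    cases hc with | recd _ hc =>
    obtain ⟨B', h₁, h₂⟩ := ih hc
    exact ⟨_, .recd _ h₁, .recd _ h₂⟩
  | unfold h =>
    cases hc with | recd _ hc =>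
    obtain ⟨B', h₁, h₂⟩ := Cap.of_repl h rfl hc
    exact ⟨_, .recd _ h₁, .recd _ h₂⟩
  | defNil => cases hc
  | comEmpty => exact ⟨_, .comEmpty hc, .refl _ _⟩
  | selEmpty => exact ⟨_, .selEmpty hc, .refl _ _⟩

section Iterate

variable (l : List (Beh Pid Var Expr Lbl)) (n : ℕ)

theorem unf_iterate_com (Θ) (B : Beh Pid Var Expr Lbl) :
    (unf l)^[n] (com Θ B) = com Θ ((unf l)^[n] B) := by
  induction n generalizing B with
  | zero => rfl
  | succ n ih => simp [ih, unf]

theorem unf_iterate_sel (S) (B : Beh Pid Var Expr Lbl) :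
    (unf l)^[n] (sel S B) = sel S ((unf l)^[n] B) := by
  induction n generalizing B with
  | zero => rfl
  | succ n ih => simp [ih, unf]

theorem unf_iterate_branch (p : Pid) (I : Finset Lbl) (f : I → Beh Pid Var Expr Lbl) :
    (unf l)^[n] (branch p I f) = branch p I (fun ℓ => (unf l)^[n] (f ℓ)) := by
  induction n generalizing f with
  | zero => rfl
  | succ n ih => simp [ih, unf]

theorem unf_iterate_ite (e) (B₁ B₂ : Beh Pid Var Expr Lbl) :
    (unf l)^[n] (ite e B₁ B₂) = ite e ((unf l)^[n] B₁) ((unf l)^[n] B₂) := by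
  induction n generalizing B₁ B₂ with
  | zero => rfl
  | succ n ih => simp [ih, unf]

theorem unf_iterate_recd (B₂ B₁ : Beh Pid Var Expr Lbl) :
    (unf l)^[n] (recd B₂ B₁) = recd B₂ ((unf (B₂ :: l))^[n] B₁) := by
  induction n generalizing B₁ with
  | zero => rfl
  | succ n ih => simp [ih, unf]

theorem BEq.unf_iterate (B : Beh Pid Var Expr Lbl) : BEq l B ((Beh.unf l)^[n] B) := by
  induction n generalizing B with
  | zero => exact .refl _ _
  | succ n ih => exact (BEq.unf l B).trans (ih _)

end Iterate

/-- A capability shows at the head after sufficiently many uniform unfoldings. -/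
theorem Cap.exists_LH {l a} {B B' : Beh Pid Var Expr Lbl} (h : Cap l a B B') :
    ∃ n₀, ∀ n ≥ n₀, ∃ B'', LH a ((unf l)^[n] B) B'' ∧ BEq l B'' B' := by
  induction h with
  | com B h =>
    refine ⟨0, fun n _ => ⟨_, by rw [unf_iterate_com]; exact .com _ h, .comOpt _ ?_⟩⟩
    exact (BEq.unf_iterate _ n B).symm
  | sel B h =>
    refine ⟨0, fun n _ => ⟨_, by rw [unf_iterate_sel]; exact .sel _ h, .selOpt _ ?_⟩⟩
    exact (BEq.unf_iterate _ n B).symm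
  | br f b =>
    refine ⟨0, fun n _ => ⟨_, by rw [unf_iterate_branch]; exact .br _ b, ?_⟩⟩
    exact (BEq.unf_iterate _ n _).symm
  | iteTrue l e B₁ B₂ =>
    refine ⟨0, fun n _ => ⟨_, by rw [unf_iterate_ite]; exact .iteTrue _ _ _, ?_⟩⟩
    exact (BEq.unf_iterate _ n _).symm
  | iteFalse l e B₁ B₂ =>
    refine ⟨0, fun n _ => ⟨_, by rw [unf_iterate_ite]; exact .iteFalse _ _ _, ?_⟩⟩
    exact (BEq.unf_iterate _ n _).symm
  | recd B₂ _ ih =>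
    obtain ⟨n₀, ih⟩ := ih
    refine ⟨n₀, fun n hn => ?_⟩
    obtain ⟨B'', h, h'⟩ := ih n hn
    exact ⟨_, by rw [unf_iterate_recd]; exact .recd _ h, .recd _ h'⟩
  | comEmpty _ ih =>
    obtain ⟨n₀, ih⟩ := ih
    refine ⟨n₀, fun n hn => ?_⟩
    obtain ⟨B'', h, h'⟩ := ih n hn
    exact ⟨_, by rw [unf_iterate_com]; exact .comEmpty h, h'⟩
  | selEmpty _ ih =>
    obtain ⟨n₀, ih⟩ := ih
    refine ⟨n₀, fun n hn => ?_⟩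
    obtain ⟨B'', h, h'⟩ := ih n hn
    exact ⟨_, by rw [unf_iterate_sel]; exact .selEmpty h, h'⟩
  | @unfold l a k A B' hk _ ih =>
    obtain ⟨n₀, ih⟩ := ih
    -- The first round turns the invocation into its body; the other rounds act on that body.
    refine ⟨n₀ + 1, fun n hn => ?_⟩
    obtain ⟨m, rfl⟩ : ∃ m, n = m + 1 := ⟨n - 1, by omega⟩
    obtain ⟨B'', h, h'⟩ := ih m (by omega)
    refine ⟨B'', ?_, h'⟩
    simpa [unf, hk] using h

end Actions
end Beh

/-! ### Well-formedness under subsets and index shifts -/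

section Wellformedness

variable {Pid Var Val Expr Lbl : Type*} {L : ExprLang Var Val Expr}

theorem WFCom.mono {H H' : Finset (Com Pid Var Expr)} (h : WFCom L H') (hs : H ⊆ H') : WFCom L H :=
  ⟨fun η hη => h.1 η (hs hη), fun η hη η' hη' => h.2.1 η (hs hη) η' (hs hη'),
    fun η hη η' hη' => h.2.2 η (hs hη) η' (hs hη')⟩

theorem WFSel.mono {Φ Φ' : Finset (Sel Pid Lbl)} (h : WFSel Φ') (hs : Φ ⊆ Φ') : WFSel Φ :=
  ⟨fun φ hφ => h.1 φ (hs hφ), fun φ hφ φ' hφ' => h.2 φ (hs hφ) φ' (hs hφ')⟩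

namespace Chor

theorem WF.lift {C : Chor Pid Var Expr Lbl} (h : C.WF L) (d c : ℕ) : (C.lift d c).WF L := by
  induction C generalizing c with
  | com H C ih => exact ⟨h.1, ih h.2 c⟩
  | sel Φ C ih => exact ⟨h.1, ih h.2 c⟩
  | ite p e C₁ C₂ ih₁ ih₂ => exact ⟨ih₁ h.1 c, ih₂ h.2 c⟩
  | recd C₂ C₁ ih₂ ih₁ => exact ⟨ih₂ h.1 _, ih₁ h.2 _⟩
  | call k => trivial
  | nil => trivial

theorem ClosedAt.lift {C : Chor Pid Var Expr Lbl} {n c : ℕ} (h : C.ClosedAt n) (d : ℕ)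
    (hc : c ≤ n) : (C.lift d c).ClosedAt (n + d) := by
  induction C generalizing c n with
  | com H C ih => exact ih h hc
  | sel Φ C ih => exact ih h hc
  | ite p e C₁ C₂ ih₁ ih₂ => exact ⟨ih₁ h.1 hc, ih₂ h.2 hc⟩
  | recd C₂ C₁ ih₂ ih₁ =>
    have h₂ := ih₂ h.1 (Nat.succ_le_succ hc)
    have h₁ := ih₁ h.2 (Nat.succ_le_succ hc)
    simp only [Nat.succ_eq_add_one, Nat.add_right_comm n 1 d] at h₁ h₂
    exact ⟨h₂, h₁⟩
  | call k =>
    simp only [ClosedAt, Chor.lift] at h ⊢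
    split <;> omega
  | nil => trivial

end Chor

end Wellformedness

/-! ### Process annotations of procedures -/

section ProcessNames

variable {Pid Var Expr Lbl : Type*} [DecidableEq Pid]

namespace Chor

theorem pn_lift (Γ₁ Δ Γ₂ : List (Finset Pid)) (C : Chor Pid Var Expr Lbl) :
    pn (Γ₁ ++ Δ ++ Γ₂) (C.lift Δ.length Γ₁.length) = pn (Γ₁ ++ Γ₂) C := by
  induction C generalizing Γ₁ with
  | com H C ih => simp only [lift, pn, ih]
  | sel Φ C ih => simp only [lift, pn, ih]
  | ite p e C₁ C₂ ih₁ ih₂ => simp only [lift, pn, ih₁, ih₂]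
  | recd C₂ C₁ ih₂ ih₁ =>
    have h₂ := ih₂ (∅ :: Γ₁)
    have h₁ := ih₁ (pn (∅ :: (Γ₁ ++ Γ₂)) C₂ :: Γ₁)
    simp only [List.cons_append, List.length_cons] at h₁ h₂
    simp only [lift, pn, h₂, h₁]
  | call k =>
    simp only [lift, pn, List.getD_eq_getElem?_getD]
    congr 1
    split
    · rename_i h
      rw [List.append_assoc, List.getElem?_append_left h, List.getElem?_append_left h]
    · rename_i h
      rw [List.getElem?_append_right (by simp; omega), List.getElem?_append_right (by omega)]
      congr 1
      simp; omega
  | nil => rfl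

/-- Annotations enter the set of processes only through unions, so enlarging them by `A` enlarges
the result by at most `A`. -/
theorem pn_subset_union (A : Finset Pid) (C : Chor Pid Var Expr Lbl) {Γ Γ' : List (Finset Pid)}
    (h : ∀ k, Γ'.getD k ∅ ⊆ A ∪ Γ.getD k ∅) : pn Γ' C ⊆ A ∪ pn Γ C := by
  induction C generalizing Γ Γ' with
  | com H C ih =>
    have := ih h
    simp only [pn]
    grind
  | sel Φ C ih =>
    have := ih h
    simp only [pn]
    grind
  | ite p e C₁ C₂ ih₁ ih₂ =>
    have := ih₁ h
    have := ih₂ h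
    simp only [pn]
    grind
  | recd C₂ C₁ ih₂ ih₁ =>
    have h₂ : pn (∅ :: Γ') C₂ ⊆ A ∪ pn (∅ :: Γ) C₂ := ih₂ fun k => by
      cases k with
      | zero => simp
      | succ k => simpa using h k
    have h₁ : pn (pn (∅ :: Γ') C₂ :: Γ') C₁ ⊆ A ∪ pn (pn (∅ :: Γ) C₂ :: Γ) C₁ := ih₁ fun k => by
      cases k with
      | zero => simpa using h₂
      | succ k => simpa using h k
    simp only [pn]
    grind
  | call k => exact h k
  | nil => simp [pn]

/-- The annotation of a procedure is the set of processes of its body. -/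
theorem pn_fix (Γ : List (Finset Pid)) (C : Chor Pid Var Expr Lbl) :
    pn (pn (∅ :: Γ) C :: Γ) C = pn (∅ :: Γ) C := by
  apply Finset.Subset.antisymm
  -- With `A` the set on the right, annotating the procedure by `A` instead of `∅` adds nothing
  -- outside `A`.
  · have := pn_subset_union (pn (∅ :: Γ) C) C (Γ := ∅ :: Γ) (Γ' := pn (∅ :: Γ) C :: Γ) (fun k => by
      cases k <;> simp)
    simpa using this
  · have := pn_subset_union ∅ C (Γ' := ∅ :: Γ) (Γ := pn (∅ :: Γ) C :: Γ) (fun k => by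
      cases k <;> simp)
    simpa using this

end Chor

end ProcessNames

/-! ### Behaviour projection: trivial cases, uniqueness, index shifts -/

section Projection

variable {Pid Var Val Expr Lbl : Type*} {L : ExprLang Var Val Expr}
  [DecidableEq Pid] [DecidableEq Var] [DecidableEq Expr] [DecidableEq Lbl]

open Chor

theorem actsOf_eq_empty {r : Pid} {H : Finset (Com Pid Var Expr)}
    (h : ∀ η ∈ H, η.src ≠ r ∧ η.tgt ≠ r) : actsOf r H = ∅ := by
  ext a
  simp only [actsOf, Finset.mem_union, Finset.mem_image, Finset.mem_filter, Finset.notMem_empty,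
    iff_false]
  rintro (⟨η, ⟨hη, h'⟩, _⟩ | ⟨η, ⟨hη, h'⟩, _⟩)
  · exact (h η hη).1 h'
  · exact (h η hη).2 h'

theorem selsOf_eq_empty {r : Pid} {Φ : Finset (Sel Pid Lbl)} (h : ∀ φ ∈ Φ, φ.src ≠ r) :
    selsOf r Φ = ∅ := by
  ext a
  simp only [selsOf, Finset.mem_image, Finset.mem_filter, Finset.notMem_empty, iff_false]
  rintro ⟨φ, ⟨hφ, h'⟩, _⟩
  exact h φ hφ h'

theorem Proj.eq_nil {r : Pid} {Γ} {C : Chor Pid Var Expr Lbl} {B} (h : Proj r Γ C B)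
    (hr : r ∉ pn Γ C) : B = .nil := by
  induction h with
  | nil => rfl
  | com H _ ih =>
    simp only [pn, Finset.mem_union, Finset.mem_image, not_or, not_exists, not_and] at hr
    rw [actsOf_eq_empty fun η hη => ⟨hr.1.1 η hη, hr.1.2 η hη⟩, ih hr.2]
    simp [Beh.comOpt]
  | selRecv Φ φ hφ h _ _ =>
    simp only [pn, Finset.mem_union, Finset.mem_image, not_or, not_exists, not_and] at hr
    exact absurd h (hr.1.2 φ hφ)
  | selSend Φ h _ ih =>
    simp only [pn, Finset.mem_union, Finset.mem_image, not_or, not_exists, not_and] at hr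
    rw [selsOf_eq_empty hr.1.1, ih hr.2]
    simp [Beh.selOpt]
  | iteSelf => simp [pn] at hr
  | iteOther p e h _ _ hm ih₁ ih₂ =>
    simp only [pn, Finset.mem_union, not_or] at hr
    rw [ih₁ hr.1.2, ih₂ hr.2] at hm
    cases hm; rfl
  | recIn h => simp [pn, h] at hr
  | recOut h _ ih =>
    simp only [pn, Finset.mem_union, not_or] at hr
    exact ih hr.2
  | callIn k hk h => simp [pn, List.getD_eq_getElem?_getD, hk, h] at hr
  | callOut => rfl

/-- This lets projectability be stated for all processes instead of those that occur. Closedness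
matters, since an invocation without a definition has no projection. -/
theorem Proj.exists_nil {r : Pid} {Γ} {C : Chor Pid Var Expr Lbl} (hc : C.ClosedAt Γ.length)
    (hr : r ∉ pn Γ C) : Proj r Γ C .nil := by
  induction C generalizing Γ with
  | com H C ih =>
    simp only [pn, Finset.mem_union, Finset.mem_image, not_or, not_exists, not_and] at hr
    have := Proj.com H (ih hc hr.2)
    rwa [actsOf_eq_empty fun η hη => ⟨hr.1.1 η hη, hr.1.2 η hη⟩, Beh.comOpt, if_pos rfl] at this
  | sel Φ C ih =>
    simp only [pn, Finset.mem_union, Finset.mem_image, not_or, not_exists, not_and] at hr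
    have := Proj.selSend Φ hr.1.2 (ih hc hr.2)
    rwa [selsOf_eq_empty hr.1.1, Beh.selOpt, if_pos rfl] at this
  | ite p e C₁ C₂ ih₁ ih₂ =>
    simp only [pn, Finset.mem_union, not_or, Finset.mem_singleton] at hr
    exact .iteOther p e (Ne.symm hr.1.1) (ih₁ hc.1 hr.1.2) (ih₂ hc.2 hr.2) .nil
  | recd C₂ C₁ ih₂ ih₁ =>
    simp only [pn, Finset.mem_union, not_or] at hr
    exact .recOut hr.1 (ih₁ hc.2 hr.2)
  | call k =>
    have hk : Γ[k]? = some Γ[k] := List.getElem?_eq_getElem hc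
    refine .callOut k hk ?_
    simpa [pn, List.getD_eq_getElem?_getD, hk] using hr
  | nil => exact .nil _

theorem Proj.functional {r : Pid} {Γ} {C : Chor Pid Var Expr Lbl} {B B'} (h : Proj r Γ C B)
    (h' : Proj r Γ C B') (hC : C.WF L) : B = B' := by
  induction h generalizing B' with
  | nil => cases h'; rfl
  | com H _ ih => cases h' with | com _ h' => rw [ih h' hC.2]
  | selRecv Φ φ hφ h _ ih =>
    cases h' with
    | selRecv _ φ' hφ' h' hp =>
      -- Distinct selections in a well-formed group have distinct targets.
      have : φ = φ' := by
        by_contra hne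
        exact (hC.1.2 φ hφ φ' hφ' hne).2 (h.trans h'.symm)
      subst this
      rw [ih hp hC.2]
    | selSend _ hn => exact absurd h (hn φ hφ)
  | selSend Φ hn _ ih =>
    cases h' with
    | selRecv _ φ' hφ' h' _ => exact absurd h' (hn φ' hφ')
    | selSend _ _ h' => rw [ih h' hC.2]
  | iteSelf e _ _ ih₁ ih₂ =>
    cases h' with
    | iteSelf _ h₁ h₂ => rw [ih₁ h₁ hC.1, ih₂ h₂ hC.2]
    | iteOther _ _ h => exact absurd rfl h
  | iteOther p e h _ _ hm ih₁ ih₂ =>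
    cases h' with
    | iteSelf => exact absurd rfl h
    | iteOther _ _ _ h₁ h₂ hm' =>
      rw [ih₁ h₁ hC.1, ih₂ h₂ hC.2] at hm
      exact hm.functional hm'
  | recIn h _ _ ih₂ ih₁ =>
    cases h' with
    | recIn _ h₂ h₁ => rw [ih₂ h₂ hC.1, ih₁ h₁ hC.2]
    | recOut hn => exact absurd h hn
  | recOut h _ ih =>
    cases h' with
    | recIn hn => exact absurd hn h
    | recOut _ h₁ => exact ih h₁ hC.2
  | callIn k hk h =>
    cases h' with
    | callIn => rfl
    | callOut _ hk' h' =>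
      rw [hk] at hk'; cases hk'
      exact absurd h h'
  | callOut k hk h =>
    cases h' with
    | callIn _ hk' h' =>
      rw [hk] at hk'; cases hk'
      exact absurd h' h
    | callOut => rfl

theorem Beh.lift_comOpt (d c : ℕ) (Θ) (B : Beh Pid Var Expr Lbl) :
    (Beh.comOpt Θ B).lift d c = Beh.comOpt Θ (B.lift d c) := by
  unfold Beh.comOpt; split <;> rfl

theorem Beh.lift_selOpt (d c : ℕ) (S) (B : Beh Pid Var Expr Lbl) :
    (Beh.selOpt S B).lift d c = Beh.selOpt S (B.lift d c) := by
  unfold Beh.selOpt; split <;> rfl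

/-- A projected index counts only the definitions kept for `r`. Shift and cutoff of the behaviour
are therefore the numbers of annotations containing `r`, not the lengths of the lists. -/
theorem Proj.lift {r : Pid} {Γ₁ Γ₂ : List (Finset Pid)} {C : Chor Pid Var Expr Lbl} {B}
    (Δ : List (Finset Pid)) (h : Proj r (Γ₁ ++ Γ₂) C B) :
    Proj r (Γ₁ ++ Δ ++ Γ₂) (C.lift Δ.length Γ₁.length)
      (B.lift (Δ.countP (fun A => r ∈ A)) (Γ₁.countP (fun A => r ∈ A))) := by
  generalize hΓ : Γ₁ ++ Γ₂ = Γ at h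
  induction h generalizing Γ₁ with
  | nil => exact .nil _
  | com H _ ih => rw [Beh.lift_comOpt]; exact .com H (ih hΓ)
  | selRecv Φ φ hφ h _ ih => exact .selRecv Φ φ hφ h (ih hΓ)
  | selSend Φ hn _ ih => rw [Beh.lift_selOpt]; exact .selSend Φ hn (ih hΓ)
  | iteSelf e _ _ ih₁ ih₂ => exact .iteSelf e (ih₁ hΓ) (ih₂ hΓ)
  | iteOther p e h _ _ hm ih₁ ih₂ => exact .iteOther p e h (ih₁ hΓ) (ih₂ hΓ) (hm.lift _ _)
  | @recIn _ C₁ C₂ _ _ h _ _ ih₂ ih₁ =>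
    subst hΓ
    have e := pn_lift (∅ :: Γ₁) Δ Γ₂ C₂
    have h₁ := ih₁ (Γ₁ := pn (∅ :: (Γ₁ ++ Γ₂)) C₂ :: Γ₁) rfl
    have h₂ := ih₂ (Γ₁ := pn (∅ :: (Γ₁ ++ Γ₂)) C₂ :: Γ₁) rfl
    simp only [List.cons_append, List.length_cons] at h₁ h₂ e
    rw [List.countP_cons_of_pos (by simpa using h)] at h₁ h₂
    rw [← e] at h h₁ h₂
    exact .recIn h h₂ h₁
  | @recOut _ C₁ C₂ _ h _ ih =>
    subst hΓ
    have e := pn_lift (∅ :: Γ₁) Δ Γ₂ C₂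
    have h₁ := ih (Γ₁ := pn (∅ :: (Γ₁ ++ Γ₂)) C₂ :: Γ₁) rfl
    simp only [List.cons_append, List.length_cons] at h₁ e
    rw [List.countP_cons_of_neg (by simpa using h)] at h₁
    rw [← e] at h h₁
    exact .recOut h h₁
  | @callIn _ A k hk h =>
    subst hΓ
    by_cases hlt : k < Γ₁.length
    · have hk' : (Γ₁ ++ Δ ++ Γ₂)[k]? = some A := by
        rw [List.append_assoc, List.getElem?_append_left hlt]
        rwa [List.getElem?_append_left hlt] at hk
      rw [List.getElem?_append_left hlt, List.getElem?_eq_getElem hlt] at hk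
      -- Definition `k` is itself kept, so the projected index lies strictly below the projected
      -- cutoff.
      have hcnt : (Γ₁.take k).countP (fun A => r ∈ A) < Γ₁.countP (fun A => r ∈ A) := by
        conv_rhs => rw [← List.take_append_drop k Γ₁, List.drop_eq_getElem_cons hlt]
        rw [List.countP_append, List.countP_cons_of_pos (by simpa [Option.some.inj hk] using h)]
        omega
      have := Proj.callIn (r := r) (Var := Var) (Expr := Expr) (Lbl := Lbl) k hk' h
      rw [List.append_assoc, List.take_append_of_le_length hlt.le] at this
      simpa [Chor.lift, Beh.lift, hlt, List.take_append_of_le_length hlt.le, hcnt] using this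
    · obtain ⟨j, rfl⟩ : ∃ j, k = Γ₁.length + j := ⟨k - Γ₁.length, by omega⟩
      rw [List.getElem?_append_right (by omega)] at hk
      have hk' : (Γ₁ ++ Δ ++ Γ₂)[(Γ₁ ++ Δ).length + j]? = some A := by
        rw [List.getElem?_append_right (by omega)]
        simpa using hk
      have := Proj.callIn (r := r) (Var := Var) (Expr := Expr) (Lbl := Lbl) _ hk' h
      rw [List.take_length_add_append] at this
      simp only [Chor.lift, Beh.lift, hlt, if_false, List.take_length_add_append,
        List.countP_append]
      rw [if_neg (by omega)]
      simp only [List.length_append, List.countP_append] at this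
      convert this using 2
      · omega
      · omega
  | @callOut _ A k hk h =>
    subst hΓ
    by_cases hlt : k < Γ₁.length
    · have hk' : (Γ₁ ++ Δ ++ Γ₂)[k]? = some A := by
        rw [List.append_assoc, List.getElem?_append_left hlt]
        rwa [List.getElem?_append_left hlt] at hk
      simpa [Chor.lift, Beh.lift, hlt] using Proj.callOut k hk' h
    · have hk' : (Γ₁ ++ Δ ++ Γ₂)[k + Δ.length]? = some A := by
        rw [List.getElem?_append_right (by simp; omega)]
        rw [List.getElem?_append_right (by omega)] at hk
        rw [← hk]; congr 1; simp; omega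
      simpa [Chor.lift, Beh.lift, hlt] using Proj.callOut _ hk' h

end Projection

/-! ### The invariant that survives every step -/

section Good

variable {Pid Var Val Expr Lbl : Type*} 
  [DecidableEq Pid] [DecidableEq Var] [DecidableEq Expr] [DecidableEq Lbl]

namespace Chor

/-- The requirements on the body of a definition: it is well-formed, closed, and projectable. -/
def GoodDef (L : ExprLang Var Val Expr) (Γ : List (Finset Pid)) (C : Chor Pid Var Expr Lbl) : Prop :=
  C.WF L ∧ C.ClosedAt (Γ.length + 1) ∧ ∀ r, ∃ B, Proj r (pn (∅ :: Γ) C :: Γ) C B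

/-- Well-formed and closed choreographies with projectable definitions. In contrast to
projectability, this is preserved by the semantics. -/
def Good (L : ExprLang Var Val Expr) : List (Finset Pid) → Chor Pid Var Expr Lbl → Prop
  | Γ, com H C => WFCom L H ∧ C.Good L Γ
  | Γ, sel Φ C => WFSel Φ ∧ C.Good L Γ
  | Γ, ite _ _ C₁ C₂ => C₁.Good L Γ ∧ C₂.Good L Γ
  | Γ, recd C₂ C₁ => C₂.GoodDef L Γ ∧ C₁.Good L (pn (∅ :: Γ) C₂ :: Γ)
  | Γ, call k => k < Γ.length
  | _, nil => True

variable {L : ExprLang Var Val Expr}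

theorem Good.wf {Γ} {C : Chor Pid Var Expr Lbl} (h : C.Good L Γ) : C.WF L := by
  induction C generalizing Γ with
  | com H C ih => exact ⟨h.1, ih h.2⟩
  | sel Φ C ih => exact ⟨h.1, ih h.2⟩
  | ite p e C₁ C₂ ih₁ ih₂ => exact ⟨ih₁ h.1, ih₂ h.2⟩
  | recd C₂ C₁ ih₂ ih₁ => exact ⟨h.1.1, ih₁ h.2⟩
  | call k => trivial
  | nil => trivial

theorem Good.of_proj {Γ} {C : Chor Pid Var Expr Lbl} (hw : C.WF L) (hc : C.ClosedAt Γ.length)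
    (hp : ∀ r, ∃ B, Proj r Γ C B) : C.Good L Γ := by
  induction C generalizing Γ with
  | com H C ih =>
    refine ⟨hw.1, ih hw.2 hc fun r => ?_⟩
    obtain ⟨B, h⟩ := hp r
    cases h with | com _ h => exact ⟨_, h⟩
  | sel Φ C ih =>
    refine ⟨hw.1, ih hw.2 hc fun r => ?_⟩
    obtain ⟨B, h⟩ := hp r
    cases h with
    | selRecv _ _ _ _ h => exact ⟨_, h⟩
    | selSend _ _ h => exact ⟨_, h⟩
  | ite p e C₁ C₂ ih₁ ih₂ =>
    refine ⟨ih₁ hw.1 hc.1 fun r => ?_, ih₂ hw.2 hc.2 fun r => ?_⟩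
    · obtain ⟨B, h⟩ := hp r
      cases h with
      | iteSelf _ h₁ h₂ => exact ⟨_, h₁⟩
      | iteOther _ _ _ h₁ h₂ => exact ⟨_, h₁⟩
    · obtain ⟨B, h⟩ := hp r
      cases h with
      | iteSelf _ h₁ h₂ => exact ⟨_, h₂⟩
      | iteOther _ _ _ h₁ h₂ => exact ⟨_, h₂⟩
  | recd C₂ C₁ ih₂ ih₁ =>
    refine ⟨⟨hw.1, hc.1, fun r => ?_⟩, ih₁ hw.2 hc.2 fun r => ?_⟩
    -- If `r` does not occur in the body, the projection of the definition says nothing about it,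
    -- but the body then projects to `nil` anyway.
    · by_cases hr : r ∈ pn (∅ :: Γ) C₂
      · obtain ⟨B, h⟩ := hp r
        cases h with
        | recIn _ h₂ h₁ => exact ⟨_, h₂⟩
        | recOut hn => exact absurd hr hn
      · exact ⟨_, Proj.exists_nil hc.1 (by rwa [pn_fix])⟩
    · obtain ⟨B, h⟩ := hp r
      cases h with
      | recIn _ h₂ h₁ => exact ⟨_, h₁⟩
      | recOut _ h₁ => exact ⟨_, h₁⟩
  | call k => exact hc
  | nil => trivial

/-- A body inserted below the binders `Δ` is still well-formed, closed and projectable, because its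
projections shift along with it. -/
theorem GoodDef.good_lift {Γ} {D : Chor Pid Var Expr Lbl} (h : D.GoodDef L Γ)
    (Δ : List (Finset Pid)) :
    (D.lift Δ.length 0).Good L (Δ ++ pn (∅ :: Γ) D :: Γ) := by
  refine .of_proj (h.1.lift _ _) ?_ fun r => ?_
  · have := h.2.1.lift Δ.length (Nat.zero_le _)
    convert this using 1
    simp; omega
  · obtain ⟨B, hB⟩ := h.2.2 r
    exact ⟨_, Proj.lift (Γ₁ := []) Δ hB⟩

theorem Good.repl {D C C' : Chor Pid Var Expr Lbl} {n} (h : Repl D n C C') {Γ Δ}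
    (hD : D.GoodDef L Γ) (hn : n = Δ.length) (hC : C.Good L (Δ ++ pn (∅ :: Γ) D :: Γ)) :
    C'.Good L (Δ ++ pn (∅ :: Γ) D :: Γ) := by
  induction h generalizing Δ with
  | here n => subst hn; exact hD.good_lift Δ
  | com H _ ih => exact ⟨hC.1, ih hn hC.2⟩
  | sel Φ _ ih => exact ⟨hC.1, ih hn hC.2⟩
  | iteL p e C₂ _ ih => exact ⟨ih hn hC.1, hC.2⟩
  | iteR p e C₁ _ ih => exact ⟨hC.1, ih hn hC.2⟩
  | recd C₂ _ ih => exact ⟨hC.1, ih (Δ := _ :: Δ) (by simp [hn]) hC.2⟩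

theorem Good.swap {C C' : Chor Pid Var Expr Lbl} (h : Swap L C C') {Γ} :
    C.Good L Γ ↔ C'.Good L Γ := by
  cases h with
  | comCom H₁ H₂ hd C hw =>
    simp only [Good]
    have h₁ : WFCom L H₁ := hw.mono fun x hx => by simp [hx]
    have h₂ : WFCom L H₂ := hw.mono fun x hx => by simp [hx]
    tauto
  | selSel Φ₁ Φ₂ hd C hw =>
    simp only [Good]
    have h₁ : WFSel Φ₁ := hw.mono fun x hx => by simp [hx]
    have h₂ : WFSel Φ₂ := hw.mono fun x hx => by simp [hx]
    tauto
  | comSel | comIte | selIte | comRec | selRec | iteRec | iteIte => simp only [Good]; tauto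

theorem Good.pre {C C' : Chor Pid Var Expr Lbl} (h : Pre L C C') {Γ} (hC : C.Good L Γ) :
    C'.Good L Γ := by
  induction h generalizing Γ with
  | refl => exact hC
  | trans _ _ ih₁ ih₂ => exact ih₂ (ih₁ hC)
  | com H _ ih => exact ⟨hC.1, ih hC.2⟩
  | sel Φ _ ih => exact ⟨hC.1, ih hC.2⟩
  | ite p e _ _ ih₁ ih₂ => exact ⟨ih₁ hC.1, ih₂ hC.2⟩
  | recd C₂ _ ih => exact ⟨hC.1, ih hC.2⟩
  | unfold h => exact ⟨hC.1, Good.repl (Δ := []) h hC.1 rfl hC.2⟩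
  | defNil => trivial
  | comEmpty => exact hC.2
  | selEmpty => exact hC.2
  | swap h => exact (Good.swap h).1 hC
  | swapSymm h => exact (Good.swap h).2 hC

/-- No mergeability is demanded outside procedure bodies, and the semantics copies bodies but never
rewrites them. -/
theorem Good.step {x y : Chor Pid Var Expr Lbl × State Pid Var Val} (h : Step L x y) {Γ}
    (hC : x.1.Good L Γ) : y.1.Good L Γ := by
  induction h generalizing Γ with
  | com => exact hC.2
  | sel => exact hC.2
  | iteTrue => exact hC.1
  | iteFalse => exact hC.2
  | str h _ h' ih => exact (ih (hC.pre h)).pre h'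
  | ctx C₂ _ ih => exact ⟨hC.1, ih hC.2⟩

/-- The projections on the occurring processes are completed by `nil` on all others. -/
theorem ClosedAt.good_of_epp {C : Chor Pid Var Expr Lbl} (hc : C.ClosedAt 0) (hw : C.WF L)
    {B : Pid → Beh Pid Var Expr Lbl} (hB : ∀ p ∈ pn [] C, Proj p [] C (B p)) :
    ∃ B' : Pid → Beh Pid Var Expr Lbl, (∀ p ∈ pn [] C, B' p = B p) ∧ (∀ p, Proj p [] C (B' p)) ∧
      C.Good L [] := by
  have key : ∀ p, Proj p [] C (if p ∈ pn [] C then B p else .nil) := fun p => by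
    split
    · exact hB p ‹_›
    · exact Proj.exists_nil hc ‹_›
  exact ⟨_, fun p hp => by simp [hp], key, .of_proj hw hc fun r => ⟨_, key r⟩⟩

end Chor

end Good

/-! ### Uniform unfolding of choreographies and its projection -/

section Unfolding

variable {Pid Var Val Expr Lbl : Type*}

namespace Chor

/-- Every invocation in the scope of `C` is unfolded once; `l` lists the enclosing bodies. -/
def unf : List (Chor Pid Var Expr Lbl) → Chor Pid Var Expr Lbl → Chor Pid Var Expr Lbl
  | l, com H C => com H (unf l C)
  | l, sel Φ C => sel Φ (unf l C)
  | l, ite p e C₁ C₂ => ite p e (unf l C₁) (unf l C₂)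
  | l, recd C₂ C₁ => recd C₂ (unf (C₂ :: l) C₁)
  | l, call k => (l[k]?).elim (call k) (lift k 0)
  | _, nil => nil

/-- Evaluation contexts, with the list of definitions in whose scope the hole is. -/
inductive IsCtx : List (Chor Pid Var Expr Lbl) →
    (Chor Pid Var Expr Lbl → Chor Pid Var Expr Lbl) → Prop
  | id : IsCtx [] (fun C => C)
  | com {l K} (H) : IsCtx l K → IsCtx l (fun C => K (com H C))
  | sel {l K} (Φ) : IsCtx l K → IsCtx l (fun C => K (sel Φ C))
  | iteL {l K} (p e C₂) : IsCtx l K → IsCtx l (fun C => K (ite p e C C₂))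
  | iteR {l K} (p e C₁) : IsCtx l K → IsCtx l (fun C => K (ite p e C₁ C))
  | recd {l K} (A) : IsCtx l K → IsCtx (A :: l) (fun C => K (recd A C))

variable (L : ExprLang Var Val Expr)

theorem IsCtx.pre {l : List (Chor Pid Var Expr Lbl)} {K} (hK : IsCtx l K) {C C'} (h : Pre L C C') :
    Pre L (K C) (K C') := by
  induction hK generalizing C C' with
  | id => exact h
  | com H _ ih => exact ih (.com H h)
  | sel Φ _ ih => exact ih (.sel Φ h)
  | iteL p e C₂ _ ih => exact ih (.ite p e h (.refl _))
  | iteR p e C₁ _ ih => exact ih (.ite p e (.refl _) h)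
  | recd A _ ih => exact ih (.recd A h)

theorem IsCtx.repl {l : List (Chor Pid Var Expr Lbl)} {K} (hK : IsCtx l K) {C C' D n}
    (hn : l[n]? = some D) (h : Repl D n C C') : Pre L (K C) (K C') := by
  induction hK generalizing C C' n with
  | id => simp at hn
  | com H _ ih => exact ih hn (.com H h)
  | sel Φ _ ih => exact ih hn (.sel Φ h)
  | iteL p e C₂ _ ih => exact ih hn (.iteL p e _ h)
  | iteR p e C₁ _ ih => exact ih hn (.iteR p e _ h)
  | recd A hK ih =>
    cases n with
    | zero => cases hn; exact hK.pre L (.unfold h)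
    | succ n => exact ih (by simpa using hn) (.recd A h)

theorem IsCtx.pre_unf (C : Chor Pid Var Expr Lbl) {l K} (hK : IsCtx l K) :
    Pre L (K C) (K (Chor.unf l C)) := by
  induction C generalizing l K with
  | com H _ ih => exact ih (.com H hK)
  | sel Φ _ ih => exact ih (.sel Φ hK)
  | ite p e C₁ C₂ ih₁ ih₂ => exact .trans (ih₁ (.iteL p e C₂ hK)) (ih₂ (.iteR p e _ hK))
  | recd C₂ _ _ ih => exact ih (.recd C₂ hK)
  | call k =>
    cases h : l[k]? with
    | none => simpa [Chor.unf, h] using .refl _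
    | some A => simpa [Chor.unf, h] using hK.repl L h (.here k)
  | nil => exact .refl _

theorem Pre.unf (C : Chor Pid Var Expr Lbl) : Pre L C (Chor.unf [] C) :=
  IsCtx.id.pre_unf L C

/-- The choreography `C` in the scope of the definitions `l`, the innermost one first. -/
def wrap : List (Chor Pid Var Expr Lbl) → Chor Pid Var Expr Lbl → Chor Pid Var Expr Lbl
  | [], C => C
  | A :: l, C => wrap l (recd A C)

theorem unf_wrap (l l' : List (Chor Pid Var Expr Lbl)) (C) :
    unf l' (wrap l C) = wrap l (unf (l ++ l') C) := by
  induction l generalizing C with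
  | nil => rfl
  | cons A l ih => rw [wrap, ih]; rfl

theorem Pre.wrap (l : List (Chor Pid Var Expr Lbl)) {C C'} (h : Pre L C C') :
    Pre L (wrap l C) (wrap l C') := by
  induction l generalizing C C' with
  | nil => exact h
  | cons A l ih => exact ih (.recd A h)

theorem Pre.wrap_nil (l : List (Chor Pid Var Expr Lbl)) : Pre L (Chor.wrap l nil) nil := by
  induction l with
  | nil => exact .refl _
  | cons A l ih => exact .trans (.wrap L l (.defNil A)) ih

end Chor

variable [DecidableEq Pid] [DecidableEq Var] [DecidableEq Expr] [DecidableEq Lbl]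

open Chor

/-- The projections on `r` of the definitions `l`, with annotations `Γ`, are `lr`. -/
inductive ProjDefs (r : Pid) : List (Finset Pid) → List (Chor Pid Var Expr Lbl) →
    List (Beh Pid Var Expr Lbl) → Prop
  | nil : ProjDefs r [] [] []
  | keep {Γ l lr A B} : r ∈ pn (∅ :: Γ) A → Proj r (pn (∅ :: Γ) A :: Γ) A B → ProjDefs r Γ l lr →
      ProjDefs r (pn (∅ :: Γ) A :: Γ) (A :: l) (B :: lr)
  | drop {Γ l lr A} : r ∉ pn (∅ :: Γ) A → Proj r (pn (∅ :: Γ) A :: Γ) A .nil → ProjDefs r Γ l lr →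
      ProjDefs r (pn (∅ :: Γ) A :: Γ) (A :: l) lr

/-- The position in `lr` is the number of kept definitions further inside. The body is projected in
`Γ.drop k`, whose first entry is its own annotation, as its index `0` refers to itself. -/
theorem ProjDefs.getElem_mem {r : Pid} {Γ} {l : List (Chor Pid Var Expr Lbl)} {lr}
    (h : ProjDefs r Γ l lr) {k : ℕ} {a : Finset Pid} (hk : Γ[k]? = some a) (hr : r ∈ a) :
    ∃ A B, l[k]? = some A ∧ lr[(Γ.take k).countP (fun A' => r ∈ A')]? = some B ∧
      Proj r (Γ.drop k) A B := by
  induction h generalizing k with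
  | nil => simp at hk
  | @keep Γ l lr A B h hA _ ih =>
    cases k with
    | zero => exact ⟨A, B, by simp, by simp, hA⟩
    | succ k =>
      obtain ⟨A', B', h₁, h₂, h₃⟩ := ih (by simpa using hk)
      refine ⟨A', B', by simpa using h₁, ?_, h₃⟩
      rw [List.take_succ_cons, List.countP_cons_of_pos (by simpa using h)]
      simpa using h₂
  | @drop Γ l lr A h hA _ ih =>
    cases k with
    | zero =>
      simp only [List.getElem?_cons_zero, Option.some.injEq] at hk
      subst hk
      exact absurd hr h
    | succ k =>
      obtain ⟨A', B', h₁, h₂, h₃⟩ := ih (by simpa using hk)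
      refine ⟨A', B', by simpa using h₁, ?_, h₃⟩
      rw [List.take_succ_cons, List.countP_cons_of_neg (by simpa using h)]
      simpa using h₂

theorem ProjDefs.getElem_notMem {r : Pid} {Γ} {l : List (Chor Pid Var Expr Lbl)} {lr}
    (h : ProjDefs r Γ l lr) {k : ℕ} {a : Finset Pid} (hk : Γ[k]? = some a) (hr : r ∉ a) :
    ∃ A, l[k]? = some A ∧ Proj r (Γ.drop k) A .nil := by
  induction h generalizing k with
  | nil => simp at hk
  | @keep Γ l lr A B h hA _ ih =>
    cases k with
    | zero =>
      simp only [List.getElem?_cons_zero, Option.some.injEq] at hk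
      subst hk
      exact absurd h hr
    | succ k =>
      obtain ⟨A', h₁, h₃⟩ := ih (by simpa using hk)
      exact ⟨A', by simpa using h₁, h₃⟩
  | @drop Γ l lr A h hA _ ih =>
    cases k with
    | zero => exact ⟨A, by simp, hA⟩
    | succ k =>
      obtain ⟨A', h₁, h₃⟩ := ih (by simpa using hk)
      exact ⟨A', by simpa using h₁, h₃⟩

/-- Projection commutes with unfolding an invocation. -/
theorem Proj.unf_call {r : Pid} {Γ} {l : List (Chor Pid Var Expr Lbl)} {lr k B}
    (h : Proj r Γ (call k) B) (hl : ProjDefs r Γ l lr) :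
    Proj r Γ (Chor.unf l (call k)) (Beh.unf lr B) := by
  cases h with
  | callIn _ hk hr =>
    obtain ⟨A, B, h₁, h₂, h₃⟩ := hl.getElem_mem hk hr
    have hlen := (List.getElem?_eq_some_iff.1 hk).1
    -- The unfolding places the body below the `k` inner definitions, so its projection is shifted
    -- over their annotations.
    have := Proj.lift (Γ₁ := []) (Γ.take k) h₃
    simpa [Chor.unf, Beh.unf, h₁, h₂, hlen.le] using this
  | callOut _ hk hr =>
    obtain ⟨A, h₁, h₃⟩ := hl.getElem_notMem hk hr
    have hlen := (List.getElem?_eq_some_iff.1 hk).1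
    have := Proj.lift (Γ₁ := []) (Γ.take k) h₃
    simpa [Chor.unf, Beh.unf, h₁, hlen.le, Beh.lift] using this

theorem Beh.unf_comOpt (l) (Θ) (B : Beh Pid Var Expr Lbl) :
    Beh.unf l (Beh.comOpt Θ B) = Beh.comOpt Θ (Beh.unf l B) := by
  unfold Beh.comOpt; split <;> rfl

theorem Beh.unf_selOpt (l) (S) (B : Beh Pid Var Expr Lbl) :
    Beh.unf l (Beh.selOpt S B) = Beh.selOpt S (Beh.unf l B) := by
  unfold Beh.selOpt; split <;> rfl

variable {L : ExprLang Var Val Expr}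

/-- Projection commutes with unfolding, up to pruning. -/
theorem Proj.unf {r : Pid} {Γ} {C : Chor Pid Var Expr Lbl} {B} (h : Proj r Γ C B)
    (hC : C.Good L Γ) {l lr} (hl : ProjDefs r Γ l lr) :
    ∃ B', Proj r Γ (Chor.unf l C) B' ∧ Beh.Prune B' (Beh.unf lr B) := by
  induction h generalizing l lr with
  | nil => exact ⟨_, .nil _, .nil⟩
  | com H _ ih =>
    obtain ⟨B', h₁, h₂⟩ := ih hC.2 hl
    exact ⟨_, .com H h₁, by rw [Beh.unf_comOpt]; exact h₂.comOpt _⟩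
  | selRecv Φ φ hφ h _ ih =>
    obtain ⟨B', h₁, h₂⟩ := ih hC.2 hl
    exact ⟨_, .selRecv Φ φ hφ h h₁, .branch _ _ _ (Finset.Subset.refl _) _ _ fun _ => h₂⟩
  | selSend Φ hn _ ih =>
    obtain ⟨B', h₁, h₂⟩ := ih hC.2 hl
    exact ⟨_, .selSend Φ hn h₁, by rw [Beh.unf_selOpt]; exact h₂.selOpt _⟩
  | iteSelf e _ _ ih₁ ih₂ =>
    obtain ⟨B₁, h₁, h₁'⟩ := ih₁ hC.1 hl
    obtain ⟨B₂, h₂, h₂'⟩ := ih₂ hC.2 hl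
    exact ⟨_, .iteSelf e h₁ h₂, .ite e h₁' h₂'⟩
  | iteOther p e h _ _ hm ih₁ ih₂ =>
    obtain ⟨B₁, h₁, h₁'⟩ := ih₁ hC.1 hl
    obtain ⟨B₂, h₂, h₂'⟩ := ih₂ hC.2 hl
    -- Pruning enters twice: `X`, the merge of the unfolded behaviours, is a pruning of the unfolded
    -- merge; and `Y`, the merge of the actual projections, is a pruning of `X`.
    obtain ⟨X, hX, hX'⟩ := hm.unf (.refl lr)
    obtain ⟨Y, hY, hY'⟩ := Beh.Prune.merge hX h₁' h₂'
    exact ⟨Y, .iteOther p e h h₁ h₂ hY, hY'.trans hX'⟩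
  | recIn hr h₂ _ _ ih =>
    obtain ⟨B₁, h₁, h₁'⟩ := ih hC.2 (.keep hr h₂ hl)
    exact ⟨_, .recIn hr h₂ h₁, .recd (.refl _) h₁'⟩
  | recOut hr _ ih =>
    obtain ⟨B₁, h₁, h₁'⟩ :=
      ih hC.2 (.drop hr (.exists_nil hC.1.2.1 (by rwa [pn_fix])) hl)
    exact ⟨_, .recOut hr h₁, h₁'⟩
  | callIn k hk hr => exact ⟨_, (Proj.callIn k hk hr).unf_call hl, .refl _⟩
  | callOut k hk hr => exact ⟨_, (Proj.callOut k hk hr).unf_call hl, .refl _⟩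

theorem Proj.unf_iterate (n : ℕ) {r : Pid} {C : Chor Pid Var Expr Lbl} {B} (h : Proj r [] C B)
    (hC : C.Good L []) :
    ∃ B', Proj r [] ((Chor.unf [])^[n] C) B' ∧ Beh.Prune B' ((Beh.unf [])^[n] B) := by
  induction n generalizing C B with
  | zero => exact ⟨B, h, .refl _⟩
  | succ n ih =>
    obtain ⟨B₁, h₁, h₁'⟩ := h.unf hC .nil
    obtain ⟨B₂, h₂, h₂'⟩ := ih h₁ (hC.pre (.unf L C))
    refine ⟨B₂, h₂, h₂'.trans ?_⟩
    have key : ∀ (m : ℕ) {A A' : Beh Pid Var Expr Lbl}, Beh.Prune A A' →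
        Beh.Prune ((Beh.unf [])^[m] A) ((Beh.unf [])^[m] A') := by
      intro m
      induction m with
      | zero => exact fun h => h
      | succ m ih => exact fun h => ih (h.unf .nil)
    exact key n h₁'

theorem Chor.Pre.unf_iterate (n : ℕ) (C : Chor Pid Var Expr Lbl) :
    Chor.Pre L C ((Chor.unf [])^[n] C) := by
  induction n generalizing C with
  | zero => exact .refl _
  | succ n ih => exact .trans (.unf L C) (ih _)

/-- For an invocation that is only enclosed by definitions, projection commutes with unfolding. -/
theorem Proj.unf_wrap_call {r : Pid} {l : List (Chor Pid Var Expr Lbl)} {k B}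
    (h : Proj r [] (wrap l (call k)) B) (hC : (wrap l (call k)).Good L []) :
    Proj r [] (wrap l (Chor.unf l (call k))) (Beh.unf [] B) := by
  have key : ∀ (l' : List (Chor Pid Var Expr Lbl)) (C : Chor Pid Var Expr Lbl),
      (∀ Γ B lr, Proj r Γ C B → C.Good L Γ → ProjDefs r Γ l' lr →
        Proj r Γ (Chor.unf l' C) (Beh.unf lr B)) →
      ∀ B, Proj r [] (wrap l' C) B → (wrap l' C).Good L [] →
        Proj r [] (wrap l' (Chor.unf l' C)) (Beh.unf [] B) := by
    intro l'
    induction l' with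
    | nil => exact fun C h B hB hC => h [] B [] hB hC .nil
    | cons A l' ih =>
      intro C h B hB hC
      refine ih (recd A C) (fun Γ B lr hB hC hl => ?_) B hB hC
      cases hB with
      | recIn hr h₂ h₁ => exact .recIn hr h₂ (h _ _ _ h₁ hC.2 (.keep hr h₂ hl))
      | recOut hr h₁ =>
        exact .recOut hr
          (h _ _ _ h₁ hC.2 (.drop hr (.exists_nil hC.1.2.1 (by rwa [pn_fix])) hl))
  exact key l (call k) (fun Γ B lr hB _ hl => hB.unf_call hl) B h hC

end Unfolding

/-! ### The sequential machine and its invariance under the concurrent semantics -/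

section Machine

variable {Pid Var Val Expr Lbl : Type*} (L : ExprLang Var Val Expr)

open Classical in
/-- The effect of a multicom on the state. -/
noncomputable def upd (H : Finset (Com Pid Var Expr)) (σ : State Pid Var Val) : State Pid Var Val :=
  fun q y => if h : ∃ η ∈ H, η.tgt = q ∧ η.var = y then L.eval h.choose.expr (σ h.choose.src)
    else σ q y

variable {L}

theorem upd_of_notMem {H : Finset (Com Pid Var Expr)} {σ : State Pid Var Val} {q y}
    (h : ∀ η ∈ H, η.tgt = q → η.var ≠ y) : upd L H σ q y = σ q y := by
  rw [upd, dif_neg]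
  rintro ⟨η, hη, hq, hy⟩
  exact h η hη hq hy

theorem upd_of_mem {H : Finset (Com Pid Var Expr)} (hH : WFCom L H) {σ : State Pid Var Val}
    {η : Com Pid Var Expr} (hη : η ∈ H) : upd L H σ η.tgt η.var = L.eval η.expr (σ η.src) := by
  have h : ∃ η' ∈ H, η'.tgt = η.tgt ∧ η'.var = η.var := ⟨η, hη, rfl, rfl⟩
  rw [upd, dif_pos h]
  have : h.choose = η := by
    by_contra hne
    exact (hH.2.1 _ h.choose_spec.1 _ hη hne h.choose_spec.2.1).1 h.choose_spec.2.2
  rw [this]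

theorem upd_empty (σ : State Pid Var Val) : upd L (∅ : Finset (Com Pid Var Expr)) σ = σ := by
  funext q y
  exact upd_of_notMem (by simp)

theorem eval_upd {H : Finset (Com Pid Var Expr)} {σ : State Pid Var Val} {p e}
    (h : ∀ η ∈ H, η.tgt = p → η.var ∉ L.vars e) : L.eval e (upd L H σ p) = L.eval e (σ p) :=
  L.eval_congr _ _ _ fun _ hx => upd_of_notMem fun η hη ht hv => h η hη ht (hv ▸ hx)

section

variable [DecidableEq Pid] [DecidableEq Var]

theorem State.set_apply (σ : State Pid Var Val) (q : Pid) (y : Var) (v : Val) (q' y') :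
    σ.set q y v q' y' = if q' = q ∧ y' = y then v else σ q' y' := by
  unfold State.set
  by_cases hq : q' = q
  · subst hq
    by_cases hy : y' = y
    · subst hy; simp
    · simp [hy]
  · simp [hq]

/-- Performing one communication of a group first is harmless: by condition (b) no expression
evaluated at its target mentions the variable it writes, and by (a) no other communication writes
that variable. -/
theorem upd_cons {H : Finset (Com Pid Var Expr)} {η} (hη : η ∉ H) (hH : WFCom L (H.cons η hη))
    (σ : State Pid Var Val) : upd L (H.cons η hη) σ =
      upd L H (σ.set η.tgt η.var (L.eval η.expr (σ η.src))) := by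
  funext q y
  by_cases hex : ∃ η' ∈ H, η'.tgt = q ∧ η'.var = y
  · obtain ⟨η', hη', rfl, rfl⟩ := hex
    have hw : WFCom L H := hH.mono (Finset.subset_cons hη)
    rw [upd_of_mem hH (Finset.mem_cons_of_mem hη'), upd_of_mem hw hη']
    refine L.eval_congr _ _ _ fun x hx => ?_
    rw [State.set_apply, if_neg]
    rintro ⟨h₁, rfl⟩
    exact hH.2.2 η (Finset.mem_cons_self η H) η' (Finset.mem_cons_of_mem hη') h₁.symm hx
  · push Not at hex
    rw [upd_of_notMem hex, State.set_apply]
    split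
    · rename_i h
      rw [h.1, h.2, upd_of_mem hH (Finset.mem_cons_self η H)]
    · rename_i h
      refine upd_of_notMem fun η' hη' ht hv => ?_
      rcases Finset.mem_cons.1 hη' with rfl | hη'
      · exact h ⟨ht.symm, hv.symm⟩
      · exact hex η' hη' ht hv

theorem upd_singleton (η : Com Pid Var Expr) (σ : State Pid Var Val) :
    upd L {η} σ = σ.set η.tgt η.var (L.eval η.expr (σ η.src)) := by
  funext q y
  rw [State.set_apply]
  split
  · rename_i h
    have h' : ∃ η' ∈ ({η} : Finset (Com Pid Var Expr)), η'.tgt = q ∧ η'.var = y :=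
      ⟨η, by simp, h.1.symm, h.2.symm⟩
    rw [upd, dif_pos h']
    have := Finset.mem_singleton.1 h'.choose_spec.1
    rw [this]
  · rename_i h
    refine upd_of_notMem fun η' hη' ht hv => ?_
    rw [Finset.mem_singleton] at hη'
    subst hη'
    exact h ⟨ht.symm, hv.symm⟩

theorem upd_disjUnion {H₁ H₂ : Finset (Com Pid Var Expr)} (hd : Disjoint H₁ H₂)
    (hH : WFCom L (H₁.disjUnion H₂ hd)) (σ : State Pid Var Val) :
    upd L (H₁.disjUnion H₂ hd) σ = upd L H₂ (upd L H₁ σ) := by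
  induction H₁ using Finset.cons_induction generalizing σ with
  | empty => simp [upd_empty]
  | cons η H₁ hη ih =>
    have hd' : Disjoint H₁ H₂ := Finset.disjoint_of_subset_left (Finset.subset_cons hη) hd
    have hη' : η ∉ H₁.disjUnion H₂ hd' := by
      simp only [Finset.mem_disjUnion, not_or]
      exact ⟨hη, Finset.disjoint_left.1 hd (Finset.mem_cons_self η H₁)⟩
    have e : (H₁.cons η hη).disjUnion H₂ hd = (H₁.disjUnion H₂ hd').cons η hη' := by
      ext x; simp [or_assoc]
    have hw : WFCom L (H₁.cons η hη) := hH.mono fun x hx => by simp [Finset.mem_cons.1 hx]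
    rw [e] at hH ⊢
    rw [upd_cons hη' hH, ih hd' (hH.mono (Finset.subset_cons hη')), upd_cons hη hw]

end

variable (L)

/-- Configurations of the sequential machine: the enclosing definitions, the choreography under
execution, the state, and the number of actions performed. -/
abbrev Cfg (Pid Var Val Expr Lbl : Type*) :=
  List (Chor Pid Var Expr Lbl) × Chor Pid Var Expr Lbl × State Pid Var Val × ℕ

open Classical in
/-- Sequential execution of choreographies. -/
noncomputable def mstep : Cfg Pid Var Val Expr Lbl → Cfg Pid Var Val Expr Lbl
  | (l, .com H C, σ, n) => (l, C, upd L H σ, n + H.card)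
  | (l, .sel Φ C, σ, n) => (l, C, σ, n + Φ.card)
  | (l, .ite p e C₁ C₂, σ, n) => (l, if L.eval e (σ p) = L.tt then C₁ else C₂, σ, n + 1)
  | (l, .recd A C, σ, n) => (A :: l, C, σ, n)
  | (l, .call k, σ, n) => (l, Chor.unf l (.call k), σ, n)
  | (_, .nil, σ, n) => ([], .nil, σ, n)

/-- Two configurations have a common successor in the sequential execution. -/
def Join (c c' : Cfg Pid Var Val Expr Lbl) : Prop := ∃ n m, (mstep L)^[n] c = (mstep L)^[m] c'

variable {L}

theorem Join.refl (c : Cfg Pid Var Val Expr Lbl) : Join L c c := ⟨0, 0, rfl⟩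

theorem Join.symm {c c' : Cfg Pid Var Val Expr Lbl} (h : Join L c c') : Join L c' c := by
  obtain ⟨n, m, h⟩ := h
  exact ⟨m, n, h.symm⟩

/-- The machine is deterministic, so the two runs out of `c₂` are prefixes of a single run. -/
theorem Join.trans {c₁ c₂ c₃ : Cfg Pid Var Val Expr Lbl} (h : Join L c₁ c₂) (h' : Join L c₂ c₃) :
    Join L c₁ c₃ := by
  obtain ⟨n, m, h⟩ := h
  obtain ⟨k, j, h'⟩ := h'
  refine ⟨k + n, m + j, ?_⟩
  rw [Function.iterate_add_apply, h, ← Function.iterate_add_apply, Nat.add_comm,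
    Function.iterate_add_apply, h', ← Function.iterate_add_apply]

theorem Join.of_left {c c' d : Cfg Pid Var Val Expr Lbl} (h : mstep L c = d) (h' : Join L d c') :
    Join L c c' := by
  obtain ⟨n, m, h'⟩ := h'
  exact ⟨n + 1, m, by rw [Function.iterate_succ_apply, h, h']⟩

theorem Join.of_right {c c' d : Cfg Pid Var Val Expr Lbl} (h : mstep L c' = d) (h' : Join L c d) :
    Join L c c' := (Join.of_left h h'.symm).symm

open Chor

/-- The machine unfolds an invocation when it arrives there; unfolding in advance just saves that
one transition. -/
theorem Join.of_repl {D C C' : Chor Pid Var Expr Lbl} {k} (h : Repl D k C C') {l}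
    (hl : l[k]? = some D) (σ : State Pid Var Val) (n : ℕ) : Join L (l, C, σ, n) (l, C', σ, n) := by
  induction h generalizing l σ n with
  | here k => exact .of_left rfl (by simpa [mstep, Chor.unf, hl] using Join.refl _)
  | com H _ ih => exact .of_left rfl (.of_right rfl (ih hl _ _))
  | sel Φ _ ih => exact .of_left rfl (.of_right rfl (ih hl _ _))
  | iteL p e C₂ _ ih =>
    refine .of_left rfl (.of_right rfl ?_)
    simp only [mstep]
    split
    · exact ih hl _ _
    · exact .refl _
  | iteR p e C₂ _ ih =>
    refine .of_left rfl (.of_right rfl ?_)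
    simp only [mstep]
    split
    · exact .refl _
    · exact ih hl _ _
  | recd C₂ _ ih => exact .of_left rfl (.of_right rfl (ih (by simpa using hl) _ _))

variable [DecidableEq Pid] [DecidableEq Var]

/-- The two sides perform the same actions with the same effect on the state. The side conditions
enter through `upd_disjUnion`, when a group of communications is split, and `eval_upd`, when
communications pass a condition; the counts agree because cardinalities add up. -/
theorem Join.of_swap {C C' : Chor Pid Var Expr Lbl} (h : Swap L C C') (l)
    (σ : State Pid Var Val) (n : ℕ) : Join L (l, C, σ, n) (l, C', σ, n) := by
  cases h with
  | comCom H₁ H₂ hd C hw =>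
    refine .of_left rfl (.of_right rfl (.of_right rfl ?_))
    simp only [mstep]
    rw [upd_disjUnion hd hw, Finset.card_disjUnion, Nat.add_assoc]
    exact .refl _
  | selSel Φ₁ Φ₂ hd C hw =>
    refine .of_left rfl (.of_right rfl (.of_right rfl ?_))
    simp only [mstep]
    rw [Finset.card_disjUnion, Nat.add_assoc]
    exact .refl _
  | comSel H Φ C h =>
    refine .of_left rfl (.of_left rfl (.of_right rfl (.of_right rfl ?_)))
    simp only [mstep]
    rw [Nat.add_right_comm]
    exact .refl _
  | comIte H p e C₁ C₂ h =>
    refine .of_left rfl (.of_right rfl (.of_right rfl ?_))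
    simp only [mstep]
    rw [eval_upd h, Nat.add_right_comm]
    split <;> exact .of_left rfl (.refl _)
  | selIte Φ p e C₁ C₂ h =>
    refine .of_left rfl (.of_right rfl (.of_right rfl ?_))
    simp only [mstep]
    rw [Nat.add_right_comm]
    split <;> exact .of_left rfl (.refl _)
  | comRec => exact .of_left rfl (.of_left rfl (.of_right rfl (.of_right rfl (.refl _))))
  | selRec => exact .of_left rfl (.of_left rfl (.of_right rfl (.of_right rfl (.refl _))))
  | iteRec =>
    refine .of_left rfl (.of_left rfl (.of_right rfl ?_))
    simp only [mstep]
    split <;> exact .of_right rfl (.refl _)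
  | iteIte p q e₁ e₂ =>
    refine .of_left rfl (.of_right rfl ?_)
    simp only [mstep]
    by_cases h₁ : L.eval e₁ (σ p) = L.tt <;> by_cases h₂ : L.eval e₂ (σ q) = L.tt <;>
      simp only [h₁, h₂, if_true, if_false] <;>
      exact .of_left rfl (.of_right rfl (by simp only [mstep, h₁, h₂]; exact .refl _))

/-- The structural precongruence does not change the sequential execution. -/
theorem Join.of_pre {C C' : Chor Pid Var Expr Lbl} (h : Pre L C C') (l)
    (σ : State Pid Var Val) (n : ℕ) : Join L (l, C, σ, n) (l, C', σ, n) := by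
  induction h generalizing l σ n with
  | refl => exact .refl _
  | trans _ _ ih₁ ih₂ => exact (ih₁ l σ n).trans (ih₂ l σ n)
  | com H _ ih => exact .of_left rfl (.of_right rfl (ih _ _ _))
  | sel Φ _ ih => exact .of_left rfl (.of_right rfl (ih _ _ _))
  | ite p e _ _ ih₁ ih₂ =>
    refine .of_left rfl (.of_right rfl ?_)
    simp only [mstep]
    split
    · exact ih₁ _ _ _
    · exact ih₂ _ _ _
  | recd C₂ _ ih => exact .of_left rfl (.of_right rfl (ih _ _ _))
  | unfold h => exact .of_left rfl (.of_right rfl (.of_repl h rfl _ _))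
  -- At `nil` the machine discards all enclosing definitions, so the extra one leaves no trace.
  | defNil => exact .of_left rfl (.of_left rfl (.of_right rfl (.refl _)))
  | comEmpty => exact .of_left rfl (by simp only [mstep]; rw [upd_empty]; exact .refl _)
  | selEmpty => exact .of_left rfl (.refl _)
  | swap h => exact .of_swap h l σ n
  | swapSymm h => exact (Join.of_swap h l σ n).symm

/-- A step of the concurrent semantics is an action of the sequential execution. -/
theorem Join.of_step {x y : Chor Pid Var Expr Lbl × State Pid Var Val} (h : Step L x y) (l) (n : ℕ) :
    Join L (l, x.1, x.2, n) (l, y.1, y.2, n + 1) := by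
  induction h generalizing l n with
  | com η C σ => exact .of_left rfl (by simp only [mstep]; rw [upd_singleton]; exact .refl _)
  | sel φ C σ => exact .of_left rfl (.refl _)
  | iteTrue p e C₁ C₂ σ h => exact .of_left rfl (by simp only [mstep]; rw [if_pos h]; exact .refl _)
  | iteFalse p e C₁ C₂ σ h => exact .of_left rfl (by simp only [mstep]; rw [if_neg h]; exact .refl _)
  | str h _ h' ih => exact ((Join.of_pre h l _ n).trans (ih l n)).trans (.of_pre h' l _ _)
  | ctx C₂ _ ih => exact .of_left rfl (.of_right rfl (ih _ _))

end Machine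

/-- Labels of actions: a communication, a selection, or a conditional with its outcome. -/
inductive Lab (Pid Var Expr Lbl : Type*) where
  | com (η : Com Pid Var Expr)
  | sel (φ : Sel Pid Lbl)
  | cond (p : Pid) (e : Expr) (b : Bool)

/-! ### Actions that do not depend on what precedes them -/

section Labels

variable {Pid Var Val Expr Lbl : Type*}

/-- The process `r` takes part in the action. -/
def Lab.Inv : Lab Pid Var Expr Lbl → Pid → Prop
  | com η, r => η.src = r ∨ η.tgt = r
  | sel φ, r => φ.src = r ∨ φ.tgt = r
  | cond p _ _, r => p = r

/-- There are no self-communications and no self-selections. -/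
def Lab.Proper : Lab Pid Var Expr Lbl → Prop
  | com η => η.src ≠ η.tgt
  | sel φ => φ.src ≠ φ.tgt
  | cond _ _ _ => True

/-- The action is possible in the first state and leads to the second one. -/
def Lab.Fires [DecidableEq Pid] [DecidableEq Var] (L : ExprLang Var Val Expr) :
    Lab Pid Var Expr Lbl → State Pid Var Val → State Pid Var Val → Prop
  | com η, σ, σ' => σ' = σ.set η.tgt η.var (L.eval η.expr (σ η.src))
  | sel _, σ, σ' => σ' = σ
  | cond p e b, σ, σ' => (L.eval e (σ p) = L.tt ↔ b = true) ∧ σ' = σ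

/-- The local actions of a label. -/
inductive Loc : Lab Pid Var Expr Lbl → Pid → BAct Pid Var Expr Lbl → Prop
  | send (η : Com Pid Var Expr) : Loc (.com η) η.src (.act (.send η.tgt η.expr))
  | recv (η : Com Pid Var Expr) : Loc (.com η) η.tgt (.act (.recv η.src η.var))
  | sel (φ : Sel Pid Lbl) : Loc (.sel φ) φ.src (.sel φ.tgt φ.lbl)
  | br (φ : Sel Pid Lbl) : Loc (.sel φ) φ.tgt (.br φ.src φ.lbl)
  | cond (p : Pid) (e : Expr) (b : Bool) : Loc (.cond p e b) p (.cond e b)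

theorem Loc.inv {lab : Lab Pid Var Expr Lbl} {r a} (h : Loc lab r a) : lab.Inv r := by
  cases h with
  | send | sel => exact .inl rfl
  | recv | br => exact .inr rfl
  | cond => exact rfl

theorem Lab.Inv.exists_loc {lab : Lab Pid Var Expr Lbl} {r} (h : lab.Inv r) : ∃ a, Loc lab r a := by
  cases lab with
  | com η => rcases h with rfl | rfl; exacts [⟨_, .send η⟩, ⟨_, .recv η⟩]
  | sel φ => rcases h with rfl | rfl; exacts [⟨_, .sel φ⟩, ⟨_, .br φ⟩]
  | cond p e b => cases h; exact ⟨_, .cond _ e b⟩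

/-- In a self-communication or self-selection one process would play both roles. -/
theorem Loc.functional {lab : Lab Pid Var Expr Lbl} (hl : lab.Proper) {r a a'} (h : Loc lab r a)
    (h' : Loc lab r a') : a = a' := by
  generalize hr : r = r' at h'
  cases h <;> cases h' <;> first | rfl | exact absurd hr hl | exact absurd hr.symm hl

theorem Lab.exists_inv (lab : Lab Pid Var Expr Lbl) : ∃ r, lab.Inv r := by
  cases lab with
  | com η => exact ⟨_, .inl rfl⟩
  | sel φ => exact ⟨_, .inl rfl⟩
  | cond p e b => exact ⟨p, rfl⟩

open Chor

/-- `Ext lab C C'`: the action `lab` of `C` does not depend on preceding ones, and `C'` is what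
remains after performing it. -/
inductive Ext : Lab Pid Var Expr Lbl → Chor Pid Var Expr Lbl → Chor Pid Var Expr Lbl → Prop
  | hereCom (η : Com Pid Var Expr) (H) (h : η ∉ H) (C) :
      Ext (.com η) (com (H.cons η h) C) (com H C)
  | hereSel (φ : Sel Pid Lbl) (Φ) (h : φ ∉ Φ) (C) : Ext (.sel φ) (sel (Φ.cons φ h) C) (sel Φ C)
  | hereTrue (p e C₁ C₂) : Ext (.cond p e true) (ite p e C₁ C₂) C₁
  | hereFalse (p e C₁ C₂) : Ext (.cond p e false) (ite p e C₁ C₂) C₂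
  | com {lab C C'} (H : Finset (Com Pid Var Expr)) :
      (∀ η ∈ H, ¬ lab.Inv η.src ∧ ¬ lab.Inv η.tgt) → Ext lab C C' → Ext lab (com H C) (com H C')
  | sel {lab C C'} (Φ : Finset (Sel Pid Lbl)) :
      (∀ φ ∈ Φ, ¬ lab.Inv φ.src ∧ ¬ lab.Inv φ.tgt) → Ext lab C C' → Ext lab (sel Φ C) (sel Φ C')
  | ite {lab C₁ C₁' C₂ C₂'} (p e) : ¬ lab.Inv p → Ext lab C₁ C₁' → Ext lab C₂ C₂' →
      Ext lab (ite p e C₁ C₂) (ite p e C₁' C₂')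
  | recd {lab C C'} (A) : Ext lab C C' → Ext lab (recd A C) (recd A C')

theorem Ext.wrap {lab : Lab Pid Var Expr Lbl} {C C'} (h : Ext lab C C') (l) :
    Ext lab (wrap l C) (wrap l C') := by
  induction l generalizing C C' with
  | nil => exact h
  | cons A l ih => exact ih (.recd A h)

variable {L : ExprLang Var Val Expr}

/-- By definition of `Ext`, everything in front of the communication is free of its participants,
and so satisfies the side conditions for moving it outwards. A group is passed by joining `{η}` to
it and splitting the union in the other order. -/
theorem Ext.pre_com {η : Com Pid Var Expr} (hη : η.src ≠ η.tgt) {C C' : Chor Pid Var Expr Lbl}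
    (h : Ext (.com η) C C') (hC : C.WF L) : Pre L C (.com {η} C') := by
  generalize hl : Lab.com η = lab at h
  induction h with
  | hereCom η' H h C =>
    cases hl
    have := Swap.comCom (L := L) {η} H (by simpa using h) C
    rw [Finset.singleton_disjUnion] at this
    exact .swap (this hC.1)
  | hereSel | hereTrue | hereFalse => cases hl
  | com H hH _ ih =>
    subst hl
    refine .trans (.com H (ih hC.2 rfl)) ?_
    have hd : Disjoint {η} H := by
      rw [Finset.disjoint_singleton_left]
      exact fun h => (hH η h).1 (.inl rfl)
    -- The mixed cases of well-formedness are vacuous, since `η` shares no process with `H`.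
    have hw : WFCom L (Finset.disjUnion {η} H hd) := by
      simp only [Lab.Inv] at hH
      refine ⟨fun η' h => ?_, fun η₁ h₁ η₂ h₂ hne ht => ?_, fun η₁ h₁ η₂ h₂ ht => ?_⟩
      · rcases Finset.mem_disjUnion.1 h with h | h
        · rw [Finset.mem_singleton] at h; subst h; exact hη
        · exact hC.1.1 _ h
      · simp only [Finset.mem_disjUnion, Finset.mem_singleton] at h₁ h₂
        rcases h₁ with rfl | h₁ <;> rcases h₂ with rfl | h₂
        · exact absurd rfl hne
        · exact absurd (.inr ht) (hH _ h₂).2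
        · exact absurd (.inr ht.symm) (hH _ h₁).2
        · exact hC.1.2.1 _ h₁ _ h₂ hne ht
      · simp only [Finset.mem_disjUnion, Finset.mem_singleton] at h₁ h₂
        rcases h₁ with rfl | h₁ <;> rcases h₂ with rfl | h₂
        · exact absurd ht.symm hη
        · exact absurd (.inr ht) (hH _ h₂).1
        · exact absurd (.inl ht.symm) (hH _ h₁).2
        · exact hC.1.2.2 _ h₁ _ h₂ ht
    refine .trans ?_ (.swap (.comCom {η} H hd _ hw))
    rw [Finset.disjUnion_comm] at hw ⊢
    exact .swapSymm (.comCom H {η} hd.symm _ hw)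
  | sel Φ hΦ _ ih =>
    subst hl
    refine .trans (.sel Φ (ih hC.2 rfl)) (.swapSymm (.comSel {η} Φ _ fun φ hφ η' hη' => ?_))
    rw [Finset.mem_singleton] at hη'
    subst hη'
    exact ⟨fun h => (hΦ φ hφ).2 (.inl h.symm), fun h => (hΦ φ hφ).2 (.inr h.symm)⟩
  | ite p e hp _ _ ih₁ ih₂ =>
    subst hl
    refine .trans (.ite p e (ih₁ hC.1 rfl) (ih₂ hC.2 rfl)) (.swap (.comIte {η} p e _ _ ?_))
    intro η' hη' h
    rw [Finset.mem_singleton] at hη'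
    subst hη'
    exact absurd (.inr h) hp
  | recd A _ ih => exact .trans (.recd A (ih hC.2 hl)) (.swap (.comRec _ _ _))

theorem Ext.pre_sel {φ : Sel Pid Lbl} (hφ : φ.src ≠ φ.tgt) {C C' : Chor Pid Var Expr Lbl}
    (h : Ext (.sel φ) C C') (hC : C.WF L) : Pre L C (.sel {φ} C') := by
  generalize hl : Lab.sel φ = lab at h
  induction h with
  | hereSel φ' Φ h C =>
    cases hl
    have := Swap.selSel (L := L) {φ} Φ (by simpa using h) C
    rw [Finset.singleton_disjUnion] at this
    exact .swap (this hC.1)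
  | hereCom | hereTrue | hereFalse => cases hl
  | sel Φ hΦ _ ih =>
    subst hl
    refine .trans (.sel Φ (ih hC.2 rfl)) ?_
    have hd : Disjoint {φ} Φ := by
      rw [Finset.disjoint_singleton_left]
      exact fun h => (hΦ φ h).1 (.inl rfl)
    have hw : WFSel (Finset.disjUnion {φ} Φ hd) := by
      simp only [Lab.Inv] at hΦ
      refine ⟨fun φ' h => ?_, fun φ₁ h₁ φ₂ h₂ hne => ?_⟩
      · rcases Finset.mem_disjUnion.1 h with h | h
        · rw [Finset.mem_singleton] at h; subst h; exact hφ
        · exact hC.1.1 _ h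
      · simp only [Finset.mem_disjUnion, Finset.mem_singleton] at h₁ h₂
        rcases h₁ with rfl | h₁ <;> rcases h₂ with rfl | h₂
        · exact absurd rfl hne
        · exact ⟨fun ht => (hΦ _ h₂).1 (.inr ht), fun ht => (hΦ _ h₂).2 (.inr ht)⟩
        · exact ⟨fun ht => (hΦ _ h₁).2 (.inl ht.symm), fun ht => (hΦ _ h₁).2 (.inr ht.symm)⟩
        · exact hC.1.2 _ h₁ _ h₂ hne
    refine .trans ?_ (.swap (.selSel {φ} Φ hd _ hw))
    rw [Finset.disjUnion_comm] at hw ⊢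
    exact .swapSymm (.selSel Φ {φ} hd.symm _ hw)
  | com H hH _ ih =>
    subst hl
    refine .trans (.com H (ih hC.2 rfl)) (.swap (.comSel H {φ} _ fun φ' hφ' η hη => ?_))
    rw [Finset.mem_singleton] at hφ'
    subst hφ'
    exact ⟨fun h => (hH η hη).1 (.inr h), fun h => (hH η hη).2 (.inr h)⟩
  | ite p e hp _ _ ih₁ ih₂ =>
    subst hl
    refine .trans (.ite p e (ih₁ hC.1 rfl) (ih₂ hC.2 rfl)) (.swap (.selIte {φ} p e _ _ ?_))
    intro φ' hφ' h
    rw [Finset.mem_singleton] at hφ'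
    subst hφ'
    exact hp (.inr h)
  | recd A _ ih => exact .trans (.recd A (ih hC.2 hl)) (.swap (.selRec _ _ _))

/-- The label records one outcome, but moving a conditional outwards carries both of its branches;
`D` is this pair of branches, indexed by the outcome. -/
theorem Ext.pre_cond {p : Pid} {e : Expr} {b : Bool} {C C' : Chor Pid Var Expr Lbl}
    (h : Ext (.cond p e b) C C') :
    ∃ D : Bool → Chor Pid Var Expr Lbl, D b = C' ∧ Pre L C (.ite p e (D true) (D false)) := by
  generalize hl : Lab.cond p e b = lab at h
  induction h with
  | hereTrue p' e' C₁ C₂ => cases hl; exact ⟨fun b => if b then C₁ else C₂, rfl, .refl _⟩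
  | hereFalse p' e' C₁ C₂ => cases hl; exact ⟨fun b => if b then C₁ else C₂, rfl, .refl _⟩
  | hereSel | hereCom => cases hl
  | com H hH _ ih =>
    obtain ⟨D, hD, h⟩ := ih hl
    subst hl
    exact ⟨fun b => .com H (D b), by simp only [hD], .trans (.com H h) (.swapSymm
      (.comIte H p e _ _ fun η hη ht => absurd ht.symm (hH η hη).2))⟩
  | sel Φ hΦ _ ih =>
    obtain ⟨D, hD, h⟩ := ih hl
    subst hl
    exact ⟨fun b => .sel Φ (D b), by simp only [hD], .trans (.sel Φ h) (.swapSymm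
      (.selIte Φ p e _ _ fun φ hφ ht => absurd ht.symm (hΦ φ hφ).2))⟩
  | ite q e' _ _ _ ih₁ ih₂ =>
    obtain ⟨D₁, hD₁, h₁⟩ := ih₁ hl
    obtain ⟨D₂, hD₂, h₂⟩ := ih₂ hl
    exact ⟨fun b => .ite q e' (D₁ b) (D₂ b), by simp only [hD₁, hD₂],
      .trans (.ite q e' h₁ h₂) (.swap (.iteIte _ _ _ _ _ _ _ _))⟩
  | recd A _ ih =>
    obtain ⟨D, hD, h⟩ := ih hl
    exact ⟨fun b => .recd A (D b), by simp only [hD], .trans (.recd A h) (.swap (.iteRec _ _ _ _ _))⟩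

variable [DecidableEq Pid] [DecidableEq Var]

theorem Ext.step {lab : Lab Pid Var Expr Lbl} {C C'} (h : Ext lab C C') (hl : lab.Proper)
    (hC : C.WF L) {σ σ'} (hf : lab.Fires L σ σ') : Step L (C, σ) (C', σ') := by
  cases lab with
  | com η =>
    cases hf
    exact .str (h.pre_com hl hC) (.com η C' σ) (.refl _)
  | sel φ =>
    cases hf
    exact .str (h.pre_sel hl hC) (.sel φ C' σ) (.refl _)
  | cond p e b =>
    obtain ⟨hb, rfl⟩ := hf
    obtain ⟨D, rfl, h'⟩ := h.pre_cond (L := L)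
    cases b with
    | true => exact .str h' (.iteTrue p e _ _ _ (hb.2 rfl)) (.refl _)
    | false => exact .str h' (.iteFalse p e _ _ _ fun h => by simpa using hb.1 h) (.refl _)

end Labels

/-! ### Extracting an action from a choreography, and the effect on projections -/

section Extraction

variable {Pid Var Val Expr Lbl : Type*} [DecidableEq Pid] [DecidableEq Var] [DecidableEq Expr]
  [DecidableEq Lbl] {L : ExprLang Var Val Expr}

open Chor

theorem send_mem_actsOf {r q : Pid} {e : Expr} {H : Finset (Com Pid Var Expr)} :
    Act.send q e ∈ actsOf r H ↔ ∃ η ∈ H, η.src = r ∧ η.tgt = q ∧ η.expr = e := by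
  simp [actsOf, and_assoc]

theorem recv_mem_actsOf {r p : Pid} {x : Var} {H : Finset (Com Pid Var Expr)} :
    Act.recv p x ∈ actsOf r H ↔ ∃ η ∈ H, η.tgt = r ∧ η.src = p ∧ η.var = x := by
  simp [actsOf, and_assoc]

theorem mem_selsOf {r q : Pid} {l : Lbl} {Φ : Finset (Sel Pid Lbl)} :
    (q, l) ∈ selsOf r Φ ↔ ∃ φ ∈ Φ, φ.src = r ∧ φ.tgt = q ∧ φ.lbl = l := by
  simp [selsOf, and_assoc]

theorem mem_actsOf_iff {r : Pid} {H : Finset (Com Pid Var Expr)} {a} :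
    a ∈ actsOf r H ↔ ∃ η ∈ H, (η.src = r ∧ a = .send η.tgt η.expr) ∨
      (η.tgt = r ∧ a = .recv η.src η.var) := by
  cases a with
  | send q e => rw [send_mem_actsOf]; grind
  | recv p x => rw [recv_mem_actsOf]; grind

theorem Beh.can_comOpt {a : BAct Pid Var Expr Lbl} {Θ} {B} (h : Beh.Can a (Beh.comOpt Θ B)) :
    (Θ = ∅ ∧ Beh.Can a B) ∨ ∃ a' ∈ Θ, a = .act a' := by
  unfold Beh.comOpt at h
  split at h
  · exact .inl ⟨‹_›, h⟩
  · cases h with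
    | com _ h => exact .inr ⟨_, h, rfl⟩
    | comEmpty => contradiction

theorem Beh.can_selOpt {a : BAct Pid Var Expr Lbl} {S} {B} (h : Beh.Can a (Beh.selOpt S B)) :
    (S = ∅ ∧ Beh.Can a B) ∨ ∃ q l, (q, l) ∈ S ∧ a = .sel q l := by
  unfold Beh.selOpt at h
  split at h
  · exact .inl ⟨‹_›, h⟩
  · cases h with
    | sel _ h => exact .inr ⟨_, _, h, rfl⟩
    | selEmpty => contradiction

/-- The send shows both processes and the expression, the receive both processes and the variable.
By condition (a) a group has at most one communication from one given process to another, so the two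
halves belong together. If one participant occurs in `H`, then so does its partner. -/
theorem mem_of_actsOf {H : Finset (Com Pid Var Expr)} (hH : WFCom L H) {η : Com Pid Var Expr}
    (h₁ : (actsOf η.src H).Nonempty → .send η.tgt η.expr ∈ actsOf η.src H)
    (h₂ : (actsOf η.tgt H).Nonempty → .recv η.src η.var ∈ actsOf η.tgt H)
    (h : (actsOf η.src H).Nonempty ∨ (actsOf η.tgt H).Nonempty) : η ∈ H := by
  have hs : (actsOf η.src H).Nonempty := by
    rcases h with h | h
    · exact h
    · obtain ⟨η', h', _, hs, _⟩ := recv_mem_actsOf.1 (h₂ h)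
      exact ⟨.send η'.tgt η'.expr, send_mem_actsOf.2 ⟨η', h', hs, rfl, rfl⟩⟩
  obtain ⟨η₁, hm₁, hs₁, ht₁, he₁⟩ := send_mem_actsOf.1 (h₁ hs)
  have ht : (actsOf η.tgt H).Nonempty :=
    ⟨.recv η₁.src η₁.var, recv_mem_actsOf.2 ⟨η₁, hm₁, ht₁, rfl, rfl⟩⟩
  obtain ⟨η₂, hm₂, ht₂, hs₂, hx₂⟩ := recv_mem_actsOf.1 (h₂ ht)
  have : η₁ = η₂ := by
    by_contra hne
    exact (hH.2.1 η₁ hm₁ η₂ hm₂ hne (ht₁.trans ht₂.symm)).2 (hs₁.trans hs₂.symm)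
  subst this
  have : η₁ = η := by
    cases η₁; cases η; simp_all
  exact this ▸ hm₁

theorem Finset.exists_eq_cons {α : Type*} {s : Finset α} {a : α} (h : a ∈ s) :
    ∃ (t : Finset α) (ht : a ∉ t), s = t.cons a ht := by
  classical
  exact ⟨s.erase a, Finset.notMem_erase a s, by simp [Finset.insert_erase h]⟩

/-- If the heads of the projections of all participants fit an action, then the action can be
extracted from the choreography. -/
theorem Ext.exists {lab : Lab Pid Var Expr Lbl} {C Γ} (hC : C.WF L)
    (h : ∀ r a, Loc lab r a → ∃ B, Proj r Γ C B ∧ Beh.Can a B) : ∃ C', Ext lab C C' := by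
  induction C generalizing Γ with
  | com H C ih =>
    -- Either the group is invisible to all participants and can be skipped, or the action has to
    -- belong to it.
    by_cases hH : ∀ η ∈ H, ¬ lab.Inv η.src ∧ ¬ lab.Inv η.tgt
    · obtain ⟨C', hC'⟩ := ih hC.2 (Γ := Γ) fun r a hr => by
        obtain ⟨B, hB, hc⟩ := h r a hr
        cases hB with
        | com _ hB =>
          refine ⟨_, hB, ?_⟩
          rw [actsOf_eq_empty fun η hη => ⟨fun h => (hH η hη).1 (h ▸ hr.inv),
            fun h => (hH η hη).2 (h ▸ hr.inv)⟩] at hc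
          simpa [Beh.comOpt] using hc
      exact ⟨_, .com H hH hC'⟩
    · have key : ∀ r a, Loc lab r a → (actsOf r H).Nonempty → ∃ a' ∈ actsOf r H, a = .act a' := by
        intro r a hr hne
        obtain ⟨B, hB, hc⟩ := h r a hr
        cases hB with
        | com _ hB =>
          exact (Beh.can_comOpt hc).resolve_left fun h => hne.ne_empty h.1
      obtain ⟨r, hr, hne⟩ : ∃ r, lab.Inv r ∧ (actsOf r H).Nonempty := by
        simp only [not_forall, not_and_or, not_not] at hH
        obtain ⟨η, hη, h | h⟩ := hH
        · exact ⟨_, h, _, mem_actsOf_iff.2 ⟨η, hη, .inl ⟨rfl, rfl⟩⟩⟩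
        · exact ⟨_, h, _, mem_actsOf_iff.2 ⟨η, hη, .inr ⟨rfl, rfl⟩⟩⟩
      cases lab with
      | com η =>
        have h₁ := key _ _ (.send η)
        have h₂ := key _ _ (.recv η)
        simp only [BAct.act.injEq, exists_eq_right'] at h₁ h₂
        have hm : η ∈ H := mem_of_actsOf hC.1 h₁ h₂ (by rcases hr with rfl | rfl <;> simp [hne])
        obtain ⟨H', h', rfl⟩ := Finset.exists_eq_cons hm
        exact ⟨_, .hereCom η H' h' C⟩
      | sel φ =>
        obtain ⟨a, ha⟩ := hr.exists_loc
        obtain ⟨a', _, rfl⟩ := key r a ha hne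
        cases ha
      | cond p e b =>
        obtain ⟨a, ha⟩ := hr.exists_loc
        obtain ⟨a', _, rfl⟩ := key r a ha hne
        cases ha
  | sel Φ C ih =>
    by_cases hΦ : ∀ φ ∈ Φ, ¬ lab.Inv φ.src ∧ ¬ lab.Inv φ.tgt
    · obtain ⟨C', hC'⟩ := ih hC.2 (Γ := Γ) fun r a hr => by
        obtain ⟨B, hB, hc⟩ := h r a hr
        cases hB with
        | selRecv _ φ hφ ht => exact absurd (ht ▸ hr.inv) (hΦ φ hφ).2
        | selSend _ _ hB =>
          refine ⟨_, hB, ?_⟩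
          rw [selsOf_eq_empty fun φ hφ h => (hΦ φ hφ).1 (h ▸ hr.inv)] at hc
          simpa [Beh.selOpt] using hc
      exact ⟨_, .sel Φ hΦ hC'⟩
    · obtain ⟨φ, hφ, hmem⟩ : ∃ φ, lab = .sel φ ∧ φ ∈ Φ := by
        -- The label is recovered from the sender, because the head of the receiver is only known to
        -- be a branching term on that sender.
        have hsend : ∀ φ, lab = .sel φ → (selsOf φ.src Φ).Nonempty → φ ∈ Φ := by
          rintro φ rfl hne
          obtain ⟨B, hB, hc⟩ := h _ _ (.sel φ)
          cases hB with
          | selRecv => cases hc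
          | selSend _ _ hB =>
            obtain ⟨q, l, hm, he⟩ := (Beh.can_selOpt hc).resolve_left fun h => hne.ne_empty h.1
            cases he
            obtain ⟨φ', h', h₁, h₂, h₃⟩ := mem_selsOf.1 hm
            have : φ' = φ := by cases φ'; cases φ; simp_all
            exact this ▸ h'
        simp only [not_forall, not_and_or, not_not] at hΦ
        obtain ⟨φ, hφ, hi⟩ := hΦ
        obtain ⟨r, hr, hrφ⟩ : ∃ r, lab.Inv r ∧ (φ.src = r ∨ φ.tgt = r) := by
          rcases hi with hi | hi
          · exact ⟨_, hi, .inl rfl⟩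
          · exact ⟨_, hi, .inr rfl⟩
        obtain ⟨a, ha⟩ := hr.exists_loc
        obtain ⟨B, hB, hc⟩ := h r a ha
        cases hB with
        | selRecv _ φ' hφ' ht hB =>
          cases hc
          -- Here `r` is a receiver. Its branching term names the sender of `φ'` as the sender of
          -- the action, which therefore selects in this group.
          generalize hs : φ'.src = s at ha
          cases ha with
          | br φ₀ =>
            exact ⟨φ₀, rfl, hsend φ₀ rfl
              ⟨(φ'.tgt, φ'.lbl), mem_selsOf.2 ⟨φ', hφ', hs, rfl, rfl⟩⟩⟩
        | selSend _ hn hB =>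
          have hs : φ.src = r := hrφ.resolve_right (hn φ hφ)
          have hne : (selsOf r Φ).Nonempty := ⟨_, mem_selsOf.2 ⟨φ, hφ, hs, rfl, rfl⟩⟩
          obtain ⟨q, l, hm, rfl⟩ := (Beh.can_selOpt hc).resolve_left fun h => hne.ne_empty h.1
          cases ha with
          | sel φ₀ => exact ⟨φ₀, rfl, hsend φ₀ rfl hne⟩
      subst hφ
      obtain ⟨Φ', h', rfl⟩ := Finset.exists_eq_cons hmem
      exact ⟨_, .hereSel φ Φ' h' C⟩
  | ite p e C₁ C₂ ih₁ ih₂ =>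
    by_cases hp : lab.Inv p
    · obtain ⟨a, ha⟩ := hp.exists_loc
      obtain ⟨B, hB, hc⟩ := h p a ha
      cases hB with
      | iteSelf _ h₁ h₂ =>
        cases hc with
        | ite _ b =>
          cases ha
          cases b with
          | true => exact ⟨_, .hereTrue p e C₁ C₂⟩
          | false => exact ⟨_, .hereFalse p e C₁ C₂⟩
      | iteOther _ _ hne => exact absurd rfl hne
    · obtain ⟨C₁', h₁⟩ := ih₁ hC.1 (Γ := Γ) fun r a hr => by
        obtain ⟨B, hB, hc⟩ := h r a hr
        cases hB with
        | iteSelf => exact absurd hr.inv hp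
        | iteOther _ _ _ h₁ h₂ hm => exact ⟨_, h₁, hc.of_prune (Beh.Prune.of_merge hm).1⟩
      obtain ⟨C₂', h₂⟩ := ih₂ hC.2 (Γ := Γ) fun r a hr => by
        obtain ⟨B, hB, hc⟩ := h r a hr
        cases hB with
        | iteSelf => exact absurd hr.inv hp
        | iteOther _ _ _ h₁ h₂ hm => exact ⟨_, h₂, hc.of_prune (Beh.Prune.of_merge hm).2⟩
      exact ⟨_, .ite p e hp h₁ h₂⟩
  | recd A C _ ih =>
    obtain ⟨C', hC'⟩ := ih hC.2 (Γ := pn (∅ :: Γ) A :: Γ) fun r a hr => by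
      obtain ⟨B, hB, hc⟩ := h r a hr
      cases hB with
      | recIn _ _ hB => cases hc with | recd _ hc => exact ⟨_, hB, hc⟩
      | recOut _ hB => exact ⟨_, hB, hc⟩
    exact ⟨_, .recd A hC'⟩
  | call k =>
    -- An invocation projects to an invocation or to `nil`, neither of which has an action at its
    -- head.
    obtain ⟨r, hr⟩ := lab.exists_inv
    obtain ⟨a, ha⟩ := hr.exists_loc
    obtain ⟨B, hB, hc⟩ := h r a ha
    cases hB <;> cases hc
  | nil =>
    obtain ⟨r, hr⟩ := lab.exists_inv
    obtain ⟨a, ha⟩ := hr.exists_loc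
    obtain ⟨B, hB, hc⟩ := h r a ha
    cases hB; cases hc

theorem actsOf_cons_of_ne {r : Pid} {η : Com Pid Var Expr} {H} (h : η ∉ H) (hs : η.src ≠ r)
    (ht : η.tgt ≠ r) : actsOf r (H.cons η h) = actsOf r H := by
  ext a
  simp only [mem_actsOf_iff, Finset.mem_cons]
  grind

/-- No other communication of the group contributes the same local action, because sender and
receiver determine the communication; erasing the action from the set thus removes exactly one
communication. -/
theorem erase_actsOf_cons {η : Com Pid Var Expr} {H} {h : η ∉ H} (hH : WFCom L (H.cons η h)) {r a}
    (ha : Loc (Lbl := Lbl) (.com η) r (.act a)) :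
    a ∈ actsOf r (H.cons η h) ∧ (actsOf r (H.cons η h)).erase a = actsOf r H := by
  have hη : η.src ≠ η.tgt := hH.1 η (Finset.mem_cons_self η H)
  have hu : ∀ η' ∈ H, η'.tgt = η.tgt → η'.src ≠ η.src := fun η' hη' ht =>
    (hH.2.1 η' (Finset.mem_cons_of_mem hη') η (Finset.mem_cons_self η H)
      (fun e => h (e ▸ hη')) ht).2
  cases ha with
  | send =>
    refine ⟨send_mem_actsOf.2 ⟨η, Finset.mem_cons_self η H, rfl, rfl, rfl⟩, ?_⟩
    ext a
    simp only [Finset.mem_erase, mem_actsOf_iff, Finset.mem_cons]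
    constructor
    · grind
    · rintro ⟨η', hη', h'⟩
      refine ⟨?_, η', .inr hη', h'⟩
      rintro rfl
      rcases h' with ⟨h₁, h₂⟩ | ⟨_, h₂⟩
      · have := (Act.send.inj h₂).1
        grind
      · cases h₂
  | recv =>
    refine ⟨recv_mem_actsOf.2 ⟨η, Finset.mem_cons_self η H, rfl, rfl, rfl⟩, ?_⟩
    ext a
    simp only [Finset.mem_erase, mem_actsOf_iff, Finset.mem_cons]
    constructor
    · grind
    · rintro ⟨η', hη', h'⟩
      refine ⟨?_, η', .inr hη', h'⟩
      rintro rfl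
      rcases h' with ⟨_, h₂⟩ | ⟨h₁, h₂⟩
      · cases h₂
      · grind

theorem selsOf_cons_of_ne {r : Pid} {φ : Sel Pid Lbl} {Φ} (h : φ ∉ Φ) (hs : φ.src ≠ r) :
    selsOf r (Φ.cons φ h) = selsOf r Φ := by
  ext ⟨q, l⟩
  simp only [mem_selsOf, Finset.mem_cons]
  grind

theorem erase_selsOf_cons {φ : Sel Pid Lbl} {Φ} {h : φ ∉ Φ} (hΦ : WFSel (Φ.cons φ h)) :
    (φ.tgt, φ.lbl) ∈ selsOf φ.src (Φ.cons φ h) ∧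
      (selsOf φ.src (Φ.cons φ h)).erase (φ.tgt, φ.lbl) = selsOf φ.src Φ := by
  refine ⟨mem_selsOf.2 ⟨φ, Finset.mem_cons_self φ Φ, rfl, rfl, rfl⟩, ?_⟩
  have hu : ∀ φ' ∈ Φ, φ.tgt ≠ φ'.tgt := fun φ' h' =>
    (hΦ.2 φ (Finset.mem_cons_self φ Φ) φ' (Finset.mem_cons_of_mem h') fun e => h (e ▸ h')).2
  ext ⟨q, l⟩
  simp only [Finset.mem_erase, mem_selsOf, Finset.mem_cons]
  constructor
  · rintro ⟨hne, φ', rfl | h', h₁, h₂, h₃⟩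
    · exact absurd (by rw [h₂, h₃]) hne
    · exact ⟨φ', h', h₁, h₂, h₃⟩
  · rintro ⟨φ', h', h₁, h₂, h₃⟩
    refine ⟨fun e => hu φ' h' ?_, φ', .inr h', h₁, h₂, h₃⟩
    rw [h₂]
    exact (Prod.ext_iff.1 e).1.symm

theorem Beh.LH.comOpt {a Θ} {B : Beh Pid Var Expr Lbl} (h : a ∈ Θ) :
    LH (.act a) (comOpt Θ B) (comOpt (Θ.erase a) B) := by
  have : Θ ≠ ∅ := Finset.ne_empty_of_mem h
  rw [Beh.comOpt, if_neg this]
  exact .com B h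

theorem Beh.LH.selOpt {q l S} {B : Beh Pid Var Expr Lbl} (h : (q, l) ∈ S) :
    LH (.sel q l) (selOpt S B) (selOpt (S.erase (q, l)) B) := by
  have : S ≠ ∅ := Finset.ne_empty_of_mem h
  rw [Beh.selOpt, if_neg this]
  exact .sel B h

/-- The participants of an extracted action perform it, and the projections on the other
processes lose at most some branches. -/
theorem Ext.proj {lab : Lab Pid Var Expr Lbl} {C C'} (h : Ext lab C C') (hl : lab.Proper)
    (hC : C.WF L) {r Γ B} (hB : Proj r Γ C B) :
    ∃ B', Proj r Γ C' B' ∧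
      ((¬ lab.Inv r ∧ Beh.Prune B' B) ∨ ∃ a, Loc lab r a ∧ Beh.LH a B B') := by
  induction h generalizing Γ B with
  | hereCom η H h C =>
    cases hB with | com _ hB =>
    refine ⟨_, .com H hB, ?_⟩
    by_cases hi : (Lab.com η : Lab Pid Var Expr Lbl).Inv r
    · obtain ⟨a, ha⟩ := hi.exists_loc
      refine .inr ⟨a, ha, ?_⟩
      have : ∃ a', a = .act a' := by cases ha <;> exact ⟨_, rfl⟩
      obtain ⟨a, rfl⟩ := this
      obtain ⟨h₁, h₂⟩ := erase_actsOf_cons hC.1 ha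
      rw [← h₂]
      exact .comOpt h₁
    · refine .inl ⟨hi, ?_⟩
      rw [actsOf_cons_of_ne h (fun e => hi (.inl e)) (fun e => hi (.inr e))]
      exact .refl _
  | hereSel φ Φ h C =>
    have hself : φ ∈ Φ.cons φ h := Finset.mem_cons_self φ Φ
    have hu : ∀ φ' ∈ Φ, φ.tgt ≠ φ'.src ∧ φ.tgt ≠ φ'.tgt := fun φ' h' =>
      hC.1.2 φ hself φ' (Finset.mem_cons_of_mem h') fun e => h (e ▸ h')
    cases hB with
    | selRecv _ φ' hφ' ht hB =>
      subst ht
      rcases Finset.mem_cons.1 hφ' with rfl | hm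
      -- By condition (c) the target of the performed selection takes no further part in the group,
      -- so its projection continues with the branch itself.
      · have := Proj.selSend Φ (fun φ' h' => (hu φ' h').2.symm) hB
        rw [selsOf_eq_empty fun φ' h' => (hu φ' h').1.symm, Beh.selOpt, if_pos rfl] at this
        refine ⟨_, this, .inr ⟨_, .br φ', ?_⟩⟩
        exact .br (fun _ => _) ⟨φ'.lbl, by simp⟩
      -- The target of another selection of the group is neither source nor target of `φ`, again by
      -- condition (c).
      · refine ⟨_, .selRecv Φ φ' hm rfl hB, .inl ⟨?_, .refl _⟩⟩
        rintro (h' | h')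
        · exact (hC.1.2 φ' hφ' φ hself fun e => h (e ▸ hm)).1 h'.symm
        · exact (hu φ' hm).2 h'
    | selSend _ hn hB =>
      refine ⟨_, .selSend Φ (fun φ' h' => hn φ' (Finset.mem_cons_of_mem h')) hB, ?_⟩
      by_cases hs : φ.src = r
      · subst hs
        obtain ⟨h₁, h₂⟩ := erase_selsOf_cons hC.1
        refine .inr ⟨_, .sel φ, ?_⟩
        rw [← h₂]
        exact .selOpt h₁
      · refine .inl ⟨fun h' => h'.elim hs (hn φ hself), ?_⟩
        rw [selsOf_cons_of_ne h hs]
        exact .refl _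
  | hereTrue p e C₁ C₂ =>
    cases hB with
    | iteSelf _ h₁ h₂ => exact ⟨_, h₁, .inr ⟨_, .cond _ _ _, .iteTrue _ _ _⟩⟩
    | iteOther _ _ hne h₁ h₂ hm => exact ⟨_, h₁, .inl ⟨hne, (Beh.Prune.of_merge hm).1⟩⟩
  | hereFalse p e C₁ C₂ =>
    cases hB with
    | iteSelf _ h₁ h₂ => exact ⟨_, h₂, .inr ⟨_, .cond _ _ _, .iteFalse _ _ _⟩⟩
    | iteOther _ _ hne h₁ h₂ hm => exact ⟨_, h₂, .inl ⟨hne, (Beh.Prune.of_merge hm).2⟩⟩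
  | com H hH _ ih =>
    cases hB with | com _ hB =>
    obtain ⟨B', hB', h' | ⟨a, ha, h'⟩⟩ := ih hl hC.2 hB
    · exact ⟨_, .com H hB', .inl ⟨h'.1, h'.2.comOpt _⟩⟩
    · refine ⟨_, .com H hB', .inr ⟨a, ha, ?_⟩⟩
      rw [actsOf_eq_empty fun η hη => ⟨fun e => (hH η hη).1 (e ▸ ha.inv),
        fun e => (hH η hη).2 (e ▸ ha.inv)⟩]
      simpa [Beh.comOpt] using h'
  | sel Φ hΦ _ ih =>
    cases hB with
    | selRecv _ φ hφ ht hB =>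
      obtain ⟨B', hB', h' | ⟨a, ha, h'⟩⟩ := ih hl hC.2 hB
      · exact ⟨_, .selRecv Φ φ hφ ht hB',
          .inl ⟨h'.1, .branch _ _ _ (Finset.Subset.refl _) _ _ fun _ => h'.2⟩⟩
      · exact absurd (ht ▸ ha.inv) (hΦ φ hφ).2
    | selSend _ hn hB =>
      obtain ⟨B', hB', h' | ⟨a, ha, h'⟩⟩ := ih hl hC.2 hB
      · exact ⟨_, .selSend Φ hn hB', .inl ⟨h'.1, h'.2.selOpt _⟩⟩
      · refine ⟨_, .selSend Φ hn hB', .inr ⟨a, ha, ?_⟩⟩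
        rw [selsOf_eq_empty fun φ hφ e => (hΦ φ hφ).1 (e ▸ ha.inv)]
        simpa [Beh.selOpt] using h'
  | ite p e hp _ _ ih₁ ih₂ =>
    cases hB with
    | iteSelf _ h₁ h₂ =>
      obtain ⟨B₁, hB₁, h₁' | ⟨a, ha, _⟩⟩ := ih₁ hl hC.1 h₁
      · obtain ⟨B₂, hB₂, h₂' | ⟨a, ha, _⟩⟩ := ih₂ hl hC.2 h₂
        · exact ⟨_, .iteSelf e hB₁ hB₂, .inl ⟨hp, .ite e h₁'.2 h₂'.2⟩⟩
        · exact absurd ha.inv hp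
      · exact absurd ha.inv hp
    | iteOther _ _ hne h₁ h₂ hm =>
      -- Whether `r` participates does not depend on the branch, so the two mixed cases are
      -- contradictory.
      obtain ⟨B₁, hB₁, h₁' | ⟨a, ha, h₁'⟩⟩ := ih₁ hl hC.1 h₁ <;>
      obtain ⟨B₂, hB₂, h₂' | ⟨a', ha', h₂'⟩⟩ := ih₂ hl hC.2 h₂
      · obtain ⟨B', hm', hp'⟩ := Beh.Prune.merge hm h₁'.2 h₂'.2
        exact ⟨_, .iteOther p e hne hB₁ hB₂ hm', .inl ⟨h₁'.1, hp'⟩⟩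
      · exact absurd ha'.inv h₁'.1
      · exact absurd ha.inv h₂'.1
      · cases ha.functional hl ha'
        obtain ⟨B', hm', hp'⟩ := Beh.LH.merge hm h₁' h₂'
        exact ⟨_, .iteOther p e hne hB₁ hB₂ hm', .inr ⟨a, ha, hp'⟩⟩
  | recd A _ ih =>
    cases hB with
    | recIn hr h₂ h₁ =>
      obtain ⟨B', hB', h' | ⟨a, ha, h'⟩⟩ := ih hl hC.2 h₁
      · exact ⟨_, .recIn hr h₂ hB', .inl ⟨h'.1, .recd (.refl _) h'.2⟩⟩
      · exact ⟨_, .recIn hr h₂ hB', .inr ⟨a, ha, .recd _ h'⟩⟩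
    | recOut hr h₁ =>
      obtain ⟨B', hB', h'⟩ := ih hl hC.2 h₁
      exact ⟨_, .recOut hr hB', h'⟩

end Extraction

namespace Net

/-! ### Structural congruence of parallel products -/

section Congruence

variable {Pid Var Expr Lbl : Type*}

theorem Pre.parAssoc' (N₁ N₂ N₃ : Net Pid Var Expr Lbl) :
    Pre (Net.par N₁ (Net.par N₂ N₃)) (Net.par (Net.par N₁ N₂) N₃) :=
  .trans (.parComm _ _) <| .trans (.par (.parComm _ _) (.refl _)) <| .trans (.parAssoc _ _ _) <|
    .trans (.parComm _ _) (.par (.parComm _ _) (.refl _))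

theorem Pre.parLeftComm (N₁ N₂ N₃ : Net Pid Var Expr Lbl) :
    Pre (Net.par N₁ (Net.par N₂ N₃)) (Net.par N₂ (Net.par N₁ N₃)) :=
  .trans (.parAssoc' _ _ _) <| .trans (.par (.parComm _ _) (.refl _)) (.parAssoc _ _ _)

theorem prod_congr {B B' : Pid → Beh Pid Var Expr Lbl} {l : List Pid} (h : ∀ p ∈ l, B p = B' p) :
    prod B l = prod B' l := by
  induction l with
  | nil => rfl
  | cons p l ih =>
    change par _ (prod B l) = par _ (prod B' l)
    rw [h p (by simp), ih fun q hq => h q (by simp [hq])]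

theorem Pre.prod {B B' : Pid → Beh Pid Var Expr Lbl} {l : List Pid}
    (h : ∀ p ∈ l, Beh.Pre (B p) (B' p)) : Pre (Net.prod B l) (Net.prod B' l) := by
  induction l with
  | nil => exact .refl _
  | cons p l ih => exact .par (.proc p (h p (by simp))) (ih fun q hq => h q (by simp [hq]))

theorem Pre.prod_perm (B : Pid → Beh Pid Var Expr Lbl) {l l' : List Pid} (h : l.Perm l') :
    Pre (Net.prod B l) (Net.prod B l') := by
  induction h with
  | nil => exact .refl _
  | cons p _ ih => exact .par (.refl _) ih
  | swap p q l => exact .parLeftComm _ _ _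
  | trans _ _ ih₁ ih₂ => exact .trans ih₁ ih₂

theorem Congr.of_pre {N M : Net Pid Var Expr Lbl} (h : Pre N M) : Congr N M := .rel _ _ h

theorem Congr.trans {N₁ N₂ N₃ : Net Pid Var Expr Lbl} (h : Congr N₁ N₂) (h' : Congr N₂ N₃) :
    Congr N₁ N₃ := Relation.EqvGen.trans _ _ _ h h'

theorem Congr.symm {N M : Net Pid Var Expr Lbl} (h : Congr N M) : Congr M N :=
  Relation.EqvGen.symm _ _ h

theorem Congr.refl (N : Net Pid Var Expr Lbl) : Congr N N := Relation.EqvGen.refl _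

theorem Congr.par {N N' M M' : Net Pid Var Expr Lbl} (h : Congr N N') (h' : Congr M M') :
    Congr (Net.par N M) (Net.par N' M') := by
  have h₂ : Congr (N'.par M) (N'.par M') := by
    clear h
    induction h' with
    | rel _ _ h => exact .rel _ _ (.par (.refl _) h)
    | refl => exact .refl _
    | symm _ _ _ ih => exact ih.symm
    | trans _ _ _ _ _ ih₁ ih₂ => exact ih₁.trans ih₂
  have h₁ : Congr (N.par M) (N'.par M) := by
    clear h₂ h'
    induction h with
    | rel _ _ h => exact .rel _ _ (.par h (.refl _))
    | refl => exact .refl _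
    | symm _ _ _ ih => exact ih.symm
    | trans _ _ _ _ _ ih₁ ih₂ => exact ih₁.trans ih₂
  exact h₁.trans h₂

theorem Congr.proc (p : Pid) {B B' : Beh Pid Var Expr Lbl} (h : Relation.EqvGen Beh.Pre B B') :
    Congr (proc p B) (proc p B') := by
  induction h with
  | rel _ _ h => exact .rel _ _ (.proc p h)
  | refl => exact .refl _
  | symm _ _ _ ih => exact ih.symm
  | trans _ _ _ _ _ ih₁ ih₂ => exact ih₁.trans ih₂

theorem Congr.prod {B B' : Pid → Beh Pid Var Expr Lbl} (l : List Pid)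
    (h : ∀ p, Relation.EqvGen Beh.Pre (B p) (B' p)) : Congr (Net.prod B l) (Net.prod B' l) := by
  induction l with
  | nil => exact .refl _
  | cons p l ih => exact .par (.proc p (h p)) ih

theorem Congr.prod_append (B : Pid → Beh Pid Var Expr Lbl) (l l' : List Pid) :
    Congr (Net.par (Net.prod B l) (Net.prod B l')) (Net.prod B (l ++ l')) := by
  induction l with
  | nil => exact .of_pre (.parNil _)
  | cons p l ih => exact (Congr.of_pre (.parAssoc _ _ _)).trans (.par (.refl _) ih)

theorem Congr.prod_nil (B : Pid → Beh Pid Var Expr Lbl) {l : List Pid} (h : ∀ p ∈ l, B p = .nil) :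
    Congr (Net.prod B l) nil := by
  induction l with
  | nil => exact .refl _
  | cons p l ih =>
    change Congr (Net.par (Net.proc p (B p)) (Net.prod B l)) _
    rw [h p (by simp)]
    exact (Congr.par (.of_pre (.procNil p)) (ih fun q hq => h q (by simp [hq]))).trans
      (.of_pre (.parNil _))

end Congruence

/-! ### Networks as families of behaviours -/

section View

variable {Pid Var Val Expr Lbl : Type*} [DecidableEq Pid]

/-- The names of the processes of a network. -/
def names : Net Pid Var Expr Lbl → List Pid
  | nil => []
  | proc p _ => [p]
  | par N M => N.names ++ M.names

/-- The behaviour of a process in a network. -/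
def beh : Net Pid Var Expr Lbl → Pid → Beh Pid Var Expr Lbl
  | nil, _ => .nil
  | proc p B, r => if r = p then B else .nil
  | par N M, r => if r ∈ N.names then N.beh r else M.beh r

theorem beh_of_notMem {N : Net Pid Var Expr Lbl} {r : Pid} (h : r ∉ N.names) : N.beh r = .nil := by
  induction N with
  | nil => rfl
  | proc p B => simpa [names, beh] using fun e => absurd e (by simpa [names] using h)
  | par N M ihN ihM =>
    simp only [names, List.mem_append, not_or] at h
    simp [beh, h.1, ihM h.2]

theorem beh_par_left {N M : Net Pid Var Expr Lbl} {r : Pid} (h : r ∉ M.names) :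
    (par N M).beh r = N.beh r := by
  by_cases hr : r ∈ N.names
  · simp [beh, hr]
  · simp [beh, hr, beh_of_notMem hr, beh_of_notMem h]

theorem beh_par_right {N M : Net Pid Var Expr Lbl} {r : Pid} (h : r ∉ N.names) :
    (par N M).beh r = M.beh r := by
  simp [beh, h]

theorem names_prod (B : Pid → Beh Pid Var Expr Lbl) (l : List Pid) : (prod B l).names = l := by
  induction l with
  | nil => rfl
  | cons p l ih => exact congrArg (p :: ·) ih

theorem beh_prod (B : Pid → Beh Pid Var Expr Lbl) (l : List Pid) (r : Pid) :
    (prod B l).beh r = if r ∈ l then B r else .nil := by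
  induction l with
  | nil => rfl
  | cons p l ih =>
    change (par (proc p (B p)) (prod B l)).beh r = _
    by_cases hr : r = p
    · subst hr; simp [beh, names]
    · rw [beh_par_right (by simpa [names] using hr), ih]
      simp [hr]

theorem notMem_of_nodup_par {N M : Net Pid Var Expr Lbl} (h : (par N M).names.Nodup) {r : Pid}
    (hr : r ∈ N.names) : r ∉ M.names := fun hr' =>
  (List.nodup_append.1 h).2.2 r hr r hr' rfl

/-- With distinct names, a network is a family of behaviours up to the arrangement of its parallel
components, and the precongruence acts on each member separately. Names may disappear, which is
harmless because an absent process counts as `nil`. -/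
theorem Pre.view {N M : Net Pid Var Expr Lbl} (h : Pre N M) (hn : N.names.Nodup) :
    M.names.Nodup ∧ M.names ⊆ N.names ∧ ∀ r, Beh.Pre (N.beh r) (M.beh r) := by
  induction h with
  | refl N => exact ⟨hn, fun _ h => h, fun r => .refl _⟩
  | trans _ _ ih₁ ih₂ =>
    obtain ⟨h₁, s₁, p₁⟩ := ih₁ hn
    obtain ⟨h₂, s₂, p₂⟩ := ih₂ h₁
    exact ⟨h₂, fun _ h => s₁ (s₂ h), fun r => .trans (p₁ r) (p₂ r)⟩
  | @par N N' M M' _ _ ih₁ ih₂ =>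
    have hd := fun r => notMem_of_nodup_par hn (r := r)
    obtain ⟨h₁, h₂, _⟩ := List.nodup_append.1 hn
    obtain ⟨h₁, s₁, p₁⟩ := ih₁ h₁
    obtain ⟨h₂, s₂, p₂⟩ := ih₂ h₂
    refine ⟨?_, ?_, fun r => ?_⟩
    · refine List.nodup_append.2 ⟨h₁, h₂, ?_⟩
      rintro a ha b hb rfl
      exact hd a (s₁ ha) (s₂ hb)
    · intro a ha
      simp only [names, List.mem_append] at ha ⊢
      exact ha.imp (fun h => s₁ h) fun h => s₂ h
    · by_cases hr : r ∈ N.names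
      · rw [beh_par_left (hd r hr), beh_par_left fun h => hd r hr (s₂ h)]
        exact p₁ r
      · rw [beh_par_right hr, beh_par_right fun h => hr (s₁ h)]
        exact p₂ r
  | proc p h =>
    refine ⟨hn, fun _ h => h, fun r => ?_⟩
    simp only [beh]
    split
    · exact h
    · exact .refl _
  | parComm N M =>
    have hp : (N.names ++ M.names).Perm (M.names ++ N.names) := List.perm_append_comm
    refine ⟨hp.nodup_iff.1 hn, hp.symm.subset, fun r => ?_⟩
    by_cases hr : r ∈ N.names
    · rw [beh_par_left (notMem_of_nodup_par hn hr), beh_par_right (notMem_of_nodup_par hn hr)]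
      exact .refl _
    · rw [beh_par_right hr, beh_par_left hr]
      exact .refl _
  | parAssoc N₁ N₂ N₃ =>
    simp only [names, List.append_assoc] at hn ⊢
    refine ⟨hn, fun _ h => h, fun r => ?_⟩
    have : (Net.par (Net.par N₁ N₂) N₃).beh r = (Net.par N₁ (Net.par N₂ N₃)).beh r := by
      simp only [beh, names, List.mem_append]
      by_cases h₁ : r ∈ N₁.names <;> by_cases h₂ : r ∈ N₂.names <;> simp [h₁, h₂]
    rw [this]
    exact .refl _
  | parNil N => exact ⟨hn, fun _ h => h, fun r => .refl _⟩
  | procNil p =>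
    refine ⟨List.nodup_nil, List.nil_subset _, fun r => ?_⟩
    simp only [beh, ite_self]
    exact .refl _

theorem congr_prod_names (N : Net Pid Var Expr Lbl) (hn : N.names.Nodup) :
    Congr N (prod N.beh N.names) := by
  induction N with
  | nil => exact .refl _
  | proc p B =>
    have : prod (proc p B).beh (proc p B).names = par (proc p B) nil := by
      simp [prod, names, beh]
    rw [this]
    exact ((Congr.of_pre (.parComm _ _)).trans (.of_pre (.parNil _))).symm
  | par N M ihN ihM =>
    have hd := fun r => notMem_of_nodup_par hn (r := r)
    obtain ⟨h₁, h₂, _⟩ := List.nodup_append.1 hn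
    refine ((Congr.par (ihN h₁) (ihM h₂)).trans ?_).trans (.prod_append _ _ _)
    rw [prod_congr (l := N.names) fun p hp => (beh_par_left (hd p hp)).symm,
      prod_congr (l := M.names) fun p hp => (beh_par_right fun h => hd p h hp).symm]
    exact .refl _

/-- The missing names are padded with processes `nil`, which are structurally absorbed. -/
theorem congr_prod (N : Net Pid Var Expr Lbl) (hn : N.names.Nodup) {l : List Pid} (hl : l.Nodup)
    (hs : N.names ⊆ l) : Congr N (prod N.beh l) := by
  have hp : (N.names ++ l.filter (· ∉ N.names)).Perm l := by
    refine (List.perm_ext_iff_of_nodup ?_ hl).2 fun a => ?_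
    · refine List.nodup_append.2 ⟨hn, hl.filter _, ?_⟩
      rintro a ha b hb rfl
      simp only [List.mem_filter, decide_eq_true_eq] at hb
      exact hb.2 ha
    · simp only [List.mem_append, List.mem_filter, decide_eq_true_eq]
      by_cases h : a ∈ N.names
      · simp [h, hs h]
      · simp [h]
  refine (congr_prod_names N hn).trans ?_
  refine Congr.trans ?_ (.of_pre (.prod_perm _ hp))
  refine Congr.trans ?_ (.prod_append _ _ _)
  have h₀ : Congr (prod N.beh (l.filter (· ∉ N.names))) nil := .prod_nil _ fun p hp => by
    simp only [List.mem_filter, decide_eq_true_eq] at hp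
    exact beh_of_notMem hp.2
  exact (((Congr.par (.refl _) h₀).trans (.of_pre (.parComm _ _))).trans (.of_pre (.parNil _))).symm

/-- Pruning can be checked process by process. -/
theorem prune_of_beh {N M : Net Pid Var Expr Lbl} (hN : N.names.Nodup) (hM : M.names.Nodup)
    (h : ∀ r, ∃ A A', Relation.EqvGen Beh.Pre (N.beh r) A ∧ Beh.Prune A A' ∧
      Relation.EqvGen Beh.Pre A' (M.beh r)) : Prune N M := by
  choose A A' h₁ h₂ h₃ using h
  -- Both networks are written over one common list of names, so that pruning can be applied
  -- componentwise.
  have hl := List.nodup_dedup (N.names ++ M.names)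
  refine ⟨prod A (N.names ++ M.names).dedup, prod A' (N.names ++ M.names).dedup, ?_, ?_, ?_⟩
  · exact (congr_prod N hN hl fun a ha => by simp [ha]).trans (.prod _ h₁)
  · generalize (N.names ++ M.names).dedup = l
    induction l with
    | nil => exact .nil
    | cons p l ih => exact .par (.proc p (h₂ p)) ih
  · exact (Congr.prod _ h₃).trans (congr_prod M hM hl fun a ha => by simp [ha]).symm

variable [DecidableEq Var] [DecidableEq Expr] [DecidableEq Lbl] {L : ExprLang Var Val Expr}

open Beh in
/-- A step of a network, process by process. -/
theorem Step.view {x y : Net Pid Var Expr Lbl × State Pid Var Val} (h : Step L x y)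
    (hn : x.1.names.Nodup) : y.1.names.Nodup ∧ y.1.names ⊆ x.1.names ∧
      ∃ lab : Lab Pid Var Expr Lbl, lab.Proper ∧ lab.Fires L x.2 y.2 ∧
        ∀ r, (¬ lab.Inv r ∧ BEq [] (x.1.beh r) (y.1.beh r)) ∨
          ∃ a, Loc lab r a ∧ ∃ B, Cap [] a (x.1.beh r) B ∧ BEq [] B (y.1.beh r) := by
  induction h with
  | com p q e x Θ Θ' B B' σ hs hr =>
    have hpq : p ≠ q := by simpa [names] using hn
    refine ⟨hn, fun _ h => h, .com ⟨p, e, q, x⟩, hpq, rfl, fun r => ?_⟩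
    by_cases hp : r = p
    · subst hp
      refine .inr ⟨_, .send ⟨r, e, q, x⟩, comOpt (Θ.erase (.send q e)) B, ?_, ?_⟩
      · simpa [beh, names] using Cap.com B hs
      · simpa [beh, names] using (BEq.of_pre (pre_comOpt _ _) []).symm
    · by_cases hq : r = q
      · subst hq
        refine .inr ⟨_, .recv ⟨p, e, r, x⟩, comOpt (Θ'.erase (.recv p x)) B', ?_, ?_⟩
        · simpa [beh, names, hp] using Cap.com B' hr
        · simpa [beh, names, hp] using (BEq.of_pre (pre_comOpt _ _) []).symm
      · refine .inl ⟨?_, ?_⟩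
        · rintro (h | h)
          · exact hp h.symm
          · exact hq h.symm
        · simpa [beh, names, hp, hq] using .refl _ _
  | sel p q S B J f ℓ σ hs =>
    have hpq : p ≠ q := by simpa [names] using hn
    refine ⟨hn, fun _ h => h, .sel ⟨p, q, (ℓ : Lbl)⟩, hpq, rfl, fun r => ?_⟩
    by_cases hp : r = p
    · subst hp
      refine .inr ⟨_, .sel ⟨r, q, (ℓ : Lbl)⟩, selOpt (S.erase (q, (ℓ : Lbl))) B, ?_, ?_⟩
      · simpa [beh, names] using Cap.sel B hs
      · simpa [beh, names] using (BEq.of_pre (pre_selOpt _ _) []).symm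
    · by_cases hq : r = q
      · subst hq
        refine .inr ⟨_, .br ⟨p, r, (ℓ : Lbl)⟩, f ℓ, ?_, ?_⟩
        · simpa [beh, names, hp] using Cap.br f ℓ
        · simpa [beh, names, hp] using .refl _ _
      · refine .inl ⟨?_, ?_⟩
        · rintro (h | h)
          · exact hp h.symm
          · exact hq h.symm
        · simpa [beh, names, hp, hq] using .refl _ _
  | iteTrue p e B₁ B₂ σ h =>
    refine ⟨hn, fun _ h => h, .cond p e true, trivial, ⟨by simpa using h, rfl⟩, fun r => ?_⟩
    by_cases hp : r = p
    · subst hp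
      exact .inr ⟨_, .cond _ _ _, _, by simpa [beh] using .iteTrue _ _ _ _,
        by simpa [beh] using .refl _ _⟩
    · exact .inl ⟨Ne.symm hp, by simpa [beh, hp] using .refl _ _⟩
  | iteFalse p e B₁ B₂ σ h =>
    refine ⟨hn, fun _ h => h, .cond p e false, trivial, ⟨by simpa using h, rfl⟩, fun r => ?_⟩
    by_cases hp : r = p
    · subst hp
      exact .inr ⟨_, .cond _ _ _, _, by simpa [beh] using .iteFalse _ _ _ _,
        by simpa [beh] using .refl _ _⟩
    · exact .inl ⟨Ne.symm hp, by simpa [beh, hp] using .refl _ _⟩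
  | @ctx p B₁ B₁' N N' σ σ' A _ ih =>
    obtain ⟨hn', hs, lab, hl, hf, hv⟩ := ih hn
    refine ⟨hn', hs, lab, hl, hf, fun r => ?_⟩
    have hv := hv r
    by_cases hp : r = p
    · subst hp
      simp only [beh, names, List.mem_singleton, if_true] at hv ⊢
      rcases hv with ⟨hi, h⟩ | ⟨a, ha, B, hc, hB⟩
      -- Whatever holds without definitions in scope also holds with `A` in scope.
      · exact .inl ⟨hi, .recd A (h.append [A])⟩
      · exact .inr ⟨a, ha, _, .recd A (hc.append [A]), .recd A (hB.append [A])⟩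
    · simpa [beh, names, hp] using hv
  | @par N N' σ σ' M _ ih =>
    have hd := fun r => notMem_of_nodup_par hn (r := r)
    obtain ⟨h₁, h₂, _⟩ := List.nodup_append.1 hn
    obtain ⟨hn', hs, lab, hl, hf, hv⟩ := ih h₁
    refine ⟨?_, ?_, lab, hl, hf, fun r => ?_⟩
    · refine List.nodup_append.2 ⟨hn', h₂, ?_⟩
      rintro a ha b hb rfl
      exact hd a (hs ha) hb
    · intro a ha
      simp only [names, List.mem_append] at ha ⊢
      exact ha.imp (fun h => hs h) id
    · by_cases hr : r ∈ N.names
      · simp only [beh_par_left (hd r hr)]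
        exact hv r
      · simp only [beh_par_right hr, beh_par_right fun h => hr (hs h)]
        rcases hv r with ⟨hi, _⟩ | ⟨a, ha, B, hc, _⟩
        · exact .inl ⟨hi, .refl _ _⟩
        · rw [beh_of_notMem hr] at hc
          cases hc
  | str h _ h' ih =>
    obtain ⟨hn₁, hs₁, hp₁⟩ := h.view hn
    obtain ⟨hn₂, hs₂, lab, hl, hf, hv⟩ := ih hn₁
    obtain ⟨hn₃, hs₃, hp₃⟩ := h'.view hn₂
    refine ⟨hn₃, fun _ h => hs₁ (hs₂ (hs₃ h)), lab, hl, hf, fun r => ?_⟩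
    rcases hv r with ⟨hi, h⟩ | ⟨a, ha, B, hc, hB⟩
    · exact .inl ⟨hi, (BEq.of_pre (hp₁ r) []).trans (h.trans (.of_pre (hp₃ r) []))⟩
    · obtain ⟨B', hc', hB'⟩ := Cap.of_pre (hp₁ r) hc
      exact .inr ⟨a, ha, B', hc', hB'.trans (hB.trans (.of_pre (hp₃ r) []))⟩

end View

/-! ### Network steps from local actions -/

section Simulation

variable {Pid Var Val Expr Lbl : Type*} [DecidableEq Pid] [DecidableEq Var] [DecidableEq Expr]
  [DecidableEq Lbl] {L : ExprLang Var Val Expr}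

/-- An action at the head of a behaviour, not below a definition. -/
inductive Head : BAct Pid Var Expr Lbl → Beh Pid Var Expr Lbl → Beh Pid Var Expr Lbl → Prop
  | com {a Θ} (B) : a ∈ Θ → Head (.act a) (.com Θ B) (.com (Θ.erase a) B)
  | sel {q l S} (B) : (q, l) ∈ S → Head (.sel q l) (.sel S B) (.sel (S.erase (q, l)) B)
  | br {p} {J : Finset Lbl} (f : J → Beh Pid Var Expr Lbl) (l : J) :
      Head (.br p l) (.branch p J f) (f l)
  | iteTrue (e B₁ B₂) : Head (.cond e true) (.ite e B₁ B₂) B₁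
  | iteFalse (e B₁ B₂) : Head (.cond e false) (.ite e B₁ B₂) B₂

/-- The semantics handles each layer above the action: definitions by `Step.ctx`, empty groups by
the precongruence, which also removes a group that the action has exhausted. -/
theorem step_of_head {q : Pid} {N N' : Net Pid Var Expr Lbl} {σ σ' : State Pid Var Val}
    {a B B'} (h : Beh.LH a B B')
    (hb : ∀ B B', Head a B B' → Step L (par (proc q B) N, σ) (par (proc q B') N', σ')) :
    Step L (par (proc q B) N, σ) (par (proc q B') N', σ') := by
  induction h with
  | com B h =>
    exact .str (.refl _) (hb _ _ (.com B h)) (.par (.proc q (Beh.pre_comOpt _ _)) (.refl _))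
  | sel B h =>
    exact .str (.refl _) (hb _ _ (.sel B h)) (.par (.proc q (Beh.pre_selOpt _ _)) (.refl _))
  | br f l => exact hb _ _ (.br f l)
  | iteTrue => exact hb _ _ (.iteTrue _ _ _)
  | iteFalse => exact hb _ _ (.iteFalse _ _ _)
  | recd A _ ih => exact .ctx A (ih hb)
  | comEmpty _ ih => exact .str (.par (.proc q (.comEmpty _)) (.refl _)) (ih hb) (.refl _)
  | selEmpty _ ih => exact .str (.par (.proc q (.selEmpty _)) (.refl _)) (ih hb) (.refl _)

theorem step_of_head₂ {p q : Pid} {σ σ' : State Pid Var Val} {a b B₁ B₁' B₂ B₂'}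
    (h₁ : Beh.LH a B₁ B₁') (h₂ : Beh.LH b B₂ B₂')
    (hb : ∀ B₁ B₁' B₂ B₂', Head a B₁ B₁' → Head b B₂ B₂' →
      Step L (par (proc p B₁) (proc q B₂), σ) (par (proc p B₁') (proc q B₂'), σ'))
    (N : Net Pid Var Expr Lbl) :
    Step L (par (proc p B₁) (par (proc q B₂) N), σ) (par (proc p B₁') (par (proc q B₂') N), σ') :=
  .str (.parAssoc' _ _ _) (.par N (step_of_head h₁ fun _ _ hd₁ =>
    .str (.parComm _ _) (step_of_head h₂ fun _ _ hd₂ =>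
      .str (.parComm _ _) (hb _ _ _ _ hd₁ hd₂) (.parComm _ _)) (.parComm _ _))) (.parAssoc _ _ _)

/-- A network performs an action if its participants do. -/
theorem step_prod {A A' : Pid → Beh Pid Var Expr Lbl} {l : List Pid} (hl : l.Nodup)
    {lab : Lab Pid Var Expr Lbl} (hp : lab.Proper) {σ σ' : State Pid Var Val}
    (hf : lab.Fires L σ σ') (hi : ∀ r, lab.Inv r → r ∈ l) (hn : ∀ r, ¬ lab.Inv r → A' r = A r)
    (hA : ∀ r a, Loc lab r a → Beh.LH a (A r) (A' r)) :
    Step L (prod A l, σ) (prod A' l, σ') := by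
  -- The two participants are moved to the front of the product; all remaining components are
  -- unchanged.
  have two : ∀ p q, p ≠ q → p ∈ l → q ∈ l → (∀ r, lab.Inv r → r = p ∨ r = q) →
      (∀ N, Step L (par (proc p (A p)) (par (proc q (A q)) N), σ)
        (par (proc p (A' p)) (par (proc q (A' q)) N), σ')) →
      Step L (prod A l, σ) (prod A' l, σ') := by
    intro p q hpq hpl hql hr h
    have hperm : l.Perm (p :: q :: (l.erase p).erase q) :=
      (List.perm_cons_erase hpl).trans
        ((List.perm_cons_erase ((List.mem_erase_of_ne hpq.symm).2 hql)).cons p)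
    refine .str (.prod_perm A hperm) ?_ (.prod_perm A' hperm.symm)
    have he : prod A' ((l.erase p).erase q) = prod A ((l.erase p).erase q) := by
      refine prod_congr fun r hm => hn r fun hi => ?_
      rcases hr r hi with rfl | rfl
      · exact ((hl.mem_erase_iff).1 (List.mem_of_mem_erase hm)).1 rfl
      · exact (((hl.erase p).mem_erase_iff).1 hm).1 rfl
    have := h (prod A ((l.erase p).erase q))
    nth_rewrite 2 [← he] at this
    exact this
  cases lab with
  | com η =>
    refine two η.src η.tgt hp (hi _ (.inl rfl)) (hi _ (.inr rfl))
      (fun r h => h.imp Eq.symm Eq.symm)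
      (step_of_head₂ (hA _ _ (.send η)) (hA _ _ (.recv η)) fun _ _ _ _ h₁ h₂ => ?_)
    cases h₁ with | com _ h₁ => cases h₂ with | com _ h₂ =>
    cases hf
    exact .com _ _ _ _ _ _ _ _ _ h₁ h₂
  | sel φ =>
    refine two φ.src φ.tgt hp (hi _ (.inl rfl)) (hi _ (.inr rfl))
      (fun r h => h.imp Eq.symm Eq.symm)
      (step_of_head₂ (hA _ _ (.sel φ)) (hA _ _ (.br φ)) fun _ _ _ _ h₁ h₂ => ?_)
    cases hf
    cases h₁ with | sel _ h₁ =>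
    generalize hb : BAct.br _ _ = b at h₂
    cases h₂ with
    | br f l =>
      obtain ⟨h₀, h⟩ := BAct.br.inj hb
      rw [h] at h₁ ⊢
      rw [← h₀]
      exact .sel _ _ _ _ _ f l _ h₁
    | com | sel | iteTrue | iteFalse => cases hb
  | cond p e b =>
    obtain ⟨hb, rfl⟩ := hf
    have hperm := List.perm_cons_erase (hi p rfl)
    refine .str (.prod_perm A hperm) ?_ (.prod_perm A' hperm.symm)
    have he : prod A' (l.erase p) = prod A (l.erase p) := by
      refine prod_congr fun r hm => hn r fun hi => ?_
      cases hi
      exact ((hl.mem_erase_iff).1 hm).1 rfl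
    change Step L (par (proc p (A p)) (prod A (l.erase p)), _)
      (par (proc p (A' p)) (prod A' (l.erase p)), _)
    rw [he]
    refine step_of_head (hA _ _ (.cond p e b)) fun _ _ h => .par _ ?_
    cases h with
    | iteTrue => exact .iteTrue _ _ _ _ _ (hb.2 rfl)
    | iteFalse => exact .iteFalse _ _ _ _ _ fun h => by simpa using hb.1 h

end Simulation

end Net

/-- `k` steps of `S`, up to `P` on the first component. -/
inductive Reach {α β : Type*} (P : α → α → Prop) (S : α × β → α × β → Prop) :
    ℕ → α × β → α × β → Prop
  | pre {a b} (s) : P a b → Reach P S 0 (a, s) (b, s)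
  | step {x y} : S x y → Reach P S 1 x y
  | trans {m n x y z} : Reach P S m x y → Reach P S n y z → Reach P S (m + n) x z

/-- Since `S` is closed under `P` on both sides, structural moves are absorbed by any neighbouring
step; they remain visible only when there is no step at all. -/
theorem Reach.cases_zero_pos {α β : Type*} {P : α → α → Prop} {S : α × β → α × β → Prop}
    (hP : ∀ a b c, P a b → P b c → P a c)
    (hl : ∀ a b s y, P a b → S (b, s) y → S (a, s) y)
    (hr : ∀ x a b s, S x (a, s) → P a b → S x (b, s)) {k x y} (h : Reach P S k x y) :
    (k = 0 ∧ P x.1 y.1 ∧ x.2 = y.2) ∨ (0 < k ∧ Relation.TransGen S x y) := by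
  induction h with
  | pre s h => exact .inl ⟨rfl, h, rfl⟩
  | step h => exact .inr ⟨Nat.one_pos, .single h⟩
  | @trans m n x y z _ _ ih₁ ih₂ =>
    obtain ⟨x₁, x₂⟩ := x
    obtain ⟨y₁, y₂⟩ := y
    obtain ⟨z₁, z₂⟩ := z
    rcases ih₁ with ⟨rfl, h₁, h₁'⟩ | ⟨hm, h₁⟩ <;> rcases ih₂ with ⟨rfl, h₂, h₂'⟩ | ⟨hn, h₂⟩
    · exact .inl ⟨rfl, hP _ _ _ h₁ h₂, h₁'.trans h₂'⟩
    · refine .inr ⟨by omega, ?_⟩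
      cases h₁'
      obtain ⟨w, hw, hw'⟩ := (Relation.TransGen.head'_iff).1 h₂
      exact .head' (hl _ _ _ _ h₁ hw) hw'
    · refine .inr ⟨by omega, ?_⟩
      cases h₂'
      obtain ⟨w, hw, hw'⟩ := (Relation.TransGen.tail'_iff).1 h₁
      exact .tail' hw (hr _ _ _ _ hw' h₂)
    · exact .inr ⟨by omega, h₁.trans h₂⟩

/-! ### Sequential runs, and the two simulations -/

section Soundness

variable {Pid Var Val Expr Lbl : Type*} [DecidableEq Pid] [DecidableEq Var] [DecidableEq Expr]
  [DecidableEq Lbl]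

open Chor

theorem Beh.Pre.eq_nil {B : Beh Pid Var Expr Lbl} (h : Beh.Pre .nil B) : B = .nil := by
  generalize hA : Beh.nil = A at h
  induction h with
  | refl => exact rfl
  | trans _ _ ih₁ ih₂ => exact (ih₂ (ih₁ hA ▸ hA)).trans (ih₁ hA)
  | _ => cases hA

variable (L : ExprLang Var Val Expr)

theorem Chor.Good.of_wrap {l : List (Chor Pid Var Expr Lbl)} {C} (h : (wrap l C).Good L []) :
    ∃ Γ, C.Good L Γ := by
  induction l generalizing C with
  | nil => exact ⟨_, h⟩
  | cons A l ih => exact (ih h).imp' _ fun _ h => h.2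

/-- A projection of the hole extends to the definitions around it. -/
theorem Proj.exists_wrap {r : Pid} {Q : Beh Pid Var Expr Lbl → Prop}
    (hQ : ∀ A B, Q B → Q (.recd A B)) {l : List (Chor Pid Var Expr Lbl)} {C}
    (h : ∀ Γ, C.Good L Γ → ∃ B, Proj r Γ C B ∧ Q B) (hC : (wrap l C).Good L []) :
    ∃ B, Proj r [] (wrap l C) B ∧ Q B := by
  induction l generalizing C with
  | nil => exact h _ hC
  | cons A l ih =>
    refine ih (fun Γ hg => ?_) hC
    obtain ⟨B, hB, hq⟩ := h _ hg.2
    obtain ⟨B₂, hB₂⟩ := hg.1.2.2 r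
    by_cases hr : r ∈ pn (∅ :: Γ) A
    · exact ⟨_, .recIn hr hB₂ hB, hQ _ _ hq⟩
    · exact ⟨_, .recOut hr hB, hq⟩

variable {L}

theorem Proj.wrap_congr {r : Pid} {l : List (Chor Pid Var Expr Lbl)} {C C'}
    (h : ∀ Γ B, Proj r Γ C B ↔ Proj r Γ C' B) {Γ B} :
    Proj r Γ (wrap l C) B ↔ Proj r Γ (wrap l C') B := by
  induction l generalizing C C' with
  | nil => exact h _ _
  | cons A l ih =>
    refine ih fun Γ B => ⟨fun hB => ?_, fun hB => ?_⟩
    · cases hB with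
      | recIn hr h₂ h₁ => exact .recIn hr h₂ ((h _ _).1 h₁)
      | recOut hr h₁ => exact .recOut hr ((h _ _).1 h₁)
    · cases hB with
      | recIn hr h₂ h₁ => exact .recIn hr h₂ ((h _ _).2 h₁)
      | recOut hr h₁ => exact .recOut hr ((h _ _).2 h₁)

theorem Proj.com_empty_iff {r : Pid} {Γ} {C : Chor Pid Var Expr Lbl} {B} :
    Proj r Γ (.com ∅ C) B ↔ Proj r Γ C B := by
  have e : ∀ B : Beh Pid Var Expr Lbl,
      Beh.comOpt (actsOf r (∅ : Finset (Com Pid Var Expr))) B = B := fun B => by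
    simp [actsOf, Beh.comOpt]
  refine ⟨fun h => ?_, fun h => by simpa only [e] using Proj.com ∅ h⟩
  cases h with | com _ h => rwa [e]

theorem Proj.sel_empty_iff {r : Pid} {Γ} {C : Chor Pid Var Expr Lbl} {B} :
    Proj r Γ (.sel ∅ C) B ↔ Proj r Γ C B := by
  have e : ∀ B : Beh Pid Var Expr Lbl,
      Beh.selOpt (selsOf r (∅ : Finset (Sel Pid Lbl))) B = B := fun B => by
    simp [selsOf, Beh.selOpt]
  refine ⟨fun h => ?_, fun h => by simpa only [e] using Proj.selSend ∅ (by simp) h⟩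
  cases h with
  | selRecv _ _ hφ => simp at hφ
  | selSend _ _ h => rwa [e]

variable (L)

/-- A structural transformation of choreographies that their projections follow. -/
def Silent (C C' : Chor Pid Var Expr Lbl) : Prop :=
  Pre L C C' ∧ ∀ r, (∀ B, Proj r [] C B → ∃ B', Proj r [] C' B' ∧ Beh.Pre B B') ∧
    ∀ B', Proj r [] C' B' → ∃ B, Proj r [] C B ∧ Beh.Pre B B'

theorem Silent.of_iff {C C' : Chor Pid Var Expr Lbl} (h : Pre L C C')
    (h' : ∀ r B, Proj r [] C B ↔ Proj r [] C' B) : Silent L C C' :=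
  ⟨h, fun r => ⟨fun B hB => ⟨B, (h' r B).1 hB, .refl _⟩, fun B hB => ⟨B, (h' r B).2 hB, .refl _⟩⟩⟩

/-- No conditional stands between the invocation and its definitions, so nothing is merged, and
projection commutes with unfolding exactly rather than up to pruning. -/
theorem Silent.call {l : List (Chor Pid Var Expr Lbl)} {k} (hC : (wrap l (Chor.call k)).Good L []) :
    Silent L (wrap l (Chor.call k)) (wrap l (Chor.unf l (Chor.call k))) := by
  have hp : Pre L (wrap l (Chor.call k)) (wrap l (Chor.unf l (Chor.call k))) := by
    have := Pre.unf L (wrap l (Chor.call k))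
    rwa [unf_wrap, List.append_nil] at this
  refine ⟨hp, fun r => ⟨fun B hB => ⟨_, hB.unf_wrap_call hC, .unf B⟩, fun B' hB' => ?_⟩⟩
  -- For the converse direction the folded choreography must be shown projectable: the invocation
  -- always is, and the definitions are by `Good`. Uniqueness of projections then identifies `B'`.
  have key : ∀ Γ, (Chor.call k : Chor Pid Var Expr Lbl).Good L Γ →
      ∃ B, Proj r Γ (Chor.call k : Chor Pid Var Expr Lbl) B ∧ True := fun Γ hg => by
    have hk : Γ[k]? = some (Γ[k]'hg) := List.getElem?_eq_getElem hg
    by_cases hr : r ∈ Γ[k]'hg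
    · exact ⟨_, .callIn k hk hr, trivial⟩
    · exact ⟨_, .callOut k hk hr, trivial⟩
  obtain ⟨B, hB, -⟩ := Proj.exists_wrap L (fun _ _ _ => trivial) key hC
  refine ⟨B, hB, ?_⟩
  rw [hB'.functional (hB.unf_wrap_call hC) (hC.pre hp).wf]
  exact .unf B

theorem Silent.nil {l : List (Chor Pid Var Expr Lbl)} (hC : (wrap l Chor.nil).Good L []) :
    Silent L (wrap l Chor.nil) Chor.nil := by
  have key : ∀ r, ∃ B, Proj r [] (wrap l (Chor.nil : Chor Pid Var Expr Lbl)) B ∧ Beh.Pre B .nil :=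
    fun r => Proj.exists_wrap L (fun A B h => .trans (.recd A h) (.defNil A))
      (fun Γ _ => ⟨_, .nil Γ, .refl _⟩) hC
  refine ⟨.wrap_nil L l, fun r => ⟨fun B hB => ⟨_, .nil _, ?_⟩, fun B' hB' => ?_⟩⟩
  · obtain ⟨B', hB', h⟩ := key r
    rwa [hB.functional hB' hC.wf]
  · cases hB'
    exact key r

/-- A run consisting of `k` actions. -/
inductive Run : ℕ → Chor Pid Var Expr Lbl × State Pid Var Val →
    Chor Pid Var Expr Lbl × State Pid Var Val → Prop
  | act {lab : Lab Pid Var Expr Lbl} {C C' σ σ'} : Ext lab C C' → lab.Proper → lab.Fires L σ σ' →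
      Run 1 (C, σ) (C', σ')
  | silent {C C'} (σ) : Silent L C C' → Run 0 (C, σ) (C', σ)
  | trans {m n x y z} : Run m x y → Run n y z → Run (m + n) x z

variable {L}

theorem Run.reach {k} {x y : Chor Pid Var Expr Lbl × State Pid Var Val} (h : Run L k x y)
    (hx : x.1.Good L []) : y.1.Good L [] ∧ Reach (Chor.Pre L) (Chor.Step L) k x y := by
  induction h with
  | act h hl hf =>
    have hs := h.step hl hx.wf hf
    exact ⟨Chor.Good.step hs hx, .step hs⟩
  | silent σ h => exact ⟨hx.pre h.1, .pre σ h.1⟩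
  | trans _ _ ih₁ ih₂ =>
    obtain ⟨hy, h₁⟩ := ih₁ hx
    obtain ⟨hz, h₂⟩ := ih₂ hy
    exact ⟨hz, .trans h₁ h₂⟩

/-- A run without actions need not be a reduction sequence, so its end cannot serve as `C''` in part
1; its start can, once the projections are pulled back. -/
theorem Run.proj_of_zero {k} {x y : Chor Pid Var Expr Lbl × State Pid Var Val} (h : Run L k x y)
    (hk : k = 0) {r B'} (hB' : Proj r [] y.1 B') : ∃ B, Proj r [] x.1 B ∧ Beh.Pre B B' := by
  induction h generalizing B' with
  | act => cases hk
  | silent σ h => exact (h.2 r).2 _ hB'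
  | trans _ _ ih₁ ih₂ =>
    obtain ⟨B₂, h₂, h₂'⟩ := ih₂ (by omega) hB'
    obtain ⟨B₁, h₁, h₁'⟩ := ih₁ (by omega) h₂
    exact ⟨B₁, h₁, .trans h₁' h₂'⟩

/-- The machine's treatment of a whole group is realised one communication at a time by `upd_cons`;
the exhausted group is then removed silently. -/
theorem run_com {l : List (Chor Pid Var Expr Lbl)} {H : Finset (Com Pid Var Expr)}
    (hH : WFCom L H) (C) (σ : State Pid Var Val) :
    Run L H.card (wrap l (.com H C), σ) (wrap l C, upd L H σ) := by
  induction H using Finset.cons_induction generalizing σ with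
  | empty =>
    rw [upd_empty]
    exact .silent σ (.of_iff L (.wrap L l (.comEmpty C)) fun r B =>
      Proj.wrap_congr fun _ _ => Proj.com_empty_iff)
  | cons η H hη ih =>
    rw [upd_cons hη hH, Finset.card_cons, Nat.add_comm]
    exact .trans (.act ((Ext.hereCom η H hη C).wrap l) (hH.1 η (Finset.mem_cons_self η H)) rfl)
      (ih (hH.mono (Finset.subset_cons hη)) _)

theorem run_sel {l : List (Chor Pid Var Expr Lbl)} {Φ : Finset (Sel Pid Lbl)}
    (hΦ : WFSel Φ) (C) (σ : State Pid Var Val) :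
    Run L Φ.card (wrap l (.sel Φ C), σ) (wrap l C, σ) := by
  induction Φ using Finset.cons_induction with
  | empty =>
    exact .silent σ (.of_iff L (.wrap L l (.selEmpty C)) fun r B =>
      Proj.wrap_congr fun _ _ => Proj.sel_empty_iff)
  | cons φ Φ hφ ih =>
    rw [Finset.card_cons, Nat.add_comm]
    exact .trans (.act ((Ext.hereSel φ Φ hφ C).wrap l) (hΦ.1 φ (Finset.mem_cons_self φ Φ)) rfl)
      (ih (hΦ.mono (Finset.subset_cons hφ)))

theorem run_mstep (c : Cfg Pid Var Val Expr Lbl) (hc : (wrap c.1 c.2.1).Good L []) :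
    ∃ k, (mstep L c).2.2.2 = c.2.2.2 + k ∧ Run L k (wrap c.1 c.2.1, c.2.2.1)
      (wrap (mstep L c).1 (mstep L c).2.1, (mstep L c).2.2.1) := by
  obtain ⟨l, C, σ, n⟩ := c
  obtain ⟨Γ, hg⟩ := hc.of_wrap L
  cases C with
  | com H C => exact ⟨_, rfl, run_com hg.1 C σ⟩
  | sel Φ C => exact ⟨_, rfl, run_sel hg.1 C σ⟩
  | ite p e C₁ C₂ =>
    refine ⟨1, rfl, ?_⟩
    by_cases h : L.eval e (σ p) = L.tt
    · simp only [mstep, if_pos h]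
      exact .act ((Ext.hereTrue p e C₁ C₂).wrap l) trivial ⟨by simpa using h, rfl⟩
    · simp only [mstep, if_neg h]
      exact .act ((Ext.hereFalse p e C₁ C₂).wrap l) trivial ⟨by simpa using h, rfl⟩
  -- Pushing a definition onto the list leaves the wrapped choreography literally the same.
  | recd A C => exact ⟨0, rfl, .silent σ (.of_iff L (.refl _) fun _ _ => .rfl)⟩
  | call k => exact ⟨0, rfl, .silent σ (.call L hc)⟩
  | nil => exact ⟨0, rfl, .silent σ (.nil L hc)⟩

theorem run_mstep_iterate (i : ℕ) (c : Cfg Pid Var Val Expr Lbl)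
    (hc : (wrap c.1 c.2.1).Good L []) :
    ∃ k, ((mstep L)^[i] c).2.2.2 = c.2.2.2 + k ∧ Run L k (wrap c.1 c.2.1, c.2.2.1)
      (wrap ((mstep L)^[i] c).1 ((mstep L)^[i] c).2.1, ((mstep L)^[i] c).2.2.1) := by
  induction i generalizing c with
  | zero => exact ⟨0, rfl, .silent _ (.of_iff L (.refl _) fun _ _ => .rfl)⟩
  | succ i ih =>
    obtain ⟨k, hk, h⟩ := run_mstep c hc
    obtain ⟨j, hj, h'⟩ := ih _ (h.reach hc).1
    exact ⟨k + j, by rw [Function.iterate_succ_apply, hj, hk, Nat.add_assoc], h.trans h'⟩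

/-- The projections of `C` are prunings of the behaviours `A`, which are trivial outside `l`. -/
def Sim (l : List Pid) (C : Chor Pid Var Expr Lbl) (A : Pid → Beh Pid Var Expr Lbl) : Prop :=
  (∀ r, ∃ B, Proj r [] C B ∧ Beh.Prune B (A r)) ∧ ∀ r ∉ l, A r = .nil

theorem Beh.LH.ne_nil {a} {B B' : Beh Pid Var Expr Lbl} (h : Beh.LH a B B') : B ≠ .nil := by
  rintro rfl
  cases h

/-- Networks follow the runs of choreographies. -/
theorem Run.net {k} {x y : Chor Pid Var Expr Lbl × State Pid Var Val} (h : Run L k x y)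
    (hx : x.1.Good L []) {l : List Pid} (hl : l.Nodup) {A} (hA : Sim l x.1 A) :
    ∃ A', Sim l y.1 A' ∧ Reach Net.Pre (Net.Step L) k (Net.prod A l, x.2) (Net.prod A' l, y.2) := by
  induction h generalizing A with
  | @act lab C C' σ σ' h hp hf =>
    have key : ∀ r, ∃ A', (∃ B', Proj r [] C' B' ∧ Beh.Prune B' A') ∧
        ((¬ lab.Inv r ∧ A' = A r) ∨ ∃ a, Loc lab r a ∧ Beh.LH a (A r) A') := fun r => by
      obtain ⟨B, hB, hBA⟩ := hA.1 r
      obtain ⟨B', hB', ⟨hi, hp⟩ | ⟨a, ha, h⟩⟩ := h.proj hp hx.wf hB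
      · exact ⟨A r, ⟨B', hB', hp.trans hBA⟩, .inl ⟨hi, rfl⟩⟩
      · obtain ⟨A', h', hp'⟩ := h.prune hBA
        exact ⟨A', ⟨B', hB', hp'⟩, .inr ⟨a, ha, h'⟩⟩
    choose A' h₁ h₂ using key
    have hnot : ∀ r, ¬ lab.Inv r → A' r = A r := fun r hr => by
      rcases h₂ r with ⟨-, h⟩ | ⟨a, ha, -⟩
      · exact h
      · exact absurd ha.inv hr
    have hloc : ∀ r a, Loc lab r a → Beh.LH a (A r) (A' r) := fun r a ha => by
      rcases h₂ r with ⟨hi, -⟩ | ⟨a', ha', h⟩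
      · exact absurd ha.inv hi
      · rwa [ha.functional hp ha']
    -- Participants act, and the behaviours outside `l` are `nil`.
    have hmem : ∀ r, lab.Inv r → r ∈ l := fun r hr => by
      by_contra hrl
      obtain ⟨a, ha⟩ := hr.exists_loc
      exact (hloc r a ha).ne_nil (hA.2 r hrl)
    refine ⟨A', ⟨h₁, fun r hr => ?_⟩, .step (Net.step_prod hl hp hf hmem hnot hloc)⟩
    rw [hnot r fun hi => hr (hmem r hi), hA.2 r hr]
  | silent σ h =>
    have key : ∀ r, ∃ A', (∃ B', Proj r [] _ B' ∧ Beh.Prune B' A') ∧ Beh.Pre (A r) A' := fun r => by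
      obtain ⟨B, hB, hBA⟩ := hA.1 r
      obtain ⟨B', hB', hp⟩ := (h.2 r).1 B hB
      obtain ⟨A', h₁, h₂⟩ := hBA.pre hp
      exact ⟨A', ⟨B', hB', h₂⟩, h₁⟩
    choose A' h₁ h₂ using key
    refine ⟨A', ⟨h₁, fun r hr => ?_⟩, .pre σ (.prod fun r _ => h₂ r)⟩
    have := h₂ r
    rw [hA.2 r hr] at this
    exact this.eq_nil
  | trans h₁ _ ih₁ ih₂ =>
    obtain ⟨A₁, hA₁, hr₁⟩ := ih₁ hx hA
    obtain ⟨A₂, hA₂, hr₂⟩ := ih₂ (h₁.reach hx).1 hA₁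
    exact ⟨A₂, hA₂, hr₁.trans hr₂⟩

/-- The endpoint projection lists only the processes that occur; the others project to `nil`, which
is also what an absent process counts as. -/
theorem exists_epp_prune {C : Chor Pid Var Expr Lbl} {B : Pid → Beh Pid Var Expr Lbl}
    (hB : ∀ r, Proj r [] C (B r)) {N : Net Pid Var Expr Lbl} (hN : N.names.Nodup)
    (h : ∀ r, ∃ A A', Relation.EqvGen Beh.Pre (B r) A ∧ Beh.Prune A A' ∧
      Relation.EqvGen Beh.Pre A' (N.beh r)) : ∃ N', EPP C N' ∧ Net.Prune N' N := by
  refine ⟨_, ⟨B, fun p _ => hB p, rfl⟩, Net.prune_of_beh ?_ hN fun r => ?_⟩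
  · rw [Net.names_prod]
    exact Finset.nodup_toList _
  · rw [Net.beh_prod]
    split
    · exact h r
    · rename_i hr
      rw [← (hB r).eq_nil (by simpa using hr)]
      exact h r

/-- The network simulates the choreography. -/
theorem epp_complete {C : Chor Pid Var Expr Lbl} (hC : C.Good L [])
    {B : Pid → Beh Pid Var Expr Lbl} (hB : ∀ r, Proj r [] C (B r)) {l : List Pid} (hl : l.Nodup)
    (hn : ∀ r ∉ l, B r = .nil) {σ σ' : State Pid Var Val} {C'} (h : Chor.Step L (C, σ) (C', σ')) :
    ∃ (N : Net Pid Var Expr Lbl) (C'' : Chor Pid Var Expr Lbl) (σ'' : State Pid Var Val)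
      (N'' : Net Pid Var Expr Lbl), EPP C'' N'' ∧ Net.Prune N'' N ∧
      Relation.ReflTransGen (Chor.Step L) (C', σ') (C'', σ'') ∧
      Relation.TransGen (Net.Step L) (Net.prod B l, σ) (N, σ'') := by
  have hC' : C'.Good L [] := Chor.Good.step h hC
  -- The two machine runs meet after `i` and `j` transitions; the counter of the second starts at
  -- `1`, for the step already performed.
  obtain ⟨i, j, hij⟩ := Join.of_step h [] 0
  obtain ⟨k, hk, hr⟩ := run_mstep_iterate (L := L) i ([], C, σ, 0) hC
  obtain ⟨k', hk', hr'⟩ := run_mstep_iterate (L := L) j ([], C', σ', 0 + 1) hC'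
  change (mstep L)^[i] ([], C, σ, 0) = (mstep L)^[j] ([], C', σ', 0 + 1) at hij
  rw [hij] at hk hr
  generalize (mstep L)^[j] ([], C', σ', 0 + 1) = d at hk hr hk' hr'
  obtain ⟨l', D, τ, n⟩ := d
  simp only [wrap] at hk hr hk' hr'
  generalize wrap l' D = D at hr hr'
  obtain ⟨A, hA, hN⟩ := hr.net hC hl (A := B) ⟨fun r => ⟨_, hB r, .refl _⟩, hn⟩
  have hN : Relation.TransGen (Net.Step L) (Net.prod B l, σ) (Net.prod A l, τ) := by
    rcases hN.cases_zero_pos (fun _ _ _ h₁ h₂ => .trans h₁ h₂) (fun _ _ _ _ h₁ h₂ =>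
      .str h₁ h₂ (.refl _)) (fun _ _ _ _ h₁ h₂ => .str (.refl _) h₁ h₂) with ⟨h, -⟩ | ⟨-, h⟩
    -- Equal final counters give `k = k' + 1`, so the network does perform a step.
    · omega
    · exact h
  have hnames : (Net.prod A l).names.Nodup := by rwa [Net.names_prod]
  have hbeh : ∀ r, (Net.prod A l).beh r = A r := fun r => by
    rw [Net.beh_prod]
    split
    · rfl
    · rw [hA.2 r ‹_›]
  suffices ∃ C'', Relation.ReflTransGen (Chor.Step L) (C', σ') (C'', τ) ∧
      ∀ r B', Proj r [] D B' → ∃ B, Proj r [] C'' B ∧ Beh.Pre B B' by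
    obtain ⟨C'', hs, hb⟩ := this
    choose B₁ h₁ h₂ using hA.1
    choose B₂ h₃ h₄ using fun r => hb r (B₁ r) (h₁ r)
    obtain ⟨N'', hE, hP⟩ := exists_epp_prune h₃ hnames fun r =>
      ⟨B₁ r, A r, .rel _ _ (h₄ r), h₂ r, by rw [hbeh]; exact .refl _⟩
    exact ⟨_, C'', τ, N'', hE, hP, hs, hN⟩
  -- If the run from `C'` has no action, take `C'` itself as `C''`; otherwise take the common
  -- configuration `D`.
  rcases (hr'.reach hC').2.cases_zero_pos (fun _ _ _ h₁ h₂ => .trans h₁ h₂) (fun _ _ _ _ h₁ h₂ =>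
      .str h₁ h₂ (.refl _)) (fun _ _ _ _ h₁ h₂ => .str (.refl _) h₁ h₂) with ⟨h₀, -, hσ⟩ | ⟨-, h⟩
  · cases hσ
    exact ⟨C', .refl, fun r B' hB' => hr'.proj_of_zero h₀ hB'⟩
  · exact ⟨D, h.to_reflTransGen, fun r B' hB' => ⟨B', hB', .refl _⟩⟩

/-- An action has at most two participants, so the larger of two bounds works for all of them. -/
theorem Lab.exists_forall_ge (lab : Lab Pid Var Expr Lbl) {P : Pid → ℕ → Prop}
    (h : ∀ r, lab.Inv r → ∃ n₀, ∀ n ≥ n₀, P r n) : ∃ n, ∀ r, lab.Inv r → P r n := by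
  have two : ∀ p q, (∀ r, lab.Inv r ↔ p = r ∨ q = r) → ∃ n, ∀ r, lab.Inv r → P r n := by
    intro p q hpq
    obtain ⟨m, hm⟩ := h p ((hpq p).2 (.inl rfl))
    obtain ⟨n, hn⟩ := h q ((hpq q).2 (.inr rfl))
    refine ⟨max m n, fun r hr => ?_⟩
    rcases (hpq r).1 hr with rfl | rfl
    · exact hm _ (le_max_left _ _)
    · exact hn _ (le_max_right _ _)
  cases lab with
  | com η => exact two η.src η.tgt fun _ => .rfl
  | sel φ => exact two φ.src φ.tgt fun _ => .rfl
  | cond p e b => exact two p p fun _ => (or_self_iff).symm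

/-- The choreography simulates the network. -/
theorem epp_sound {C : Chor Pid Var Expr Lbl} (hC : C.Good L [])
    {B : Pid → Beh Pid Var Expr Lbl} (hB : ∀ r, Proj r [] C (B r)) {l : List Pid} (hl : l.Nodup)
    (hn : ∀ r ∉ l, B r = .nil) {σ σ' : State Pid Var Val} {N}
    (h : Net.Step L (Net.prod B l, σ) (N, σ')) :
    ∃ (C' : Chor Pid Var Expr Lbl) (N' : Net Pid Var Expr Lbl),
      EPP C' N' ∧ Net.Prune N' N ∧ Chor.Step L (C, σ) (C', σ') := by
  obtain ⟨hN, -, lab, hp, hf, hv⟩ := h.view (by rwa [Net.names_prod])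
  have hbeh : ∀ r, (Net.prod B l).beh r = B r := fun r => by
    rw [Net.beh_prod]
    split
    · rfl
    · rw [hn r ‹_›]
  simp only [hbeh] at hv
  -- A single number of unfoldings exposes the local actions of all participants.
  obtain ⟨n, hn'⟩ := lab.exists_forall_ge (P := fun r n => ∃ a, Loc lab r a ∧
      ∃ B', Beh.LH a ((Beh.unf [])^[n] (B r)) B' ∧ Beh.BEq [] B' (N.beh r)) fun r hr => by
    rcases hv r with ⟨hi, -⟩ | ⟨a, ha, B₁, hc, he⟩
    · exact absurd hr hi
    · obtain ⟨n₀, h⟩ := hc.exists_LH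
      refine ⟨n₀, fun n hn => ⟨a, ha, ?_⟩⟩
      obtain ⟨B₂, h₁, h₂⟩ := h n hn
      exact ⟨B₂, h₁, h₂.trans he⟩
  have hpre := Chor.Pre.unf_iterate (L := L) n C
  have hD := hC.pre hpre
  choose B₁ h₁ h₂ using fun r => (hB r).unf_iterate n hC
  -- The actual projections `B₁` are prunings of the unfolded behaviours, so the shapes of the heads
  -- descend to them.
  obtain ⟨C', hE⟩ := Ext.exists (lab := lab) (Γ := []) hD.wf fun r a ha => by
    obtain ⟨a', ha', B', h', -⟩ := hn' r ha.inv
    rw [ha'.functional hp ha] at h'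
    exact ⟨_, h₁ r, h'.can.of_prune (h₂ r)⟩
  choose B₂ h₃ h₄ using fun r => hE.proj hp hD.wf (h₁ r)
  -- Non-participants: the new projection prunes the unfolded old behaviour, which is equivalent to
  -- the one in `N`. Participants: the action of `B₁` lifts along pruning to the unfolded behaviour,
  -- where determinism of `LH` identifies the outcome with that of the network step.
  obtain ⟨N', hN', hP⟩ := exists_epp_prune h₃ hN fun r => by
    rcases h₄ r with ⟨hi, hpr⟩ | ⟨a, ha, hLH⟩
    · rcases hv r with ⟨-, he⟩ | ⟨a, ha, -⟩
      · exact ⟨_, _, .refl _, hpr.trans (h₂ r), ((Beh.BEq.unf_iterate _ n _).symm.trans he).eqvGen⟩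
      · exact absurd ha.inv hi
    · obtain ⟨a', ha', B', h', he⟩ := hn' r ha.inv
      rw [ha'.functional hp ha] at h'
      obtain ⟨A, hA, hAp⟩ := hLH.prune (h₂ r)
      rw [hA.functional h'] at hAp
      exact ⟨_, _, .refl _, hAp, he.eqvGen⟩
  exact ⟨C', N', hN', hP, .str hpre (hE.step hp hD.wf hf) (.refl _)⟩

end Soundness
end Multicom

open Multicom in
theorem mainTheorem3 {Pid Var Val Expr Lbl : Type*}
    [DecidableEq Pid] [DecidableEq Var] [DecidableEq Expr] [DecidableEq Lbl]
    (L : ExprLang Var Val Expr) (C : Chor Pid Var Expr Lbl)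
    (hwf : C.WF L) (hcl : C.Closed)
    (N₀ : Net Pid Var Expr Lbl) (hproj : EPP C N₀) :
    (∀ (σ : State Pid Var Val) (C' : Chor Pid Var Expr Lbl) (σ' : State Pid Var Val),
      Chor.Step L (C, σ) (C', σ') →
      ∃ (N : Net Pid Var Expr Lbl) (C'' : Chor Pid Var Expr Lbl) (σ'' : State Pid Var Val)
        (N'' : Net Pid Var Expr Lbl),
        EPP C'' N'' ∧ Net.Prune N'' N ∧
        Relation.ReflTransGen (Chor.Step L) (C', σ') (C'', σ'') ∧
        Relation.TransGen (Net.Step L) (N₀, σ) (N, σ'')) ∧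
    (∀ (σ : State Pid Var Val) (N : Net Pid Var Expr Lbl) (σ' : State Pid Var Val),
      Net.Step L (N₀, σ) (N, σ') →
      ∃ (C' : Chor Pid Var Expr Lbl) (N' : Net Pid Var Expr Lbl),
        EPP C' N' ∧ Net.Prune N' N ∧ Chor.Step L (C, σ) (C', σ')) := by
  obtain ⟨B, hB, rfl⟩ := hproj
  obtain ⟨B', hBB', hB', hC⟩ := Chor.ClosedAt.good_of_epp hcl hwf hB
  -- The family `B` is arbitrary outside the occurring processes; there `B'` is an actual
  -- projection, hence `nil`.
  rw [Net.prod_congr (B' := B') fun p hp => (hBB' p (by simpa using hp)).symm]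
  have hn : ∀ r ∉ (Chor.pn [] C).toList, B' r = .nil := fun r hr =>
    (hB' r).eq_nil (by simpa using hr)
  exact ⟨fun _ _ _ h => epp_complete hC hB' (Finset.nodup_toList _) hn h,
    fun _ _ _ h => epp_sound hC hB' (Finset.nodup_toList _) hn h⟩
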